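/- Let $n\ge 1$ and let $q:\mathbb{R}^n\to\mathbb{R}$ be a continuous function, not identically zero, which is a solution of the elliptic Signorini problem $$\Delta q\le 0 \ \text{ and }\ q\,\Delta q=0 \ \text{ in } \mathbb{R}^n,\qquad \Delta q=0 \ \text{ in } \{x_n\neq 0\},\qquad q\ge 0 \ \text{ on } \{x_n=0\}.$$ Here $\Delta q\le 0$ means that $\Delta q=-\mu$ in the sense of distributions for some nonnegative locally finite Borel measure $\mu$ on $\mathbb{R}^n$; then $q\,\Delta q=0$ means that $q=0$ $\mu$-almost everywhere, and $\Delta q=0$ in $\{x_n\ne0\}$ means that $\mu(\{x_n\neq 0\})=0$. Assume that $q$ is $\lambda$-homogeneous for some $\lambda\in\mathbb{R}$, that is, $q(rx)=r^\lambda q(x)$ for all $r>0$ and $x\in\mathbb{R}^n$, and that $q$ is convex in every direction parallel to $\{x_n=0\}$, that is, $t\mapsto q(x+te)$ is convex on $\mathbb{R}$ for every $x\in\mathbb{R}^n$ and every $e\in\mathbb{R}^n$ with $e_n=0$. Then one of the following holds: - $\lambda=3/2$; - $q$ is a harmonic polynomial and $\lambda$ is an integer; - $\lambda=1$ and $q(x)=a\,x_n-b\,|x_n|$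 for some $a\in\mathbb{R}$ and $b>0$. -/

import Mathlib

open MeasureTheory Laplacian

/-- The ambient space `ℝⁿ` with `n = m + 1 ≥ 1`; its last coordinate `x (Fin.last m)` plays the
role of `x_n`, so the thin space `{x_n = 0}` is `{x | x (Fin.last m) = 0}`. -/
abbrev Space (m : ℕ) : Type := EuclideanSpace ℝ (Fin (m + 1))

/-- `q` is homogeneous of degree `lam`: `q (r x) = r ^ lam * q x` for all `r > 0`. -/
def IsHomogeneousOfDegree {m : ℕ} (q : Space m → ℝ) (lam : ℝ) : Prop :=
  ∀ r : ℝ, 0 < r → ∀ x : Space m, q (r • x) = r ^ lam * q x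

/-- `-Δ q = μ` in the sense of distributions on `ℝⁿ`: `∫ q Δφ = - ∫ φ dμ` for every
`φ ∈ C_c^∞(ℝⁿ)`. -/
def HasNegLaplacian {m : ℕ} (q : Space m → ℝ) (μ : Measure (Space m)) : Prop :=
  ∀ φ : Space m → ℝ, ContDiff ℝ (⊤ : ℕ∞) φ → HasCompactSupport φ →
    ∫ x, q x * Δ φ x = - ∫ x, φ x ∂μ

/-- Global solutions of the elliptic Signorini (thin obstacle) problem with zero obstacle on
`{x_n = 0}`. The inequality `Δ q ≤ 0` is understood as measures: `Δ q = -μ` for a (nonnegative)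
locally finite Borel measure `μ`. Accordingly `q Δ q = 0` says that the measure `q μ` vanishes,
and `Δ q = 0` on `{x_n ≠ 0}` says that `μ` gives no mass to `{x_n ≠ 0}`. -/
structure IsSignoriniSolution {m : ℕ} (q : Space m → ℝ) : Prop where
  continuous : Continuous q
  nonneg_on_thin : ∀ x : Space m, x (Fin.last m) = 0 → 0 ≤ q x
  laplacian : ∃ μ : Measure (Space m), IsLocallyFiniteMeasure μ ∧
    HasNegLaplacian q μ ∧
    (∀ᵐ x ∂μ, q x = 0) ∧
    μ {x : Space m | x (Fin.last m) ≠ 0} = 0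

/-- `q` is convex in every direction parallel to `{x_n = 0}`. -/
def IsConvexAlongThin {m : ℕ} (q : Space m → ℝ) : Prop :=
  ∀ x e : Space m, e (Fin.last m) = 0 → ConvexOn ℝ Set.univ (fun t : ℝ => q (x + t • e))

/-- `q` is a harmonic polynomial in `x_1, …, x_n`. -/
def IsHarmonicPolynomial {m : ℕ} (q : Space m → ℝ) : Prop :=
  (∃ P : MvPolynomial (Fin (m + 1)) ℝ, ∀ x : Space m, q x = MvPolynomial.eval (fun i => x i) P) ∧
    InnerProductSpace.HarmonicOnNhd q Set.univ

/-!
A continuous homogeneous function of negative degree vanishes, and one of degree zero is constant.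
If `μ = 0`, then `q` is smooth by Weyl's lemma and its derivatives of high order are homogeneous of
negative degree, hence zero, so `q` is a polynomial. Otherwise `lam > 0` and `μ ≠ 0`, and `q` may be
replaced by its part that is even in `x_n`, as the odd part is harmonic.

Convexity along the thin space and `Δ q ≤ 0` make `q` concave in `x_n`, so the normal derivative
satisfies `∂_n q ≤ 0` on `{x_n > 0}`. The contact set `{x_n = 0, q = 0}` is a closed convex cone. If
it is all of `{x_n = 0}`, then `q ≤ 0`, convexity makes `q` a function of `x_n` alone, and
`q = -b |x_n|`. If not, it lies in a half space `{⟪e, x⟫ ≤ 0}` with `e` a unit vector of the thin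
space, and we compare with the functions of degree `1/2`
`Re (± ⟪e, x⟫ + i x_n) ^ (1/2)` on `{x_n > 0}`, which are harmonic there.

Let `v` be a homogeneous function of degree `lam - 1` which is a derivative of `q`, and let `u` be
one of these functions. Cutting off by a radial function, Euler's identity turns `∫ v Δ(cut-off u)`
into `(lam - 3/2)` times an integral of `v u` against a positive radial weight.
* For `v = -∂_n q ≥ 0` and the sign `-`, the boundary term is nonnegative by convexity of `q` along
  the thin space and because `∂_n u = 0` on the contact set. Hence `lam ≥ 3/2`.
* For `v = -∂_z q ≥ 0` with `z` in the relative interior of the contact cone and the sign `+`,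
  the boundary term is nonpositive, because `u = 0` on the contact set and `∂_n u ≥ 0` on the thin
  space. Hence `lam ≤ 3/2`.

Since `u` is singular on `{⟪e, x⟫ = x_n = 0}`, it is replaced by smooth barriers converging to it.
-/

open Filter Topology Set Metric
open scoped ContDiff RealInnerProductSpace

section OneVariable

theorem tendsto_symmSlope_of_hasDerivAt {f : ℝ → ℝ} {f' x : ℝ} (h : HasDerivAt f f' x) :
    Tendsto (fun s : ℝ => (f (x + s) - f (x - s)) / (2 * s)) (𝓝[>] 0) (𝓝 f') := by
  have right : Tendsto (fun s : ℝ => s) (𝓝[>] 0) (𝓝[≠] 0) :=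
    tendsto_id.mono_left (nhdsGT_le_nhdsNE 0)
  have left : Tendsto (fun s : ℝ => -s) (𝓝[>] 0) (𝓝[≠] 0) := by
    refine Tendsto.mono_right ?_ (nhdsLT_le_nhdsNE 0)
    simpa using tendsto_neg_nhdsGT (a := (0 : ℝ))
  have slope := hasDerivAt_iff_tendsto_slope_zero.1 h
  have mean := ((slope.comp right).add (slope.comp left)).div_const 2
  rw [add_self_div_two] at mean
  refine mean.congr' ?_
  filter_upwards [self_mem_nhdsWithin] with s hs
  have : s ≠ 0 := ne_of_gt hs
  simp only [Function.comp, smul_eq_mul, ← sub_eq_add_neg]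
  field_simp
  ring

end OneVariable

section TestFunctions

variable {E : Type*} [NormedAddCommGroup E] [NormedSpace ℝ E]

/-- `φ ∈ C_c^∞(E)`. A predicate is used, rather than Mathlib's bundled test functions, to match
the quantification in `HasNegLaplacian`. -/
structure IsTestFunction (φ : E → ℝ) : Prop where
  contDiff : ContDiff ℝ ∞ φ
  hasCompactSupport : HasCompactSupport φ

/-- The derivative `∂_e ψ` of `ψ` in the direction `e`, as an operator on functions. -/
noncomputable def dirDeriv (e : E) (ψ : E → ℝ) : E → ℝ :=
  fun x => fderiv ℝ ψ x e

theorem contDiff_dirDeriv {ψ : E → ℝ} (h : ContDiff ℝ ∞ ψ) (e : E) :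
    ContDiff ℝ ∞ (dirDeriv e ψ) :=
  (h.fderiv_right (m := ∞) (by simp)).clm_apply contDiff_const

theorem differentiable_dirDeriv {ψ : E → ℝ} (h : ContDiff ℝ ∞ ψ) (e : E) :
    Differentiable ℝ (dirDeriv e ψ) :=
  (contDiff_dirDeriv h e).differentiable (by simp)

theorem dirDeriv_add_apply {φ ψ : E → ℝ} {x : E} (e : E) (hφ : DifferentiableAt ℝ φ x)
    (hψ : DifferentiableAt ℝ ψ x) :
    dirDeriv e (fun x => φ x + ψ x) x = dirDeriv e φ x + dirDeriv e ψ x := by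
  simp only [dirDeriv, fderiv_fun_add hφ hψ, add_apply]

theorem dirDeriv_sum {ι : Type*} (s : Finset ι) {φ : ι → E → ℝ} (e : E)
    (h : ∀ i ∈ s, Differentiable ℝ (φ i)) :
    dirDeriv e (fun x => ∑ i ∈ s, φ i x) = fun x => ∑ i ∈ s, dirDeriv e (φ i) x := by
  ext x
  simp only [dirDeriv, fderiv_fun_sum fun i hi => h i hi x, sum_apply]

theorem dirDeriv_mul_apply {φ ψ : E → ℝ} {x : E} (e : E) (hφ : DifferentiableAt ℝ φ x)
    (hψ : DifferentiableAt ℝ ψ x) :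
    dirDeriv e (fun x => φ x * ψ x) x = φ x * dirDeriv e ψ x + dirDeriv e φ x * ψ x := by
  simp [dirDeriv, fderiv_fun_mul hφ hψ, mul_comm]

theorem dirDeriv_dirDeriv_apply {ψ : E → ℝ} (h : ContDiff ℝ 2 ψ) (a b x : E) :
    dirDeriv a (dirDeriv b ψ) x = fderiv ℝ (fderiv ℝ ψ) x a b := by
  have hd : Differentiable ℝ (fderiv ℝ ψ) :=
    (h.fderiv_right (m := 1) (by norm_num)).differentiable (by simp)
  change fderiv ℝ (fun y => fderiv ℝ ψ y b) x a = _
  rw [fderiv_clm_apply (hd x) (differentiableAt_const _)]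
  simp

theorem dirDeriv_comm {ψ : E → ℝ} (h : ContDiff ℝ 2 ψ) (a b : E) :
    dirDeriv a (dirDeriv b ψ) = dirDeriv b (dirDeriv a ψ) := by
  ext x
  have hsymm : IsSymmSndFDerivAt ℝ ψ x := h.contDiffAt.isSymmSndFDerivAt (by simp)
  rw [dirDeriv_dirDeriv_apply h, dirDeriv_dirDeriv_apply h, hsymm]

theorem dirDeriv_comp_sub (φ : E → ℝ) (e a : E) :
    dirDeriv e (fun x => φ (x - a)) = fun x => dirDeriv e φ (x - a) := by
  ext x
  simp only [dirDeriv, fderiv_comp_sub]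

theorem hasDerivAt_comp_add_smul {ψ : E → ℝ} (h : Differentiable ℝ ψ) (x e : E) (t : ℝ) :
    HasDerivAt (fun t : ℝ => ψ (x + t • e)) (dirDeriv e ψ (x + t • e)) t := by
  have hline : HasDerivAt (fun t : ℝ => x + t • e) e t := by
    simpa using ((hasDerivAt_id t).smul_const e).const_add x
  exact (h (x + t • e)).hasFDerivAt.comp_hasDerivAt t hline

namespace IsTestFunction

variable {φ ψ : E → ℝ}

theorem continuous (hφ : IsTestFunction φ) : Continuous φ :=
  hφ.contDiff.continuous

theorem differentiable (hφ : IsTestFunction φ) : Differentiable ℝ φ :=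
  hφ.contDiff.differentiable (by simp)

theorem dirDeriv (hφ : IsTestFunction φ) (e : E) : IsTestFunction (dirDeriv e φ) :=
  ⟨contDiff_dirDeriv hφ.contDiff e, hφ.hasCompactSupport.fderiv_apply (𝕜 := ℝ) e⟩

theorem add (hφ : IsTestFunction φ) (hψ : IsTestFunction ψ) :
    IsTestFunction (fun x => φ x + ψ x) :=
  ⟨hφ.contDiff.add hψ.contDiff, hφ.hasCompactSupport.add hψ.hasCompactSupport⟩

theorem mul_left (hφ : IsTestFunction φ) {g : E → ℝ} (hg : ContDiff ℝ ∞ g) :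
    IsTestFunction (fun x => g x * φ x) :=
  ⟨hg.mul hφ.contDiff, hφ.hasCompactSupport.mul_left⟩

theorem sum {ι : Type*} (s : Finset ι) {φ : ι → E → ℝ} (h : ∀ i, IsTestFunction (φ i)) :
    IsTestFunction (fun x => ∑ i ∈ s, φ i x) := by
  classical
  induction s using Finset.induction_on with
  | empty => simpa only [Finset.sum_empty] using ⟨contDiff_const, HasCompactSupport.zero⟩
  | insert i s hi ih => simpa only [Finset.sum_insert hi] using (h i).add ih

theorem comp_sub (hφ : IsTestFunction φ) (a : E) : IsTestFunction (fun x => φ (x - a)) :=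
  ⟨hφ.contDiff.comp (contDiff_id.sub contDiff_const),
    hφ.hasCompactSupport.comp_homeomorph (Homeomorph.subRight a)⟩

end IsTestFunction

end TestFunctions

section LocallyIntegrable

theorem norm_mul_le_indicator {Ω : Type*} {f F : Ω → ℝ} {K : Set Ω} {C : ℝ}
    (hbound : ∀ x ∈ K, |F x| ≤ C) (hzero : ∀ x ∉ K, F x = 0) (x : Ω) :
    ‖f x * F x‖ ≤ K.indicator (fun x => |f x| * C) x := by
  by_cases hx : x ∈ K
  · rw [indicator_of_mem hx, norm_mul]
    exact mul_le_mul_of_nonneg_left (hbound x hx) (abs_nonneg _)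
  · simp [hzero x hx, hx]

variable {Ω : Type*} [TopologicalSpace Ω] [T2Space Ω] [MeasurableSpace Ω] [OpensMeasurableSpace Ω]
  {ν : Measure Ω} {f : Ω → ℝ} {K : Set Ω} {C : ℝ}

theorem integrable_indicator_abs_mul_const (hf : LocallyIntegrable f ν) (hK : IsCompact K) (C : ℝ) :
    Integrable (K.indicator fun x => |f x| * C) ν :=
  (integrable_indicator_iff hK.measurableSet).2 ((hf.integrableOn_isCompact hK).norm.mul_const C)

variable [SecondCountableTopology Ω]

theorem integrable_mul_of_bounded (hf : LocallyIntegrable f ν) (hK : IsCompact K) {F : Ω → ℝ}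
    (hmeas : AEStronglyMeasurable F ν) (hbound : ∀ x ∈ K, |F x| ≤ C) (hzero : ∀ x ∉ K, F x = 0) :
    Integrable (fun x => f x * F x) ν :=
  (integrable_indicator_abs_mul_const hf hK C).mono' (hf.aestronglyMeasurable.mul hmeas)
    (.of_forall (norm_mul_le_indicator hbound hzero))

theorem tendsto_integral_mul_of_bounded (hf : LocallyIntegrable f ν) (hK : IsCompact K)
    {ι : Type*} {l : Filter ι} [l.IsCountablyGenerated] {F : ι → Ω → ℝ} {G : Ω → ℝ}
    (hmeas : ∀ᶠ k in l, AEStronglyMeasurable (F k) ν)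
    (hbound : ∀ᶠ k in l, ∀ x ∈ K, |F k x| ≤ C) (hzero : ∀ᶠ k in l, ∀ x ∉ K, F k x = 0)
    (hlim : ∀ᵐ x ∂ν, Tendsto (fun k => F k x) l (𝓝 (G x))) :
    Tendsto (fun k => ∫ x, f x * F k x ∂ν) l (𝓝 (∫ x, f x * G x ∂ν)) := by
  refine tendsto_integral_filter_of_dominated_convergence _
    (hmeas.mono fun k hk => hf.aestronglyMeasurable.mul hk) ?_
    (integrable_indicator_abs_mul_const hf hK C) (hlim.mono fun x hx => hx.const_mul _)
  filter_upwards [hbound, hzero] with k hbound hzero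
  exact .of_forall (norm_mul_le_indicator hbound hzero)

theorem hasDerivAt_integral_mul_of_bounded (hf : LocallyIntegrable f ν) (hK : IsCompact K)
    {g g' : ℝ → Ω → ℝ} {s : Set ℝ} {t₀ : ℝ} (hs : s ∈ 𝓝 t₀) (hg : ∀ t, Continuous (g t))
    (hg' : Continuous (g' t₀)) (hzero : ∀ t ∈ s, ∀ y ∉ K, g t y = 0)
    (hzero' : ∀ t ∈ s, ∀ y ∉ K, g' t y = 0) (hbound : ∀ t ∈ s, ∀ y, |g' t y| ≤ C)
    (hderiv : ∀ t ∈ s, ∀ y, HasDerivAt (fun t => g t y) (g' t y) t) :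
    HasDerivAt (fun t => ∫ y, f y * g t y ∂ν) (∫ y, f y * g' t₀ y ∂ν) t₀ := by
  have hmeas {h : Ω → ℝ} (hh : Continuous h) : AEStronglyMeasurable (fun y => f y * h y) ν :=
    hf.aestronglyMeasurable.mul hh.measurable.aestronglyMeasurable
  have hint : Integrable (fun y => f y * g t₀ y) ν := by
    simpa only [smul_eq_mul, mul_comm] using
      hf.integrable_smul_left_of_hasCompactSupport (hg t₀)
        (.intro hK (hzero t₀ (mem_of_mem_nhds hs)))
  exact (hasDerivAt_integral_of_dominated_loc_of_deriv_le hs (.of_forall fun t => hmeas (hg t))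
    hint (hmeas hg')
    (.of_forall fun y t ht => norm_mul_le_indicator (f := f)
      (fun y _ => hbound t ht y) (hzero' t ht) y)
    (integrable_indicator_abs_mul_const hf hK C)
    (.of_forall fun y t ht => (hderiv t ht y).const_mul (f y))).2

end LocallyIntegrable

section TestIntegrals

variable {E : Type*} [NormedAddCommGroup E] [NormedSpace ℝ E] [MeasurableSpace E] [BorelSpace E]
  {ν : Measure E} {f φ : E → ℝ}

theorem IsTestFunction.integrable (hφ : IsTestFunction φ) (ν : Measure E)
    [IsFiniteMeasureOnCompacts ν] : Integrable φ ν :=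
  hφ.continuous.integrable_of_hasCompactSupport hφ.hasCompactSupport

theorem IsTestFunction.integrable_mul (hφ : IsTestFunction φ) (hf : LocallyIntegrable f ν) :
    Integrable (fun x => f x * φ x) ν := by
  simpa only [smul_eq_mul, mul_comm] using
    hf.integrable_smul_left_of_hasCompactSupport hφ.continuous hφ.hasCompactSupport

theorem nonneg_of_forall_integral_mul_nonneg [FiniteDimensional ℝ E] [IsFiniteMeasureOnCompacts ν]
    [ν.IsOpenPosMeasure] (hf : Continuous f)
    (h : ∀ φ : E → ℝ, IsTestFunction φ → (∀ x, 0 ≤ φ x) → 0 ≤ ∫ x, f x * φ x ∂ν) (x₀ : E) :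
    0 ≤ f x₀ := by
  by_contra! hneg
  obtain ⟨b, hsupp, hcompact, hsmooth, hrange, hone⟩ := exists_contDiff_tsupport_subset
    (n := (⊤ : ℕ∞)) ((hf.tendsto x₀).eventually (gt_mem_nhds hneg))
  have hb : IsTestFunction b := ⟨hsmooth, hcompact⟩
  have hb₀ (x : E) : 0 ≤ b x := (hrange (mem_range_self x)).1
  have hpos : 0 < ∫ x, -(f x * b x) ∂ν := by
    refine Continuous.integral_pos_of_hasCompactSupport_nonneg_nonzero (x := x₀)
      (hf.mul hb.continuous).neg (hcompact.mul_left.comp_left neg_zero) (fun x => ?_)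
      (by simp [hone, hneg.ne])
    rcases (hb₀ x).eq_or_lt with hbx | hbx
    · simp [← hbx]
    · have hfx : f x < 0 := hsupp (subset_tsupport b hbx.ne')
      simpa using mul_nonpos_of_nonpos_of_nonneg hfx.le (hb₀ x)
  rw [integral_neg] at hpos
  linarith [h b hb hb₀]

end TestIntegrals

section Translation

open scoped Convolution

theorem integral_mul_comp_sub {G : Type*} [AddGroup G] [MeasurableSpace G] [MeasurableAdd G]
    {ν : Measure G} [ν.IsAddRightInvariant] (f φ : G → ℝ) (a : G) :
    ∫ y, f y * φ (y - a) ∂ν = ∫ y, f (y + a) * φ y ∂ν := by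
  simpa using (integral_add_right_eq_self (fun y => f y * φ (y - a)) a).symm

variable {E : Type*} [NormedAddCommGroup E] [NormedSpace ℝ E] [MeasurableSpace E] [BorelSpace E]
  {ν : Measure E} [ν.IsAddLeftInvariant] {f φ : E → ℝ}

theorem IsTestFunction.integrable_comp_add_mul (hφ : IsTestFunction φ)
    (hf : LocallyIntegrable f ν) (a : E) : Integrable (fun y => f (y + a) * φ y) ν := by
  simpa using ((hφ.comp_sub a).integrable_mul hf).comp_add_right a

theorem hasDerivAt_integral_comp_add_smul_mul [SFinite ν] (hf : LocallyIntegrable f ν)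
    (hφ : IsTestFunction φ) (e : E) (t : ℝ) :
    HasDerivAt (fun t : ℝ => ∫ y, f (y + t • e) * φ y ∂ν)
      (-∫ y, f (y + t • e) * dirDeriv e φ y ∂ν) t := by
  -- The integral is the convolution of `f` with the reflected test function, evaluated at `t • e`.
  have hneg : ContDiff ℝ 1 fun y => φ (-y) :=
    (hφ.contDiff.of_le (by simp)).comp contDiff_neg
  have hneg' : HasCompactSupport fun y => φ (-y) :=
    hφ.hasCompactSupport.comp_homeomorph (Homeomorph.neg E)
  have hconv := (hneg'.hasFDerivAt_convolution_right (.mul ℝ ℝ) hf hneg (t • e)).comp_hasDerivAt t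
    ((hasDerivAt_id t).smul_const e)
  refine (hconv.congr_of_eventuallyEq (.of_forall fun s => ?_)).congr_deriv ?_
  · simp [convolution_def, ← integral_mul_comp_sub]
  · rw [one_smul, convolution_precompR_apply _ hf (hneg'.fderiv ℝ)
      (hneg.continuous_fderiv one_ne_zero), convolution_def, ← integral_mul_comp_sub,
      ← integral_neg]
    refine integral_congr_ae (.of_forall fun y => ?_)
    have hfderiv : fderiv ℝ (fun y => φ (-y)) (t • e - y) = -fderiv ℝ φ (y - t • e) := by
      simpa using fderiv_comp_smul (f := φ) (x := t • e - y) (-1 : ℝ)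
    simp [dirDeriv, hfderiv]

end Translation

section DistributionalConvexity

variable {E : Type*} [NormedAddCommGroup E] [NormedSpace ℝ E] [MeasurableSpace E] [BorelSpace E]
  {ν : Measure E} [ν.IsAddLeftInvariant] [SFinite ν] {f φ : E → ℝ} {e : E}

theorem integral_mul_dirDeriv_eq_zero_of_forall_add_smul (hf : LocallyIntegrable f ν)
    (hφ : IsTestFunction φ) (hinv : ∀ x (t : ℝ), f (x + t • e) = f x) :
    ∫ x, f x * dirDeriv e φ x ∂ν = 0 := by
  have hderiv := hasDerivAt_integral_comp_add_smul_mul hf hφ e 0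
  simp only [hinv] at hderiv
  exact neg_eq_zero.1 (hderiv.unique (hasDerivAt_const 0 _))

theorem deriv_integral_comp_add_smul_mul (hf : LocallyIntegrable f ν) (hφ : IsTestFunction φ)
    (e : E) : deriv (fun t : ℝ => ∫ y, f (y + t • e) * φ y ∂ν) =
      fun t => -∫ y, f (y + t • e) * dirDeriv e φ y ∂ν :=
  funext fun t => (hasDerivAt_integral_comp_add_smul_mul hf hφ e t).deriv

theorem hasDerivAt_deriv_integral_comp_add_smul_mul (hf : LocallyIntegrable f ν)
    (hφ : IsTestFunction φ) (e : E) (t : ℝ) :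
    HasDerivAt (deriv fun t : ℝ => ∫ y, f (y + t • e) * φ y ∂ν)
      (∫ y, f (y + t • e) * dirDeriv e (dirDeriv e φ) y ∂ν) t := by
  rw [deriv_integral_comp_add_smul_mul hf hφ e]
  simpa using (hasDerivAt_integral_comp_add_smul_mul hf (hφ.dirDeriv e) e t).fun_neg

theorem integral_mul_dirDeriv_dirDeriv_nonneg_of_convexOn (hf : LocallyIntegrable f ν)
    (hconv : ∀ x, ConvexOn ℝ univ fun t : ℝ => f (x + t • e)) (hφ : IsTestFunction φ)
    (hφ₀ : ∀ x, 0 ≤ φ x) : 0 ≤ ∫ x, f x * dirDeriv e (dirDeriv e φ) x ∂ν := by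
  set G : ℝ → ℝ := fun t => ∫ y, f (y + t • e) * φ y ∂ν with hG
  have hGconv : ConvexOn ℝ univ G := by
    refine ⟨convex_univ, fun t _ t' _ a b ha hb hab => ?_⟩
    simp only [hG, smul_eq_mul, ← integral_const_mul]
    have hint (t : ℝ) := hφ.integrable_comp_add_mul hf (t • e)
    rw [← integral_add ((hint t).const_mul a) ((hint t').const_mul b)]
    refine integral_mono (hint _) (((hint t).const_mul a).add ((hint t').const_mul b)) fun y => ?_
    have hline := (hconv y).2 (mem_univ t) (mem_univ t') ha hb hab
    simp only [smul_eq_mul] at hline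
    have := mul_le_mul_of_nonneg_right hline (hφ₀ y)
    linarith
  have hmono : Monotone (deriv G) := fun s t hst =>
    hGconv.monotoneOn_deriv (fun t _ =>
      (hasDerivAt_integral_comp_add_smul_mul hf hφ e t).differentiableAt)
      (mem_univ s) (mem_univ t) hst
  have hsecond := hasDerivAt_deriv_integral_comp_add_smul_mul hf hφ e 0
  simp only [zero_smul, add_zero] at hsecond
  exact hsecond.deriv ▸ hmono.deriv_nonneg

theorem convexOn_integral_comp_add_smul_mul (hf : LocallyIntegrable f ν)
    (h : ∀ φ : E → ℝ, IsTestFunction φ → (∀ x, 0 ≤ φ x) →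
      0 ≤ ∫ x, f x * dirDeriv e (dirDeriv e φ) x ∂ν)
    (hφ : IsTestFunction φ) (hφ₀ : ∀ x, 0 ≤ φ x) :
    ConvexOn ℝ univ fun t : ℝ => ∫ y, f (y + t • e) * φ y ∂ν := by
  refine convexOn_univ_of_deriv2_nonneg
    (fun t => (hasDerivAt_integral_comp_add_smul_mul hf hφ e t).differentiableAt)
    (fun t => (hasDerivAt_deriv_integral_comp_add_smul_mul hf hφ e t).differentiableAt)
    fun t => ?_
  have htranslate := h _ (hφ.comp_sub (t • e)) fun y => hφ₀ _
  rw [dirDeriv_comp_sub, dirDeriv_comp_sub, integral_mul_comp_sub] at htranslate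
  simpa [(hasDerivAt_deriv_integral_comp_add_smul_mul hf hφ e t).deriv] using htranslate

theorem convexOn_of_integral_mul_dirDeriv_dirDeriv_nonneg [FiniteDimensional ℝ E]
    [IsFiniteMeasureOnCompacts ν] [ν.IsOpenPosMeasure] (hf : Continuous f)
    (h : ∀ φ : E → ℝ, IsTestFunction φ → (∀ x, 0 ≤ φ x) →
      0 ≤ ∫ x, f x * dirDeriv e (dirDeriv e φ) x ∂ν) (x : E) :
    ConvexOn ℝ univ fun t : ℝ => f (x + t • e) := by
  have hloc : LocallyIntegrable f ν := hf.locallyIntegrable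
  refine ⟨convex_univ, fun t _ t' _ a b ha hb hab => ?_⟩
  rw [← sub_nonneg]
  refine nonneg_of_forall_integral_mul_nonneg (ν := ν)
    (f := fun x => a * f (x + t • e) + b * f (x + t' • e) - f (x + (a * t + b * t') • e))
    (by fun_prop) (fun φ hφ hφ₀ => ?_) x
  have hint (t : ℝ) := hφ.integrable_comp_add_mul hloc (t • e)
  have hmean := (convexOn_integral_comp_add_smul_mul hloc h hφ hφ₀).2 (mem_univ t) (mem_univ t')
    ha hb hab
  simp only [smul_eq_mul, ← integral_const_mul] at hmean
  rw [← integral_add ((hint t).const_mul a) ((hint t').const_mul b), ← sub_nonneg,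
    ← integral_sub (((hint t).const_mul a).fun_add ((hint t').const_mul b)) (hint _)] at hmean
  refine hmean.trans_eq (integral_congr_ae (.of_forall fun y => ?_))
  ring

end DistributionalConvexity

section SymmetricDerivative

variable {E : Type*} [NormedAddCommGroup E] [NormedSpace ℝ E] {e : E} {f D : E → ℝ}

/-- `D` is the limit of the symmetric difference quotients of `f` in the direction `e`, and these
are bounded on compact sets. One-sided convexity along `e` makes such a `D` exist everywhere,
while the derivative need not exist. -/
structure IsSymmDeriv (e : E) (f D : E → ℝ) : Prop where
  tendsto : ∀ x, Tendsto (fun s : ℝ => (f (x + s • e) - f (x - s • e)) / (2 * s)) (𝓝[>] 0)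
    (𝓝 (D x))
  bounded : ∀ K : Set E, IsCompact K → ∃ C : ℝ, ∀ x ∈ K, ∀ s ∈ Ioc (0 : ℝ) 1,
    |(f (x + s • e) - f (x - s • e)) / (2 * s)| ≤ C

theorem eventually_mem_Ioc_zero_one : ∀ᶠ s : ℝ in 𝓝[>] 0, s ∈ Ioc (0 : ℝ) 1 :=
  Ioc_mem_nhdsGT one_pos

theorem convexOn_symmSlope_mem_Icc {g : ℝ → ℝ} (hg : ConvexOn ℝ univ g) {s : ℝ}
    (hs : s ∈ Ioc (0 : ℝ) 1) : (g s - g (-s)) / (2 * s) ∈ Icc (g 0 - g (-1)) (g 1 - g 0) := by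
  obtain ⟨hs₀, hs₁⟩ := hs
  have hright := hg.2 (mem_univ 0) (mem_univ 1) (sub_nonneg.2 hs₁) hs₀.le (by ring)
  have hleft := hg.2 (mem_univ 0) (mem_univ (-1)) (sub_nonneg.2 hs₁) hs₀.le (by ring)
  have hmid := hg.2 (mem_univ s) (mem_univ (-s)) (by norm_num : (0 : ℝ) ≤ 1 / 2)
    (by norm_num : (0 : ℝ) ≤ 1 / 2) (by norm_num)
  simp only [smul_eq_mul, mul_zero, mul_one, zero_add, mul_neg] at hright hleft hmid
  rw [add_neg_cancel] at hmid
  rw [mem_Icc, le_div_iff₀ (by positivity), div_le_iff₀ (by positivity)]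
  constructor <;> linarith

theorem exists_tendsto_symmSlope_of_convexOn {g : ℝ → ℝ} (hg : ConvexOn ℝ univ g) :
    ∃ d, Tendsto (fun s : ℝ => (g s - g (-s)) / (2 * s)) (𝓝[>] 0) (𝓝 d) := by
  have right := hg.hasDerivWithinAt_rightDeriv_of_mem_interior (x := 0) (by simp)
  have left := hg.hasDerivWithinAt_leftDeriv_of_mem_interior (x := 0) (by simp)
  rw [hasDerivWithinAt_iff_tendsto_slope' (by simp)] at right left
  have hneg : Tendsto (fun s : ℝ => -s) (𝓝[>] 0) (𝓝[<] 0) := by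
    simpa using tendsto_neg_nhdsGT (a := (0 : ℝ))
  refine ⟨_, ((right.add (left.comp hneg)).div_const 2).congr' ?_⟩
  filter_upwards [self_mem_nhdsWithin] with s hs
  have : s ≠ 0 := ne_of_gt hs
  simp only [Function.comp, slope_def_field, sub_zero]
  field_simp
  ring

namespace IsSymmDeriv

theorem neg (h : IsSymmDeriv e f D) : IsSymmDeriv e (fun x => -f x) (fun x => -D x) := by
  have hquot (x : E) (s : ℝ) : (-f (x + s • e) - -f (x - s • e)) / (2 * s) =
      -((f (x + s • e) - f (x - s • e)) / (2 * s)) := by ring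
  constructor
  · simpa only [hquot] using fun x => (h.tendsto x).neg
  · simpa only [hquot, abs_neg] using h.bounded

theorem measurable [MeasurableSpace E] [BorelSpace E] (h : IsSymmDeriv e f D)
    (hf : Continuous f) : Measurable D := by
  have hquot (s : ℝ) : Measurable fun x => (f (x + s • e) - f (x - s • e)) / (2 * s) :=
    Continuous.measurable (by fun_prop)
  exact measurable_of_tendsto_metrizable' _ hquot (tendsto_pi_nhds.2 h.tendsto)

theorem locallyIntegrable [ProperSpace E] [MeasurableSpace E] [BorelSpace E]
    (h : IsSymmDeriv e f D) (hf : Continuous f) (ν : Measure E) [IsFiniteMeasureOnCompacts ν] :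
    LocallyIntegrable D ν := by
  refine locallyIntegrable_iff.2 fun K hK => ?_
  obtain ⟨C, hC⟩ := h.bounded K hK
  refine Measure.integrableOn_of_bounded (M := C) hK.measure_lt_top.ne
    (h.measurable hf).aestronglyMeasurable ?_
  refine (ae_restrict_iff' hK.measurableSet).2 (.of_forall fun x hx => ?_)
  exact le_of_tendsto (h.tendsto x).abs (eventually_mem_Ioc_zero_one.mono fun s hs => hC x hx s hs)

theorem integral_mul [MeasurableSpace E] [BorelSpace E] {ν : Measure E} [ν.IsAddLeftInvariant]
    [SFinite ν] [IsLocallyFiniteMeasure ν] {φ : E → ℝ} (h : IsSymmDeriv e f D)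
    (hf : Continuous f) (hφ : IsTestFunction φ) :
    ∫ x, D x * φ x ∂ν = -∫ x, f x * dirDeriv e φ x ∂ν := by
  obtain ⟨C, hC⟩ := h.bounded _ hφ.hasCompactSupport
  have hloc : LocallyIntegrable f ν := hf.locallyIntegrable
  have hquot : Tendsto
      (fun s : ℝ => ∫ x, (f (x + s • e) - f (x - s • e)) / (2 * s) * φ x ∂ν) (𝓝[>] 0)
      (𝓝 (∫ x, D x * φ x ∂ν)) := by
    refine tendsto_integral_filter_of_dominated_convergence (fun x => C * |φ x|)
      (.of_forall fun s => ?_) ?_ ((hφ.integrable ν).abs.const_mul C)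
      (.of_forall fun x => (h.tendsto x).mul_const _)
    · have hφm := hφ.continuous.measurable
      have : Measurable fun x => (f (x + s • e) - f (x - s • e)) / (2 * s) :=
        Continuous.measurable (by fun_prop)
      exact (this.mul hφm).aestronglyMeasurable
    · filter_upwards [eventually_mem_Ioc_zero_one] with s hs
      refine .of_forall fun x => ?_
      rw [norm_mul, Real.norm_eq_abs, Real.norm_eq_abs]
      by_cases hx : x ∈ tsupport φ
      · exact mul_le_mul_of_nonneg_right (hC x hx s hs) (abs_nonneg _)
      · simp [image_eq_zero_of_notMem_tsupport hx]
  have hslope := tendsto_symmSlope_of_hasDerivAt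
    (hasDerivAt_integral_comp_add_smul_mul hloc hφ e 0)
  simp only [zero_smul, add_zero, zero_add, zero_sub] at hslope
  refine tendsto_nhds_unique hquot (hslope.congr fun s => ?_)
  rw [← integral_sub (hφ.integrable_comp_add_mul hloc _) (hφ.integrable_comp_add_mul hloc _),
    ← integral_div]
  refine integral_congr_ae (.of_forall fun x => ?_)
  simp only [neg_smul, ← sub_eq_add_neg]
  ring

end IsSymmDeriv

theorem exists_isSymmDeriv_of_convexOn (hf : Continuous f) (e : E)
    (hconv : ∀ x, ConvexOn ℝ univ fun t : ℝ => f (x + t • e)) :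
    ∃ D, IsSymmDeriv e f D ∧ ∀ x, f x - f (x - e) ≤ D x := by
  have hlim (x : E) : ∃ d, Tendsto (fun s : ℝ => (f (x + s • e) - f (x - s • e)) / (2 * s))
      (𝓝[>] 0) (𝓝 d) := by
    simpa only [neg_smul, ← sub_eq_add_neg] using exists_tendsto_symmSlope_of_convexOn (hconv x)
  have hmem (x : E) {s : ℝ} (hs : s ∈ Ioc (0 : ℝ) 1) :
      (f (x + s • e) - f (x - s • e)) / (2 * s) ∈ Icc (f x - f (x - e)) (f (x + e) - f x) := by
    simpa only [neg_smul, ← sub_eq_add_neg, zero_smul, add_zero, one_smul] using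
      convexOn_symmSlope_mem_Icc (hconv x) hs
  choose D hD using hlim
  refine ⟨D, ⟨hD, fun K hK => ?_⟩, fun x => ge_of_tendsto (hD x)
    (eventually_mem_Ioc_zero_one.mono fun s hs => (hmem x hs).1)⟩
  obtain ⟨C, hC⟩ := hK.exists_bound_of_continuousOn
    (f := fun x => max |f x - f (x - e)| |f (x + e) - f x|)
    (Continuous.continuousOn (by fun_prop))
  refine ⟨C, fun x hx s hs => ?_⟩
  exact (abs_le_max_abs_abs (hmem x hs).1 (hmem x hs).2).trans ((le_abs_self _).trans (hC x hx))

theorem exists_isSymmDeriv_of_concaveOn (hf : Continuous f) (e : E)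
    (hconc : ∀ x, ConcaveOn ℝ univ fun t : ℝ => f (x + t • e)) : ∃ D, IsSymmDeriv e f D := by
  obtain ⟨D, hD, -⟩ := exists_isSymmDeriv_of_convexOn hf.neg e fun x => (hconc x).neg
  exact ⟨fun x => -D x, by simpa using hD.neg⟩

end SymmetricDerivative

section Laplacian

variable {E : Type*} [NormedAddCommGroup E] [InnerProductSpace ℝ E] [FiniteDimensional ℝ E]

theorem laplacian_eq_sum_dirDeriv {ι : Type*} [Fintype ι] (b : OrthonormalBasis ι ℝ E)
    {ψ : E → ℝ} (h : ContDiff ℝ 2 ψ) :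
    Δ ψ = fun x => ∑ i, dirDeriv (b i) (dirDeriv (b i) ψ) x := by
  ext x
  rw [InnerProductSpace.laplacian_eq_iteratedFDeriv_orthonormalBasis ψ b]
  refine Finset.sum_congr rfl fun i _ => ?_
  rw [iteratedFDeriv_two_apply, dirDeriv_dirDeriv_apply h]
  rfl

theorem IsTestFunction.laplacian {φ : E → ℝ} (hφ : IsTestFunction φ) : IsTestFunction (Δ φ) := by
  rw [laplacian_eq_sum_dirDeriv (stdOrthonormalBasis ℝ E) (contDiff_infty.1 hφ.contDiff 2)]
  exact .sum _ fun i => (hφ.dirDeriv _).dirDeriv _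

theorem volume_inner_eq_zero [MeasurableSpace E] [BorelSpace E] {e : E} (he : e ≠ 0) :
    volume {x : E | ⟪e, x⟫ = 0} = 0 := by
  refine Measure.addHaar_submodule volume (LinearMap.ker (innerSL ℝ e).toLinearMap) fun h => he ?_
  have : e ∈ LinearMap.ker (innerSL ℝ e).toLinearMap := h ▸ Submodule.mem_top
  simpa using this

end Laplacian

section ThinSpace

variable {m : ℕ}

/-- The `i`-th standard basis vector of `ℝⁿ`. -/
noncomputable def basisVec (i : Fin (m + 1)) : Space m :=
  EuclideanSpace.single i 1

/-- The unit normal `e_n` of the thin space. -/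
noncomputable def normalVec : Space m :=
  basisVec (Fin.last m)

/-- The Laplacian `∂₁² + ⋯ + ∂_{n-1}²` in the directions of the thin space. -/
noncomputable def tangentialLaplacian (ψ : Space m → ℝ) : Space m → ℝ :=
  fun x => ∑ i : Fin m, dirDeriv (basisVec i.castSucc) (dirDeriv (basisVec i.castSucc) ψ) x

/-- The open half space `{x_n > 0}`. -/
def upperHalfSpace (m : ℕ) : Set (Space m) :=
  {x | 0 < x (Fin.last m)}

/-- The reflection `(x', x_n) ↦ (x', -x_n)` in the thin space. -/
noncomputable def mirror : Space m ≃ₗᵢ[ℝ] Space m :=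
  (ℝ ∙ (normalVec : Space m))ᗮ.reflection

theorem basisVec_castSucc_last (i : Fin m) : (basisVec i.castSucc : Space m) (Fin.last m) = 0 := by
  simp [basisVec, (Fin.castSucc_lt_last i).ne']

@[simp]
theorem normalVec_last : (normalVec : Space m) (Fin.last m) = 1 := by
  simp [normalVec, basisVec]

@[simp]
theorem norm_normalVec : ‖(normalVec : Space m)‖ = 1 := by
  simp [normalVec, basisVec]

@[simp]
theorem inner_normalVec (x : Space m) : ⟪normalVec, x⟫ = x (Fin.last m) := by
  simp [normalVec, basisVec, EuclideanSpace.inner_single_left]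

theorem laplacian_eq_sum_basisVec {ψ : Space m → ℝ} (h : ContDiff ℝ ∞ ψ) (x : Space m) :
    Δ ψ x = ∑ i, dirDeriv (basisVec i) (dirDeriv (basisVec i) ψ) x := by
  rw [laplacian_eq_sum_dirDeriv (EuclideanSpace.basisFun (Fin (m + 1)) ℝ) (contDiff_infty.1 h 2)]
  simp only [EuclideanSpace.basisFun_apply, basisVec]

theorem laplacian_eq_tangentialLaplacian_add {ψ : Space m → ℝ} (h : ContDiff ℝ ∞ ψ)
    (x : Space m) :
    Δ ψ x = tangentialLaplacian ψ x + dirDeriv normalVec (dirDeriv normalVec ψ) x := by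
  rw [laplacian_eq_sum_basisVec h, Fin.sum_univ_castSucc]
  rfl

theorem IsTestFunction.tangentialLaplacian {φ : Space m → ℝ} (hφ : IsTestFunction φ) :
    IsTestFunction (tangentialLaplacian φ) :=
  .sum _ fun _ => (hφ.dirDeriv _).dirDeriv _

theorem dirDeriv_tangentialLaplacian {φ : Space m → ℝ} (h : ContDiff ℝ ∞ φ) (e : Space m) :
    dirDeriv e (tangentialLaplacian φ) = tangentialLaplacian (dirDeriv e φ) := by
  unfold tangentialLaplacian
  rw [dirDeriv_sum _ _ fun i _ => differentiable_dirDeriv (contDiff_dirDeriv h _) _]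
  ext x
  refine Finset.sum_congr rfl fun i _ => ?_
  rw [dirDeriv_comm (contDiff_infty.1 (contDiff_dirDeriv h _) 2),
    dirDeriv_comm (contDiff_infty.1 h 2)]

theorem isOpen_upperHalfSpace : IsOpen (upperHalfSpace m) :=
  isOpen_lt continuous_const (EuclideanSpace.proj (Fin.last m)).continuous

theorem measurableSet_upperHalfSpace : MeasurableSet (upperHalfSpace m) :=
  isOpen_upperHalfSpace.measurableSet

theorem ae_last_ne_zero : ∀ᵐ x : Space m, x (Fin.last m) ≠ 0 := by
  have hne : (normalVec : Space m) ≠ 0 := fun h => by simpa [h] using norm_normalVec (m := m)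
  simpa [ae_iff] using volume_inner_eq_zero hne

theorem mirror_eq (x : Space m) : mirror x = x - (2 * x (Fin.last m)) • normalVec := by
  simp [mirror, Submodule.reflection_orthogonal_apply, Submodule.reflection_singleton_apply,
    mul_smul, two_smul]

theorem mirror_last (x : Space m) : mirror x (Fin.last m) = -x (Fin.last m) := by
  simp only [mirror_eq, PiLp.sub_apply, PiLp.smul_apply, normalVec_last, smul_eq_mul]
  ring

theorem mirror_mirror (x : Space m) : mirror (mirror x) = x :=
  Submodule.reflection_reflection _ x

theorem mirror_of_thin {x : Space m} (h : x (Fin.last m) = 0) : mirror x = x := by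
  simp [mirror_eq, h]

theorem mirror_normalVec : mirror (normalVec : Space m) = -normalVec := by
  simp [mirror_eq, two_smul]

theorem measurePreserving_mirror : MeasurePreserving (mirror : Space m → Space m) :=
  mirror.measurePreserving

theorem measurableEmbedding_mirror : MeasurableEmbedding (mirror : Space m → Space m) :=
  mirror.toHomeomorph.measurableEmbedding

theorem integral_comp_mirror (f : Space m → ℝ) : ∫ x, f (mirror x) = ∫ x, f x :=
  measurePreserving_mirror.integral_comp measurableEmbedding_mirror f

theorem compl_upperHalfSpace_ae_eq :
    (upperHalfSpace m)ᶜ =ᵐ[volume] mirror ⁻¹' upperHalfSpace m := by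
  filter_upwards [ae_last_ne_zero] with x hx
  have hiff : ¬ 0 < x (Fin.last m) ↔ 0 < mirror x (Fin.last m) := by
    rw [mirror_last, not_lt, neg_pos, hx.le_iff_lt]
  exact propext hiff

theorem integral_eq_two_mul_of_even {f : Space m → ℝ} (hf : Integrable f)
    (heven : ∀ x, f (mirror x) = f x) : ∫ x, f x = 2 * ∫ x in upperHalfSpace m, f x := by
  have hlower : ∫ x in (upperHalfSpace m)ᶜ, f x = ∫ x in upperHalfSpace m, f x := by
    refine (setIntegral_congr_set compl_upperHalfSpace_ae_eq).trans ?_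
    simpa only [heven] using measurePreserving_mirror.setIntegral_preimage_emb
      measurableEmbedding_mirror f (upperHalfSpace m)
  rw [← integral_add_compl measurableSet_upperHalfSpace hf, hlower, two_mul]

theorem IsSymmDeriv.homogeneous {e : Space m} {f D : Space m → ℝ} (h : IsSymmDeriv e f D)
    {lam : ℝ} (hf : IsHomogeneousOfDegree f lam) : IsHomogeneousOfDegree D (lam - 1) := by
  intro r hr x
  have hscale : Tendsto (fun s : ℝ => s / r) (𝓝[>] 0) (𝓝[>] 0) := by
    refine tendsto_nhdsWithin_iff.2 ⟨?_, ?_⟩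
    · have : Tendsto (fun s : ℝ => s / r) (𝓝 0) (𝓝 (0 / r)) := tendsto_id.div_const r
      exact (zero_div r ▸ this).mono_left nhdsWithin_le_nhds
    · filter_upwards [self_mem_nhdsWithin] with s hs using div_pos hs hr
  refine tendsto_nhds_unique (h.tendsto (r • x))
    ((((h.tendsto x).comp hscale).const_mul (r ^ (lam - 1))).congr' ?_)
  filter_upwards [self_mem_nhdsWithin] with s hs
  have hs₀ : s ≠ 0 := ne_of_gt hs
  have hs : s • e = r • (s / r) • e := by rw [smul_smul, mul_div_cancel₀ _ hr.ne']
  simp only [Function.comp]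
  rw [hs, ← smul_add, ← smul_sub, hf r hr, hf r hr, Real.rpow_sub_one hr.ne']
  field_simp

theorem IsSymmDeriv.odd_of_even {f D : Space m → ℝ} (h : IsSymmDeriv normalVec f D)
    (hf : ∀ x, f (mirror x) = f x) (x : Space m) : D (mirror x) = -D x := by
  refine tendsto_nhds_unique (h.tendsto (mirror x)) ((h.tendsto x).neg.congr fun s => ?_)
  rw [← hf (mirror x + _), ← hf (mirror x - _)]
  simp only [map_add, map_sub, map_smul, mirror_normalVec, mirror_mirror, smul_neg,
    ← sub_eq_add_neg, sub_neg_eq_add]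
  ring

end ThinSpace

section ConvexSolutions

variable {m : ℕ} {q φ : Space m → ℝ} {μ : Measure (Space m)}

theorem integral_mul_tangentialLaplacian_nonneg (hq : Continuous q) (hconv : IsConvexAlongThin q)
    (hφ : IsTestFunction φ) (hφ₀ : ∀ x, 0 ≤ φ x) : 0 ≤ ∫ x, q x * tangentialLaplacian φ x := by
  simp only [tangentialLaplacian, Finset.mul_sum]
  rw [integral_finsetSum _ fun i _ =>
    ((hφ.dirDeriv _).dirDeriv _).integrable_mul hq.locallyIntegrable]
  exact Finset.sum_nonneg fun i _ => integral_mul_dirDeriv_dirDeriv_nonneg_of_convexOn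
    hq.locallyIntegrable (fun x => hconv x _ (basisVec_castSucc_last i)) hφ hφ₀

theorem integral_mul_laplacian_eq_tangential_add_normal (hq : LocallyIntegrable q)
    (hφ : IsTestFunction φ) :
    ∫ x, q x * Δ φ x = (∫ x, q x * tangentialLaplacian φ x) +
      ∫ x, q x * dirDeriv normalVec (dirDeriv normalVec φ) x := by
  rw [← integral_add (hφ.tangentialLaplacian.integrable_mul hq)
    (((hφ.dirDeriv _).dirDeriv _).integrable_mul hq)]
  simp only [laplacian_eq_tangentialLaplacian_add hφ.contDiff, mul_add]

theorem concaveOn_normal_of_isConvexAlongThin (hq : Continuous q) (hconv : IsConvexAlongThin q)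
    (hμ : HasNegLaplacian q μ) (x : Space m) :
    ConcaveOn ℝ univ fun t : ℝ => q (x + t • normalVec) := by
  refine neg_convexOn_iff.1 (convexOn_of_integral_mul_dirDeriv_dirDeriv_nonneg (ν := volume)
    (f := fun x => -q x) hq.neg (fun φ hφ hφ₀ => ?_) x)
  have hlap := hμ φ hφ.contDiff hφ.hasCompactSupport
  rw [integral_mul_laplacian_eq_tangential_add_normal hq.locallyIntegrable hφ] at hlap
  have htan := integral_mul_tangentialLaplacian_nonneg hq hconv hφ hφ₀
  have hmass : 0 ≤ ∫ x, φ x ∂μ := integral_nonneg hφ₀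
  simp only [neg_mul, integral_neg]
  linarith

end ConvexSolutions

section Fold

variable {m : ℕ} {κ : ℝ} {φ ψ : Space m → ℝ}

/-- A smooth approximation, as `κ → 0`, of the folding map `(x', x_n) ↦ (x', |x_n|)`. Composition
with it turns test functions on the closed upper half space into even ones. -/
noncomputable def fold (κ : ℝ) (x : Space m) : Space m :=
  x + (√(x (Fin.last m) ^ 2 + κ ^ 2) - x (Fin.last m)) • normalVec

/-- The derivative of the last coordinate of `fold κ` in the normal direction. -/
noncomputable def foldSlope (κ : ℝ) (x : Space m) : ℝ :=
  x (Fin.last m) / √(x (Fin.last m) ^ 2 + κ ^ 2)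

theorem hasFDerivAt_coord (i : Fin (m + 1)) (x : Space m) :
    HasFDerivAt (fun x : Space m => x i) (EuclideanSpace.proj (𝕜 := ℝ) i) x :=
  (EuclideanSpace.proj (𝕜 := ℝ) i).hasFDerivAt

theorem contDiff_coord (i : Fin (m + 1)) : ContDiff ℝ ∞ fun x : Space m => x i :=
  (EuclideanSpace.proj (𝕜 := ℝ) i).contDiff

theorem sq_add_sq_pos (hκ : 0 < κ) (t : ℝ) : 0 < t ^ 2 + κ ^ 2 := by
  positivity

theorem norm_add_smul_normalVec_sq (x : Space m) (c : ℝ) :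
    ‖x + c • normalVec‖ ^ 2 = ‖x‖ ^ 2 + 2 * c * x (Fin.last m) + c ^ 2 := by
  rw [norm_add_sq_real, norm_smul, norm_normalVec, real_inner_smul_right, real_inner_comm,
    inner_normalVec, mul_one, Real.norm_eq_abs, sq_abs]
  ring

theorem norm_le_norm_fold (κ : ℝ) (x : Space m) : ‖x‖ ≤ ‖fold κ x‖ := by
  refine le_of_sq_le_sq ?_ (norm_nonneg _)
  rw [fold, norm_add_smul_normalVec_sq]
  linarith [Real.sq_sqrt (show 0 ≤ x (Fin.last m) ^ 2 + κ ^ 2 by positivity), sq_nonneg κ]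

theorem fold_zero_of_nonneg {x : Space m} (hx : 0 ≤ x (Fin.last m)) : fold 0 x = x := by
  simp [fold, Real.sqrt_sq hx]

theorem fold_zero_mirror (x : Space m) : fold 0 (mirror x) = fold 0 x := by
  simp only [fold, mirror_last, neg_sq]
  rw [mirror_eq, sub_add, ← sub_smul, sub_eq_add_neg, ← neg_smul]
  congr 2
  ring

theorem foldSlope_zero_of_pos {x : Space m} (hx : 0 < x (Fin.last m)) : foldSlope 0 x = 1 := by
  simp [foldSlope, Real.sqrt_sq hx.le, hx.ne']

theorem foldSlope_mirror (κ : ℝ) (x : Space m) : foldSlope κ (mirror x) = -foldSlope κ x := by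
  simp only [foldSlope, mirror_last, neg_sq, neg_div]

theorem abs_foldSlope_le_one (κ : ℝ) (x : Space m) : |foldSlope κ x| ≤ 1 := by
  rw [foldSlope, abs_div, abs_of_nonneg (Real.sqrt_nonneg _)]
  exact div_le_one_of_le₀ (Real.abs_le_sqrt (by linarith [sq_nonneg κ])) (Real.sqrt_nonneg _)

theorem measurable_foldSlope (κ : ℝ) : Measurable (foldSlope κ : Space m → ℝ) := by
  have hlast : Continuous fun x : Space m => x (Fin.last m) := (contDiff_coord _).continuous
  exact hlast.measurable.div ((hlast.pow 2).add continuous_const).sqrt.measurable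

theorem continuous_fold (κ : ℝ) : Continuous (fold κ : Space m → Space m) := by
  unfold fold
  fun_prop

theorem tendsto_fold (x : Space m) : Tendsto (fun κ => fold κ x) (𝓝[>] 0) (𝓝 (fold 0 x)) := by
  have : Continuous fun κ => fold κ x := by
    unfold fold
    fun_prop
  exact (this.tendsto 0).mono_left nhdsWithin_le_nhds

theorem tendsto_foldSlope {x : Space m} (hx : x (Fin.last m) ≠ 0) :
    Tendsto (fun κ => foldSlope κ x) (𝓝[>] 0) (𝓝 (foldSlope 0 x)) := by
  have hsqrt : √(x (Fin.last m) ^ 2 + 0 ^ 2) ≠ 0 := by simpa [Real.sqrt_sq_eq_abs] using hx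
  have : ContinuousAt (fun κ => foldSlope κ x) 0 :=
    ContinuousAt.div (by fun_prop) (by fun_prop) hsqrt
  exact this.tendsto.mono_left nhdsWithin_le_nhds

theorem contDiff_fold (hκ : 0 < κ) : ContDiff ℝ ∞ (fold κ : Space m → Space m) := by
  have hsqrt : ContDiff ℝ ∞ fun x : Space m => √(x (Fin.last m) ^ 2 + κ ^ 2) :=
    (((contDiff_coord _).pow 2).add contDiff_const).sqrt fun x => (sq_add_sq_pos hκ _).ne'
  exact contDiff_id.add ((hsqrt.sub (contDiff_coord _)).smul contDiff_const)

theorem IsTestFunction.comp_fold (hψ : IsTestFunction ψ) (hκ : 0 < κ) :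
    IsTestFunction fun x => ψ (fold κ x) := by
  obtain ⟨R, -, hR⟩ := hψ.hasCompactSupport.exists_pos_le_norm
  refine ⟨hψ.contDiff.comp (contDiff_fold hκ), .intro (isCompact_closedBall 0 R) fun x hx => ?_⟩
  exact hR _ ((not_le.1 (mem_closedBall_zero_iff.not.1 hx)).le.trans (norm_le_norm_fold κ x))

theorem dirDeriv_comp_fold_apply (hκ : 0 < κ) (hψ : Differentiable ℝ ψ) (e x : Space m) :
    dirDeriv e (fun x => ψ (fold κ x)) x =
      fderiv ℝ ψ (fold κ x) (e + ((foldSlope κ x - 1) * e (Fin.last m)) • normalVec) := by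
  have hsqrt := (((hasFDerivAt_coord (Fin.last m) x).pow 2).add_const (κ ^ 2)).sqrt
    (sq_add_sq_pos hκ _).ne'
  have hfold := (hasFDerivAt_id x).add
    ((hsqrt.sub (hasFDerivAt_coord (Fin.last m) x)).smul_const normalVec)
  have hcomp : HasFDerivAt (fun x => ψ (fold κ x)) _ x := (hψ _).hasFDerivAt.comp x hfold
  rw [dirDeriv, hcomp.fderiv]
  simp only [ContinuousLinearMap.comp_apply, add_apply, ContinuousLinearMap.smulRight_apply,
    sub_apply, smul_apply, smul_eq_mul]
  congr 3
  have := Real.sqrt_pos.2 (sq_add_sq_pos hκ (x (Fin.last m)))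
  simp [foldSlope]
  field_simp

theorem dirDeriv_comp_fold_of_tangential (hκ : 0 < κ) (hψ : Differentiable ℝ ψ) {e : Space m}
    (he : e (Fin.last m) = 0) :
    dirDeriv e (fun x => ψ (fold κ x)) = fun x => dirDeriv e ψ (fold κ x) := by
  ext x
  rw [dirDeriv_comp_fold_apply hκ hψ, he, mul_zero, zero_smul, add_zero, dirDeriv]

theorem dirDeriv_normalVec_comp_fold (hκ : 0 < κ) (hψ : Differentiable ℝ ψ) (x : Space m) :
    dirDeriv normalVec (fun x => ψ (fold κ x)) x =
      foldSlope κ x * dirDeriv normalVec ψ (fold κ x) := by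
  have hvec : normalVec + ((foldSlope κ x - 1) * 1) • (normalVec : Space m) =
      foldSlope κ x • normalVec := by
    module
  rw [dirDeriv_comp_fold_apply hκ hψ, normalVec_last, hvec, map_smul, smul_eq_mul, dirDeriv]

theorem tangentialLaplacian_comp_fold (hκ : 0 < κ) (hψ : ContDiff ℝ ∞ ψ) (x : Space m) :
    tangentialLaplacian (fun x => ψ (fold κ x)) x = tangentialLaplacian ψ (fold κ x) := by
  refine Finset.sum_congr rfl fun i _ => ?_
  rw [dirDeriv_comp_fold_of_tangential hκ (hψ.differentiable (by simp)) (basisVec_castSucc_last i),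
    dirDeriv_comp_fold_of_tangential hκ (differentiable_dirDeriv hψ _) (basisVec_castSucc_last i)]

theorem exists_comp_fold_eq_zero_of_notMem_closedBall (hφ : IsTestFunction φ) :
    ∃ R, ∀ κ, ∀ x ∉ closedBall (0 : Space m) R, φ (fold κ x) = 0 := by
  obtain ⟨R, -, hR⟩ := hφ.hasCompactSupport.exists_pos_le_norm
  refine ⟨R, fun κ x hx => hR _ (le_trans ?_ (norm_le_norm_fold κ x))⟩
  exact (not_le.1 (mem_closedBall_zero_iff.not.1 hx)).le

theorem abs_mul_comp_fold_le {C s : ℝ} {x : Space m} (hC : ∀ x, ‖φ x‖ ≤ C) (hs : |s| ≤ 1) :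
    |s * φ (fold κ x)| ≤ C := by
  rw [abs_mul]
  exact (mul_le_of_le_one_left (abs_nonneg _) hs).trans (hC _)

theorem aestronglyMeasurable_mul_comp_fold {ν : Measure (Space m)} {c : Space m → ℝ}
    (hφ : Continuous φ) (hc : Measurable c) :
    AEStronglyMeasurable (fun x => c x * φ (fold κ x)) ν :=
  (hc.mul (hφ.comp (continuous_fold κ)).measurable).aestronglyMeasurable

theorem tendsto_integral_mul_comp_fold {ν : Measure (Space m)} {f : Space m → ℝ}
    {c : ℝ → Space m → ℝ} (hf : LocallyIntegrable f ν) (hφ : IsTestFunction φ)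
    (hmeas : ∀ κ, Measurable (c κ)) (hbound : ∀ κ x, |c κ x| ≤ 1)
    (hlim : ∀ᵐ x ∂ν, Tendsto (fun κ => c κ x) (𝓝[>] 0) (𝓝 (c 0 x))) :
    Tendsto (fun κ => ∫ x, f x * (c κ x * φ (fold κ x)) ∂ν) (𝓝[>] 0)
      (𝓝 (∫ x, f x * (c 0 x * φ (fold 0 x)) ∂ν)) := by
  obtain ⟨R, hR⟩ := exists_comp_fold_eq_zero_of_notMem_closedBall hφ
  obtain ⟨C, hC⟩ := hφ.hasCompactSupport.exists_bound_of_continuous hφ.continuous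
  refine tendsto_integral_mul_of_bounded hf (isCompact_closedBall 0 R)
    (.of_forall fun κ => aestronglyMeasurable_mul_comp_fold hφ.continuous (hmeas κ))
    (.of_forall fun κ x _ => abs_mul_comp_fold_le hC (hbound κ x))
    (.of_forall fun κ x hx => by rw [hR κ x hx, mul_zero]) (hlim.mono fun x hx => ?_)
  exact hx.mul ((hφ.continuous.tendsto _).comp (tendsto_fold x))

theorem integral_mul_comp_fold_zero_eq_two_mul {f c : Space m → ℝ} (hf : LocallyIntegrable f)
    (hφ : IsTestFunction φ) (hmeas : Measurable c) (hbound : ∀ x, |c x| ≤ 1)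
    (heven : ∀ x, f (mirror x) * c (mirror x) = f x * c x)
    (hone : ∀ x ∈ upperHalfSpace m, c x = 1) :
    ∫ x, f x * (c x * φ (fold 0 x)) = 2 * ∫ x in upperHalfSpace m, f x * φ x := by
  obtain ⟨R, hR⟩ := exists_comp_fold_eq_zero_of_notMem_closedBall hφ
  obtain ⟨C, hC⟩ := hφ.hasCompactSupport.exists_bound_of_continuous hφ.continuous
  have hint : Integrable fun x => f x * (c x * φ (fold 0 x)) :=
    integrable_mul_of_bounded hf (isCompact_closedBall 0 R)
      (aestronglyMeasurable_mul_comp_fold hφ.continuous hmeas)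
      (fun x _ => abs_mul_comp_fold_le hC (hbound x)) fun x hx => by rw [hR 0 x hx, mul_zero]
  rw [integral_eq_two_mul_of_even hint fun x => by
    rw [fold_zero_mirror, ← mul_assoc, heven, mul_assoc]]
  congr 1
  refine setIntegral_congr_fun measurableSet_upperHalfSpace fun x hx => ?_
  simp only [hone x hx, one_mul, fold_zero_of_nonneg (le_of_lt hx)]

end Fold

section WeakForm

variable {m : ℕ} {q D ψ : Space m → ℝ} {μ : Measure (Space m)}

theorem integral_mul_tangentialLaplacian_sub_integral_mul_normal (hq : Continuous q)
    (hμ : HasNegLaplacian q μ) (hD : IsSymmDeriv normalVec q D) (hψ : IsTestFunction ψ) :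
    (∫ x, q x * tangentialLaplacian ψ x) - ∫ x, D x * dirDeriv normalVec ψ x = -∫ x, ψ x ∂μ := by
  rw [← hμ ψ hψ.contDiff hψ.hasCompactSupport,
    integral_mul_laplacian_eq_tangential_add_normal hq.locallyIntegrable hψ,
    hD.integral_mul hq (hψ.dirDeriv normalVec)]
  ring

theorem integral_mul_tangentialLaplacian_fold_sub_integral_mul_normal_fold
    [IsLocallyFiniteMeasure μ] (hq : Continuous q) (hμ : HasNegLaplacian q μ)
    (hD : IsSymmDeriv normalVec q D) (hψ : IsTestFunction ψ) :
    (∫ x, q x * tangentialLaplacian ψ (fold 0 x)) -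
      ∫ x, D x * (foldSlope 0 x * dirDeriv normalVec ψ (fold 0 x)) = -∫ x, ψ (fold 0 x) ∂μ := by
  have hDloc := hD.locallyIntegrable hq volume
  have htan := tendsto_integral_mul_comp_fold (c := fun _ _ => 1)
    (hq.locallyIntegrable (μ := volume)) hψ.tangentialLaplacian (fun _ => measurable_const)
    (fun _ _ => by simp) (.of_forall fun _ => tendsto_const_nhds)
  have hnor := tendsto_integral_mul_comp_fold hDloc (hψ.dirDeriv normalVec) measurable_foldSlope
    abs_foldSlope_le_one (ae_last_ne_zero.mono fun _ => tendsto_foldSlope)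
  have hmass := tendsto_integral_mul_comp_fold (f := fun _ => 1) (c := fun _ _ => 1)
    (continuous_const.locallyIntegrable (μ := μ)) hψ (fun _ => measurable_const)
    (fun _ _ => by simp) (.of_forall fun _ => tendsto_const_nhds)
  simp only [one_mul] at htan hmass
  refine tendsto_nhds_unique (htan.sub hnor) (hmass.neg.congr' ?_)
  filter_upwards [self_mem_nhdsWithin] with κ hκ
  rw [← integral_mul_tangentialLaplacian_sub_integral_mul_normal hq hμ hD (hψ.comp_fold hκ)]
  simp only [tangentialLaplacian_comp_fold hκ hψ.contDiff,
    dirDeriv_normalVec_comp_fold hκ hψ.differentiable]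

theorem setIntegral_upperHalfSpace_mul_tangentialLaplacian_sub_mul_normal
    [IsLocallyFiniteMeasure μ] (hq : Continuous q) (heven : ∀ x, q (mirror x) = q x)
    (hμ : HasNegLaplacian q μ) (hthin : ∀ᵐ x ∂μ, x (Fin.last m) = 0)
    (hD : IsSymmDeriv normalVec q D) (hψ : IsTestFunction ψ) :
    (∫ x in upperHalfSpace m, q x * tangentialLaplacian ψ x) -
      ∫ x in upperHalfSpace m, D x * dirDeriv normalVec ψ x = -(1 / 2) * ∫ x, ψ x ∂μ := by
  have hfold := integral_mul_tangentialLaplacian_fold_sub_integral_mul_normal_fold hq hμ hD hψ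
  have hmass : ∫ x, ψ (fold 0 x) ∂μ = ∫ x, ψ x ∂μ :=
    integral_congr_ae (hthin.mono fun x hx => by simp only [fold_zero_of_nonneg hx.ge])
  have htan : ∫ x, q x * tangentialLaplacian ψ (fold 0 x) =
      2 * ∫ x in upperHalfSpace m, q x * tangentialLaplacian ψ x := by
    simpa only [one_mul] using integral_mul_comp_fold_zero_eq_two_mul (c := fun _ => 1)
      hq.locallyIntegrable hψ.tangentialLaplacian measurable_const (fun _ => by simp)
      (fun x => by rw [heven]) fun _ _ => rfl
  have hnor : ∫ x, D x * (foldSlope 0 x * dirDeriv normalVec ψ (fold 0 x)) =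
      2 * ∫ x in upperHalfSpace m, D x * dirDeriv normalVec ψ x :=
    integral_mul_comp_fold_zero_eq_two_mul (hD.locallyIntegrable hq volume)
      (hψ.dirDeriv normalVec) (measurable_foldSlope 0) (abs_foldSlope_le_one 0)
      (fun x => by rw [hD.odd_of_even heven, foldSlope_mirror, neg_mul_neg])
      fun _ => foldSlope_zero_of_pos
  linarith

end WeakForm

section SmoothTransition

theorem deriv_smoothTransition_nonneg (t : ℝ) : 0 ≤ deriv Real.smoothTransition t :=
  Real.smoothTransition.monotone.deriv_nonneg

theorem deriv_smoothTransition_of_nonpos {t : ℝ} (h : t ≤ 0) :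
    deriv Real.smoothTransition t = 0 :=
  IsLocalMin.deriv_eq_zero (.of_forall fun s => by
    rw [Real.smoothTransition.zero_of_nonpos h]
    exact Real.smoothTransition.nonneg s)

theorem deriv_smoothTransition_of_one_le {t : ℝ} (h : 1 ≤ t) :
    deriv Real.smoothTransition t = 0 :=
  IsLocalMax.deriv_eq_zero (.of_forall fun s => by
    rw [Real.smoothTransition.one_of_one_le h]
    exact Real.smoothTransition.le_one s)

theorem differentiable_smoothTransition : Differentiable ℝ Real.smoothTransition :=
  (Real.smoothTransition.contDiff (n := 1)).differentiable (by simp)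

theorem contDiff_deriv_smoothTransition : ContDiff ℝ ∞ (deriv Real.smoothTransition) :=
  (contDiff_infty_iff_deriv.1 Real.smoothTransition.contDiff).2

theorem exists_abs_deriv_smoothTransition_le :
    ∃ C : ℝ, 0 ≤ C ∧ ∀ t, |deriv Real.smoothTransition t| ≤ C := by
  have hsupp : HasCompactSupport (deriv Real.smoothTransition) := by
    refine .intro (isCompact_Icc (a := (0 : ℝ)) (b := 1)) fun t ht => ?_
    rcases le_total t 0 with h | h
    · exact deriv_smoothTransition_of_nonpos h
    · exact deriv_smoothTransition_of_one_le (not_lt.1 fun h' => ht ⟨h, h'.le⟩)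
  obtain ⟨C, hC⟩ := hsupp.exists_bound_of_continuous contDiff_deriv_smoothTransition.continuous
  exact ⟨C, (norm_nonneg _).trans (hC 0), hC⟩

end SmoothTransition

section NormalCutoff

variable {m : ℕ} {κ : ℝ} {e x : Space m}

/-- A smooth cutoff to the upper half space, equal to `1` where `κ ≤ x_n`. -/
noncomputable def normalCutoff (κ : ℝ) (x : Space m) : ℝ :=
  Real.smoothTransition (x (Fin.last m) / κ)

theorem contDiff_normalCutoff (κ : ℝ) : ContDiff ℝ ∞ (normalCutoff κ : Space m → ℝ) :=
  Real.smoothTransition.contDiff.comp ((contDiff_coord _).div_const κ)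

theorem differentiable_normalCutoff (κ : ℝ) : Differentiable ℝ (normalCutoff κ : Space m → ℝ) :=
  (contDiff_normalCutoff κ).differentiable (by simp)

theorem normalCutoff_nonneg (κ : ℝ) (x : Space m) : 0 ≤ normalCutoff κ x :=
  Real.smoothTransition.nonneg _

theorem normalCutoff_le_one (κ : ℝ) (x : Space m) : normalCutoff κ x ≤ 1 :=
  Real.smoothTransition.le_one _

theorem dirDeriv_normalCutoff (κ : ℝ) (e x : Space m) : dirDeriv e (normalCutoff κ) x =
    deriv Real.smoothTransition (x (Fin.last m) / κ) / κ * e (Fin.last m) := by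
  have hcoord := (hasFDerivAt_coord (Fin.last m) x).mul_const κ⁻¹
  have hcomp : HasFDerivAt (normalCutoff κ : Space m → ℝ) _ x :=
    (differentiable_smoothTransition (x (Fin.last m) * κ⁻¹)).hasDerivAt.comp_hasFDerivAt x hcoord
  rw [dirDeriv, hcomp.fderiv]
  simp [div_eq_mul_inv, mul_assoc]

theorem dirDeriv_normalCutoff_of_tangential (κ : ℝ) (he : e (Fin.last m) = 0) :
    dirDeriv e (normalCutoff κ) = 0 := by
  ext x
  rw [dirDeriv_normalCutoff, he, mul_zero, Pi.zero_apply]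

theorem dirDeriv_dirDeriv_normalVec_normalCutoff_of_tangential (κ : ℝ)
    (he : e (Fin.last m) = 0) : dirDeriv e (dirDeriv normalVec (normalCutoff κ)) = 0 := by
  rw [dirDeriv_comm (contDiff_infty.1 (contDiff_normalCutoff κ) 2),
    dirDeriv_normalCutoff_of_tangential κ he]
  ext x
  simp [dirDeriv]

theorem dirDeriv_normalVec_normalCutoff_nonneg (hκ : 0 < κ) (x : Space m) :
    0 ≤ dirDeriv normalVec (normalCutoff κ) x := by
  rw [dirDeriv_normalCutoff, normalVec_last, mul_one]
  exact div_nonneg (deriv_smoothTransition_nonneg _) hκ.le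

theorem dirDeriv_normalCutoff_of_nonpos (hκ : 0 < κ) (e : Space m) (hx : x (Fin.last m) ≤ 0) :
    dirDeriv e (normalCutoff κ) x = 0 := by
  rw [dirDeriv_normalCutoff,
    deriv_smoothTransition_of_nonpos (div_nonpos_of_nonpos_of_nonneg hx hκ.le), zero_div, zero_mul]

theorem dirDeriv_normalCutoff_of_le (hκ : 0 < κ) (e : Space m) (hx : κ ≤ x (Fin.last m)) :
    dirDeriv e (normalCutoff κ) x = 0 := by
  rw [dirDeriv_normalCutoff, deriv_smoothTransition_of_one_le ((one_le_div hκ).2 hx), zero_div,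
    zero_mul]

theorem eventually_dirDeriv_normalCutoff_eq_zero (e x : Space m) :
    ∀ᶠ κ in 𝓝[>] 0, dirDeriv e (normalCutoff κ) x = 0 := by
  rcases le_or_gt (x (Fin.last m)) 0 with hx | hx
  · filter_upwards [self_mem_nhdsWithin] with κ hκ
    exact dirDeriv_normalCutoff_of_nonpos hκ e hx
  · filter_upwards [Ioc_mem_nhdsGT hx] with κ hκ
    exact dirDeriv_normalCutoff_of_le hκ.1 e hκ.2

theorem abs_dirDeriv_normalVec_normalCutoff_mul_last_le {C : ℝ} (hC₀ : 0 ≤ C)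
    (hC : ∀ t, |deriv Real.smoothTransition t| ≤ C) (hκ : 0 < κ) (x : Space m) :
    |dirDeriv normalVec (normalCutoff κ) x * x (Fin.last m)| ≤ C := by
  rcases le_total (x (Fin.last m)) 0 with hx | hx
  · simpa [dirDeriv_normalCutoff_of_nonpos hκ normalVec hx] using hC₀
  rcases le_total κ (x (Fin.last m)) with hx' | hx'
  · simpa [dirDeriv_normalCutoff_of_le hκ normalVec hx'] using hC₀
  · have hratio : |x (Fin.last m) / κ| ≤ 1 := by
      rw [abs_of_nonneg (div_nonneg hx hκ.le)]
      exact div_le_one_of_le₀ hx' hκ.le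
    rw [dirDeriv_normalCutoff, normalVec_last, mul_one, div_mul_eq_mul_div, mul_div_assoc, abs_mul]
    exact (mul_le_mul (hC _) hratio (abs_nonneg _) hC₀).trans (mul_one C).le

theorem tendsto_normalCutoff (x : Space m) :
    Tendsto (fun κ => normalCutoff κ x) (𝓝[>] 0) (𝓝 ((upperHalfSpace m).indicator 1 x)) := by
  refine tendsto_const_nhds.congr' ?_
  by_cases hx : x ∈ upperHalfSpace m
  · filter_upwards [Ioc_mem_nhdsGT (show 0 < x (Fin.last m) from hx)] with κ hκ
    rw [indicator_of_mem hx, normalCutoff,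
      Real.smoothTransition.one_of_one_le ((one_le_div hκ.1).2 hκ.2), Pi.one_apply]
  · filter_upwards [self_mem_nhdsWithin] with κ hκ
    rw [indicator_of_notMem hx, normalCutoff, Real.smoothTransition.zero_of_nonpos
      (div_nonpos_of_nonpos_of_nonneg (not_lt.1 hx) (le_of_lt hκ))]

theorem tendsto_integral_normalCutoff_mul {F : Space m → ℝ} (hF : Integrable F) :
    Tendsto (fun κ => ∫ x, normalCutoff κ x * F x) (𝓝[>] 0)
      (𝓝 (∫ x in upperHalfSpace m, F x)) := by
  have hindicator : ∫ x in upperHalfSpace m, F x =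
      ∫ x, (upperHalfSpace m).indicator 1 x * F x := by
    simp only [← indicator_mul_left, Pi.one_apply, one_mul,
      integral_indicator measurableSet_upperHalfSpace]
  rw [hindicator]
  refine tendsto_integral_filter_of_dominated_convergence (fun x => |F x|) (.of_forall fun κ =>
      (contDiff_normalCutoff κ).continuous.aestronglyMeasurable.mul hF.aestronglyMeasurable)
    (.of_forall fun κ => .of_forall fun x => ?_) hF.abs
    (.of_forall fun x => (tendsto_normalCutoff x).mul_const _)
  rw [norm_mul, Real.norm_of_nonneg (normalCutoff_nonneg κ x)]
  exact mul_le_of_le_one_left (abs_nonneg _) (normalCutoff_le_one κ x)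

theorem tendsto_integral_mul_dirDeriv_normalCutoff {f g : Space m → ℝ} (hf : LocallyIntegrable f)
    (hg : IsTestFunction g) :
    Tendsto (fun κ => ∫ x, f x * (dirDeriv normalVec (normalCutoff κ) x *
      (x (Fin.last m) * g x))) (𝓝[>] 0) (𝓝 0) := by
  obtain ⟨C, hC₀, hC⟩ := exists_abs_deriv_smoothTransition_le
  obtain ⟨B, hB⟩ := hg.hasCompactSupport.exists_bound_of_continuous hg.continuous
  have hlim := tendsto_integral_mul_of_bounded (C := C * B) (l := 𝓝[>] (0 : ℝ)) (G := 0)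
    (F := fun κ x => dirDeriv normalVec (normalCutoff κ) x * (x (Fin.last m) * g x)) hf
    hg.hasCompactSupport (.of_forall fun κ => Continuous.aestronglyMeasurable ?_) ?_
    (.of_forall fun κ x hx => by simp [image_eq_zero_of_notMem_tsupport hx])
    (.of_forall fun x => tendsto_const_nhds.congr' ?_)
  · simpa using hlim
  · exact (contDiff_dirDeriv (contDiff_normalCutoff κ) _).continuous.mul
      ((contDiff_coord _).continuous.mul hg.continuous)
  · filter_upwards [self_mem_nhdsWithin] with κ hκ x _
    rw [← mul_assoc, abs_mul]
    exact mul_le_mul (abs_dirDeriv_normalVec_normalCutoff_mul_last_le hC₀ hC hκ x) (hB x)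
      (abs_nonneg _) hC₀
  · filter_upwards [eventually_dirDeriv_normalCutoff_eq_zero normalVec x] with κ hκ
    rw [hκ, zero_mul, Pi.zero_apply]

end NormalCutoff

section ProductRules

theorem dirDeriv_mul_of_dirDeriv_eq_zero {E : Type*} [NormedAddCommGroup E] [NormedSpace ℝ E]
    {g ψ : E → ℝ} {e : E} (hg : Differentiable ℝ g) (hψ : Differentiable ℝ ψ)
    (hg₀ : dirDeriv e g = 0) : dirDeriv e (fun x => g x * ψ x) = fun x => g x * dirDeriv e ψ x := by
  ext x
  rw [dirDeriv_mul_apply e (hg x) (hψ x), hg₀, Pi.zero_apply, zero_mul, add_zero]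

theorem tangentialLaplacian_mul_of_dirDeriv_eq_zero {m : ℕ} {g ψ : Space m → ℝ}
    (hg : Differentiable ℝ g) (hψ : ContDiff ℝ ∞ ψ)
    (hg₀ : ∀ e : Space m, e (Fin.last m) = 0 → dirDeriv e g = 0) (x : Space m) :
    tangentialLaplacian (fun x => g x * ψ x) x = g x * tangentialLaplacian ψ x := by
  simp only [tangentialLaplacian, Finset.mul_sum]
  refine Finset.sum_congr rfl fun i _ => ?_
  have hi := hg₀ _ (basisVec_castSucc_last i)
  rw [dirDeriv_mul_of_dirDeriv_eq_zero hg (hψ.differentiable (by simp)) hi,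
    dirDeriv_mul_of_dirDeriv_eq_zero hg (differentiable_dirDeriv hψ _) hi]

end ProductRules

section HalfSpaceParts

variable {m : ℕ} {q D v G g Ψ ψ : Space m → ℝ} {e : Space m} {μ : Measure (Space m)}

theorem setIntegral_upperHalfSpace_mul_tangentialLaplacian_nonneg (hq : Continuous q)
    (hconv : IsConvexAlongThin q) (hψ : IsTestFunction ψ) (hψ₀ : ∀ x, 0 ≤ ψ x) :
    0 ≤ ∫ x in upperHalfSpace m, q x * tangentialLaplacian ψ x := by
  refine ge_of_tendsto (tendsto_integral_normalCutoff_mul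
    (hψ.tangentialLaplacian.integrable_mul hq.locallyIntegrable)) (.of_forall fun κ => ?_)
  have hcut := integral_mul_tangentialLaplacian_nonneg hq hconv
    (hψ.mul_left (contDiff_normalCutoff κ)) fun x => mul_nonneg (normalCutoff_nonneg κ x) (hψ₀ x)
  simpa only [tangentialLaplacian_mul_of_dirDeriv_eq_zero (differentiable_normalCutoff κ)
    hψ.contDiff fun _ => dirDeriv_normalCutoff_of_tangential κ, mul_left_comm] using hcut

theorem setIntegral_upperHalfSpace_mul_of_tangential (hq : Continuous q) (hv : IsSymmDeriv e q v)
    (he : e (Fin.last m) = 0) (hψ : IsTestFunction ψ) :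
    ∫ x in upperHalfSpace m, v x * ψ x = -∫ x in upperHalfSpace m, q x * dirDeriv e ψ x := by
  refine tendsto_nhds_unique
    (tendsto_integral_normalCutoff_mul (hψ.integrable_mul (hv.locallyIntegrable hq volume)))
    ((tendsto_integral_normalCutoff_mul
      ((hψ.dirDeriv e).integrable_mul hq.locallyIntegrable)).neg.congr fun κ => ?_)
  have hparts := hv.integral_mul hq (ν := volume) (hψ.mul_left (contDiff_normalCutoff κ))
  rw [dirDeriv_mul_of_dirDeriv_eq_zero (differentiable_normalCutoff κ) hψ.differentiable
    (dirDeriv_normalCutoff_of_tangential κ he)] at hparts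
  simpa only [mul_left_comm] using hparts.symm

/-- The boundary term left by the integration by parts is `∫ q * Δ'Ψ` over the thin space, which is
nonnegative by convexity of `q` along it. -/
theorem setIntegral_upperHalfSpace_mul_tangentialLaplacian_le (hq : Continuous q)
    (hconv : IsConvexAlongThin q) (hD : IsSymmDeriv normalVec q D) (hΨ : IsTestFunction Ψ)
    (hΨ₀ : ∀ x, 0 ≤ x (Fin.last m) → 0 ≤ Ψ x) :
    ∫ x in upperHalfSpace m, D x * tangentialLaplacian Ψ x ≤
      -∫ x in upperHalfSpace m, q x * dirDeriv normalVec (tangentialLaplacian Ψ) x := by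
  have hΔ := hΨ.tangentialLaplacian
  refine le_of_tendsto_of_tendsto
    (tendsto_integral_normalCutoff_mul (hΔ.integrable_mul (hD.locallyIntegrable hq volume)))
    (tendsto_integral_normalCutoff_mul
      ((hΔ.dirDeriv normalVec).integrable_mul hq.locallyIntegrable)).neg ?_
  filter_upwards [self_mem_nhdsWithin] with κ hκ
  have hcut := contDiff_normalCutoff (m := m) κ
  have hcut' := contDiff_dirDeriv hcut normalVec
  have hboundary := integral_mul_tangentialLaplacian_nonneg hq hconv (hΨ.mul_left hcut')
    fun x => by
      rcases le_total (x (Fin.last m)) 0 with hx | hx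
      · rw [dirDeriv_normalCutoff_of_nonpos hκ normalVec hx, zero_mul]
      · exact mul_nonneg (dirDeriv_normalVec_normalCutoff_nonneg hκ x) (hΨ₀ x hx)
  simp only [tangentialLaplacian_mul_of_dirDeriv_eq_zero (hcut'.differentiable (by simp))
    hΨ.contDiff fun _ => dirDeriv_dirDeriv_normalVec_normalCutoff_of_tangential κ] at hboundary
  have hparts := hD.integral_mul hq (ν := volume) (hΔ.mul_left hcut)
  simp only [dirDeriv_mul_apply normalVec (differentiable_normalCutoff κ _)
    (hΔ.differentiable _), mul_add] at hparts
  rw [integral_add (((hΔ.dirDeriv _).mul_left hcut).integrable_mul hq.locallyIntegrable)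
    ((hΔ.mul_left hcut').integrable_mul hq.locallyIntegrable)] at hparts
  simp only [mul_left_comm (normalCutoff κ _)]
  linarith

theorem IsSymmDeriv.integral_mul_dirDeriv_comm {a b : Space m} (ha : IsSymmDeriv a q D)
    (hb : IsSymmDeriv b q v) (hq : Continuous q) (hψ : IsTestFunction ψ) :
    ∫ x, D x * dirDeriv b ψ x = ∫ x, v x * dirDeriv a ψ x := by
  rw [ha.integral_mul hq (hψ.dirDeriv b), hb.integral_mul hq (hψ.dirDeriv a),
    dirDeriv_comm (contDiff_infty.1 hψ.contDiff 2)]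

theorem setIntegral_upperHalfSpace_mul_dirDeriv_normalVec_le (hq : Continuous q)
    (hD : IsSymmDeriv normalVec q D) (hv : IsSymmDeriv e q v) (he : e (Fin.last m) = 0)
    (hv₀ : ∀ x, 0 ≤ v x) (hG : IsTestFunction G) (hg : IsTestFunction g)
    (hGg : ∀ x, 0 ≤ x (Fin.last m) → -(x (Fin.last m) * g x) ≤ G x) :
    ∫ x in upperHalfSpace m, v x * dirDeriv normalVec G x ≤
      ∫ x in upperHalfSpace m, D x * dirDeriv e G x := by
  have hvloc := hv.locallyIntegrable hq volume
  have hlim := (tendsto_integral_normalCutoff_mul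
    ((hG.dirDeriv e).integrable_mul (hD.locallyIntegrable hq volume))).add
    (tendsto_integral_mul_dirDeriv_normalCutoff hvloc hg)
  rw [add_zero] at hlim
  refine le_of_tendsto_of_tendsto (tendsto_integral_normalCutoff_mul
    ((hG.dirDeriv normalVec).integrable_mul hvloc)) hlim ?_
  filter_upwards [self_mem_nhdsWithin] with κ hκ
  have hcut := contDiff_normalCutoff (m := m) κ
  have hcut' := contDiff_dirDeriv hcut normalVec
  have hcomm := hD.integral_mul_dirDeriv_comm hv hq (hG.mul_left hcut)
  rw [dirDeriv_mul_of_dirDeriv_eq_zero (differentiable_normalCutoff κ) hG.differentiable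
    (dirDeriv_normalCutoff_of_tangential κ he)] at hcomm
  simp only [dirDeriv_mul_apply normalVec (differentiable_normalCutoff κ _) (hG.differentiable _),
    mul_add] at hcomm
  rw [integral_add (((hG.dirDeriv _).mul_left hcut).integrable_mul hvloc)
    ((hG.mul_left hcut').integrable_mul hvloc)] at hcomm
  have hboundary : -∫ x, v x * (dirDeriv normalVec (normalCutoff κ) x * G x) ≤
      ∫ x, v x * (dirDeriv normalVec (normalCutoff κ) x * (x (Fin.last m) * g x)) := by
    rw [← integral_neg]
    refine integral_mono ((hG.mul_left hcut').integrable_mul hvloc).neg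
      (((hg.mul_left (contDiff_coord _)).mul_left hcut').integrable_mul hvloc) fun x => ?_
    rcases le_total (x (Fin.last m)) 0 with hx | hx
    · simp [dirDeriv_normalCutoff_of_nonpos hκ normalVec hx]
    · have hweight := mul_nonneg (hv₀ x) (dirDeriv_normalVec_normalCutoff_nonneg hκ x)
      linarith [mul_le_mul_of_nonneg_left (hGg x hx) hweight]
  simp only [mul_left_comm (normalCutoff κ _)]
  linarith

theorem setIntegral_upperHalfSpace_mul_laplacian {f : Space m → ℝ} (hf : LocallyIntegrable f)
    (hΨ : IsTestFunction Ψ) :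
    ∫ x in upperHalfSpace m, f x * Δ Ψ x = (∫ x in upperHalfSpace m, f x * tangentialLaplacian Ψ x)
      + ∫ x in upperHalfSpace m, f x * dirDeriv normalVec (dirDeriv normalVec Ψ) x := by
  rw [← integral_add (hΨ.tangentialLaplacian.integrable_mul hf).integrableOn
    (((hΨ.dirDeriv _).dirDeriv _).integrable_mul hf).integrableOn]
  simp only [laplacian_eq_tangentialLaplacian_add hΨ.contDiff, mul_add]

variable [IsLocallyFiniteMeasure μ]

theorem setIntegral_normalDeriv_mul_laplacian_le (hq : Continuous q)
    (heven : ∀ x, q (mirror x) = q x) (hconv : IsConvexAlongThin q) (hμ : HasNegLaplacian q μ)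
    (hthin : ∀ᵐ x ∂μ, x (Fin.last m) = 0) (hD : IsSymmDeriv normalVec q D)
    (hΨ : IsTestFunction Ψ) (hΨ₀ : ∀ x, 0 ≤ x (Fin.last m) → 0 ≤ Ψ x) :
    ∫ x in upperHalfSpace m, D x * Δ Ψ x ≤ (1 / 2) * ∫ x, dirDeriv normalVec Ψ x ∂μ := by
  have hweak := setIntegral_upperHalfSpace_mul_tangentialLaplacian_sub_mul_normal hq heven hμ hthin
    hD (hΨ.dirDeriv normalVec)
  have hparts := setIntegral_upperHalfSpace_mul_tangentialLaplacian_le hq hconv hD hΨ hΨ₀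
  rw [dirDeriv_tangentialLaplacian hΨ.contDiff] at hparts
  rw [setIntegral_upperHalfSpace_mul_laplacian (hD.locallyIntegrable hq volume) hΨ]
  linarith

theorem setIntegral_tangentialDeriv_mul_laplacian_le (hq : Continuous q)
    (heven : ∀ x, q (mirror x) = q x) (hμ : HasNegLaplacian q μ)
    (hthin : ∀ᵐ x ∂μ, x (Fin.last m) = 0) (hD : IsSymmDeriv normalVec q D)
    (he : e (Fin.last m) = 0) (hv : IsSymmDeriv e q v) (hv₀ : ∀ x, 0 ≤ v x)
    (hΨ : IsTestFunction Ψ) (hg : IsTestFunction g)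
    (hΨg : ∀ x, 0 ≤ x (Fin.last m) → -(x (Fin.last m) * g x) ≤ dirDeriv normalVec Ψ x) :
    ∫ x in upperHalfSpace m, v x * Δ Ψ x ≤ (1 / 2) * ∫ x, dirDeriv e Ψ x ∂μ := by
  have hweak := setIntegral_upperHalfSpace_mul_tangentialLaplacian_sub_mul_normal hq heven hμ hthin
    hD (hΨ.dirDeriv e)
  have htan := setIntegral_upperHalfSpace_mul_of_tangential hq hv he hΨ.tangentialLaplacian
  have hnor := setIntegral_upperHalfSpace_mul_dirDeriv_normalVec_le hq hD hv he hv₀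
    (hΨ.dirDeriv normalVec) hg hΨg
  rw [dirDeriv_tangentialLaplacian hΨ.contDiff] at htan
  rw [dirDeriv_comm (contDiff_infty.1 hΨ.contDiff 2) e] at hnor
  rw [setIntegral_upperHalfSpace_mul_laplacian (hv.locallyIntegrable hq volume) hΨ]
  linarith

end HalfSpaceParts

section SlabCutoff

variable {m : ℕ} {q D φ : Space m → ℝ} {e : Space m} {μ : Measure (Space m)}

/-- A smooth function with values in `[0, 1]`, equal to `1` on the hyperplane orthogonal to `e` and
supported in a slab about it of thickness proportional to `κ`. -/
noncomputable def slabCutoff (e : Space m) (κ : ℝ) (x : Space m) : ℝ :=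
  (⟨1, 2, one_pos, one_lt_two⟩ : ContDiffBump (0 : ℝ)) (⟪e, x⟫ / κ)

theorem contDiff_slabCutoff (e : Space m) (κ : ℝ) : ContDiff ℝ ∞ (slabCutoff e κ) :=
  (ContDiffBump.contDiff _).comp ((innerSL ℝ e).contDiff.div_const κ)

theorem slabCutoff_nonneg (e : Space m) (κ : ℝ) (x : Space m) : 0 ≤ slabCutoff e κ x :=
  ContDiffBump.nonneg _

theorem slabCutoff_le_one (e : Space m) (κ : ℝ) (x : Space m) : slabCutoff e κ x ≤ 1 :=
  ContDiffBump.le_one _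

theorem slabCutoff_of_inner_eq_zero (κ : ℝ) {x : Space m} (hx : ⟪e, x⟫ = 0) :
    slabCutoff e κ x = 1 :=
  ContDiffBump.one_of_mem_closedBall _ (by simp [hx])

theorem eventually_slabCutoff_eq_zero {x : Space m} (hx : ⟪e, x⟫ ≠ 0) :
    ∀ᶠ κ in 𝓝[>] 0, slabCutoff e κ x = 0 := by
  filter_upwards [Ioo_mem_nhdsGT (half_pos (abs_pos.2 hx))] with κ hκ
  refine ContDiffBump.zero_of_le_dist _ ?_
  rw [dist_zero_right, Real.norm_eq_abs, abs_div, abs_of_pos hκ.1, le_div_iff₀ hκ.1]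
  linarith [hκ.2]

theorem dirDeriv_normalVec_slabCutoff (he : e (Fin.last m) = 0) (κ : ℝ) :
    dirDeriv normalVec (slabCutoff e κ) = 0 := by
  ext x
  have hline := hasDerivAt_comp_add_smul
    ((contDiff_slabCutoff e κ).differentiable (by simp)) x normalVec 0
  rw [zero_smul, add_zero] at hline
  refine hline.unique ((hasDerivAt_const _ (slabCutoff e κ x)).congr_of_eventuallyEq
    (.of_forall fun t => ?_))
  simp only [slabCutoff, inner_add_right, real_inner_smul_right, real_inner_comm normalVec,
    inner_normalVec, he, mul_zero, add_zero]

theorem tendsto_setIntegral_slabCutoff_mul (he : e ≠ 0) {F : Space m → ℝ} (hF : Integrable F)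
    (s : Set (Space m)) :
    Tendsto (fun κ => ∫ x in s, slabCutoff e κ x * F x) (𝓝[>] 0) (𝓝 0) := by
  have hne : ∀ᵐ x : Space m, ⟪e, x⟫ ≠ 0 := by
    simpa [ae_iff] using volume_inner_eq_zero he
  suffices h : Tendsto (fun κ => ∫ x in s, slabCutoff e κ x * F x) (𝓝[>] 0)
      (𝓝 (∫ _ in s, (0 : ℝ))) by simpa only [integral_zero] using h
  refine tendsto_integral_filter_of_dominated_convergence (fun x => |F x|)
    (.of_forall fun κ => (contDiff_slabCutoff e κ).continuous.aestronglyMeasurable.mul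
      hF.integrableOn.aestronglyMeasurable)
    (.of_forall fun κ => .of_forall fun x => ?_) hF.abs.integrableOn
    (ae_restrict_of_ae (hne.mono fun x hx => tendsto_const_nhds.congr' ?_))
  · rw [norm_mul, Real.norm_of_nonneg (slabCutoff_nonneg e κ x)]
    exact mul_le_of_le_one_left (abs_nonneg _) (slabCutoff_le_one e κ x)
  · filter_upwards [eventually_slabCutoff_eq_zero hx] with κ hκ
    rw [hκ, zero_mul]

theorem integral_eq_zero_of_ae_inner_eq_zero [IsLocallyFiniteMeasure μ] (hq : Continuous q)
    (heven : ∀ x, q (mirror x) = q x) (hconv : IsConvexAlongThin q) (hμ : HasNegLaplacian q μ)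
    (hthin : ∀ᵐ x ∂μ, x (Fin.last m) = 0) (hD : IsSymmDeriv normalVec q D)
    (he : e (Fin.last m) = 0) (he₀ : e ≠ 0) (hplane : ∀ᵐ x ∂μ, ⟪e, x⟫ = 0)
    (hφ : IsTestFunction φ) (hφ₀ : ∀ x, 0 ≤ φ x) : ∫ x, φ x ∂μ = 0 := by
  have hbound (κ : ℝ) : ∫ x, φ x ∂μ ≤ 2 * ∫ x in upperHalfSpace m,
      slabCutoff e κ x * (D x * dirDeriv normalVec φ x) := by
    have hψ : IsTestFunction fun x => slabCutoff e κ x * φ x :=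
      hφ.mul_left (contDiff_slabCutoff e κ)
    have hweak :=
      setIntegral_upperHalfSpace_mul_tangentialLaplacian_sub_mul_normal hq heven hμ hthin hD hψ
    have hnonneg := setIntegral_upperHalfSpace_mul_tangentialLaplacian_nonneg hq hconv hψ
      fun x => mul_nonneg (slabCutoff_nonneg e κ x) (hφ₀ x)
    have hmass : ∫ x, slabCutoff e κ x * φ x ∂μ = ∫ x, φ x ∂μ :=
      integral_congr_ae (hplane.mono fun x hx => by
        simp only [slabCutoff_of_inner_eq_zero κ hx, one_mul])
    rw [hmass, dirDeriv_mul_of_dirDeriv_eq_zero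
      ((contDiff_slabCutoff e κ).differentiable (by simp)) hφ.differentiable
      (dirDeriv_normalVec_slabCutoff he κ)] at hweak
    simp only [mul_left_comm (slabCutoff e κ _)]
    linarith
  have hlim := (tendsto_setIntegral_slabCutoff_mul he₀
    ((hφ.dirDeriv normalVec).integrable_mul (hD.locallyIntegrable hq volume))
    (upperHalfSpace m)).const_mul 2
  rw [mul_zero] at hlim
  exact le_antisymm (ge_of_tendsto hlim (.of_forall hbound)) (integral_nonneg hφ₀)

end SlabCutoff

section Dilations

variable {E : Type*} [NormedAddCommGroup E] [NormedSpace ℝ E]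

/-- The derivative `x · ∇ψ(x)` of `ψ` in the radial direction (the Euler operator). -/
noncomputable def radialDeriv (ψ : E → ℝ) : E → ℝ :=
  fun x => fderiv ℝ ψ x x

theorem IsTestFunction.radialDeriv {φ : E → ℝ} (hφ : IsTestFunction φ) :
    IsTestFunction (radialDeriv φ) := by
  refine ⟨(hφ.contDiff.fderiv_right (m := ∞) (by simp)).clm_apply contDiff_id,
    (hφ.hasCompactSupport.fderiv ℝ).mono fun x hx => ?_⟩
  contrapose! hx
  simp [_root_.radialDeriv, Function.notMem_support.1 hx]

theorem dirDeriv_comp_smul (ψ : E → ℝ) (r : ℝ) (e : E) :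
    dirDeriv e (fun x => ψ (r • x)) = fun x => r * dirDeriv e ψ (r • x) := by
  ext x
  simp only [dirDeriv, fderiv_comp_smul, smul_apply, smul_eq_mul]

theorem dirDeriv_const_mul (c : ℝ) (ψ : E → ℝ) (e : E) :
    dirDeriv e (fun x => c * ψ x) = fun x => c * dirDeriv e ψ x := by
  ext x
  exact DFunLike.congr_fun (congrFun (fderiv_const_smul_field (f := ψ) c) x) e

theorem hasDerivAt_comp_smul {ψ : E → ℝ} (h : Differentiable ℝ ψ) (x : E) (t : ℝ) :
    HasDerivAt (fun t : ℝ => ψ (t • x)) (fderiv ℝ ψ (t • x) x) t := by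
  simpa only [zero_add, dirDeriv] using hasDerivAt_comp_add_smul h 0 x t

theorem IsTestFunction.comp_smul {φ : E → ℝ} (hφ : IsTestFunction φ) {r : ℝ} (hr : r ≠ 0) :
    IsTestFunction (fun x => φ (r • x)) :=
  ⟨hφ.contDiff.comp (contDiff_const_smul r), hφ.hasCompactSupport.comp_smul hr⟩

theorem hasDerivAt_integral_mul_comp_smul [FiniteDimensional ℝ E] [MeasurableSpace E]
    [BorelSpace E] {ν : Measure E} {f φ : E → ℝ} (hf : LocallyIntegrable f ν)
    (hφ : IsTestFunction φ) {t₀ : ℝ} (ht₀ : 0 < t₀) :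
    HasDerivAt (fun t : ℝ => ∫ y, f y * φ (t • y) ∂ν)
      (t₀⁻¹ * ∫ y, f y * radialDeriv φ (t₀ • y) ∂ν) t₀ := by
  obtain ⟨R, -, hR⟩ := hφ.hasCompactSupport.exists_pos_le_norm
  obtain ⟨R', -, hR'⟩ := hφ.radialDeriv.hasCompactSupport.exists_pos_le_norm
  obtain ⟨C, hC⟩ := hφ.radialDeriv.hasCompactSupport.exists_bound_of_continuous
    hφ.radialDeriv.continuous
  have hfar {t : ℝ} (ht : t ∈ Ioi (t₀ / 2)) {y : E}
      (hy : y ∉ closedBall (0 : E) (max R R' / (t₀ / 2))) : max R R' ≤ ‖t • y‖ := by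
    have hy' : max R R' / (t₀ / 2) < ‖y‖ := by simpa using hy
    rw [div_lt_iff₀' (by positivity)] at hy'
    rw [norm_smul, Real.norm_eq_abs]
    exact hy'.le.trans (by gcongr; exact (mem_Ioi.1 ht).le.trans (le_abs_self t))
  have hderiv := hasDerivAt_integral_mul_of_bounded hf
    (isCompact_closedBall (0 : E) (max R R' / (t₀ / 2))) (g := fun t y => φ (t • y))
    (g' := fun t y => t⁻¹ * radialDeriv φ (t • y)) (C := (t₀ / 2)⁻¹ * C)
    (Ioi_mem_nhds (half_lt_self ht₀))
    (fun t => hφ.continuous.comp (continuous_const_smul t))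
    (continuous_const.mul (hφ.radialDeriv.continuous.comp (continuous_const_smul t₀)))
    (fun t ht y hy => hR _ ((le_max_left _ _).trans (hfar ht hy)))
    (fun t ht y hy => by rw [hR' _ ((le_max_right _ _).trans (hfar ht hy)), mul_zero])
    (fun t ht y => ?_) (fun t ht y => ?_)
  · simpa only [mul_left_comm _ t₀⁻¹, integral_const_mul] using hderiv
  · have ht₂ : t₀ / 2 < t := ht
    have ht₃ : 0 < t := (half_pos ht₀).trans ht₂
    rw [abs_mul, abs_of_pos (inv_pos.2 ht₃)]
    exact mul_le_mul (by gcongr) (hC _) (abs_nonneg _) (by positivity)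
  · have ht' : t ≠ 0 := ((half_pos ht₀).trans ht).ne'
    refine (hasDerivAt_comp_smul hφ.differentiable y t).congr_deriv ?_
    simp only [radialDeriv, map_smul, smul_eq_mul]
    field_simp

section Homogeneous

variable [FiniteDimensional ℝ E] [MeasurableSpace E] [BorelSpace E] {ν : Measure E}
  [ν.IsAddHaarMeasure] {u : E → ℝ} {a : ℝ}

theorem integral_mul_comp_smul_of_homogeneous (hu : ∀ r : ℝ, 0 < r → ∀ x, u (r • x) = r ^ a * u x)
    (φ : E → ℝ) {t : ℝ} (ht : 0 < t) :
    ∫ y, u y * φ (t • y) ∂ν = t ^ (-((Module.finrank ℝ E : ℝ) + a)) * ∫ x, u x * φ x ∂ν := by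
  have hsubst := Measure.integral_comp_smul ν (fun z => u (t⁻¹ • z) * φ z) t
  simp only [smul_smul, inv_mul_cancel₀ ht.ne', one_smul, hu t⁻¹ (inv_pos.2 ht), mul_assoc,
    integral_const_mul, smul_eq_mul] at hsubst
  rw [hsubst, ← mul_assoc, abs_of_pos (by positivity), Real.inv_rpow ht.le, neg_add,
    Real.rpow_add ht, Real.rpow_neg ht.le, Real.rpow_neg ht.le, Real.rpow_natCast]

theorem integral_mul_radialDeriv_of_homogeneous (hu : LocallyIntegrable u ν)
    (hhom : ∀ r : ℝ, 0 < r → ∀ x, u (r • x) = r ^ a * u x) {ψ : E → ℝ} (hψ : IsTestFunction ψ) :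
    ∫ x, u x * radialDeriv ψ x ∂ν = -((Module.finrank ℝ E : ℝ) + a) * ∫ x, u x * ψ x ∂ν := by
  have hdilate := hasDerivAt_integral_mul_comp_smul hu hψ one_pos
  have hpower := (Real.hasDerivAt_rpow_const (x := 1) (p := -((Module.finrank ℝ E : ℝ) + a))
    (Or.inl one_ne_zero)).mul_const (∫ x, u x * ψ x ∂ν)
  have heq : (fun t : ℝ => t ^ (-((Module.finrank ℝ E : ℝ) + a)) * ∫ x, u x * ψ x ∂ν) =ᶠ[𝓝 1]
      fun t => ∫ y, u y * ψ (t • y) ∂ν := by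
    filter_upwards [lt_mem_nhds (zero_lt_one' ℝ)] with t ht
    exact (integral_mul_comp_smul_of_homogeneous hhom ψ ht).symm
  simpa using (hdilate.congr_of_eventuallyEq heq).unique hpower

end Homogeneous

end Dilations

section RadialCutoff

variable {E : Type*} [NormedAddCommGroup E]

/-- A radial cutoff function, equal to `1` on the unit ball and to `0` outside the ball of radius
`√2`. -/
noncomputable def radialCutoff (x : E) : ℝ :=
  Real.smoothTransition (2 - ‖x‖ ^ 2)

/-- The nonnegative radial function `w` with `∇(radialCutoff) = -w(x) x`. -/
noncomputable def radialDensity (x : E) : ℝ :=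
  2 * deriv Real.smoothTransition (2 - ‖x‖ ^ 2)

theorem radialCutoff_of_two_lt {x : E} (hx : 2 < ‖x‖) : radialCutoff x = 0 :=
  Real.smoothTransition.zero_of_nonpos (by nlinarith)

theorem radialDensity_of_two_lt {x : E} (hx : 2 < ‖x‖) : radialDensity x = 0 := by
  rw [radialDensity, deriv_smoothTransition_of_nonpos (by nlinarith), mul_zero]

theorem radialCutoff_nonneg (x : E) : 0 ≤ radialCutoff x :=
  Real.smoothTransition.nonneg _

theorem radialCutoff_le_one (x : E) : radialCutoff x ≤ 1 :=
  Real.smoothTransition.le_one _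

theorem radialCutoff_of_norm_le_one {x : E} (hx : ‖x‖ ≤ 1) : radialCutoff x = 1 :=
  Real.smoothTransition.one_of_one_le (by nlinarith [norm_nonneg x])

theorem radialDensity_nonneg (x : E) : 0 ≤ radialDensity x :=
  mul_nonneg two_pos.le (deriv_smoothTransition_nonneg _)

variable [InnerProductSpace ℝ E]

theorem contDiff_radialCutoff : ContDiff ℝ ∞ (radialCutoff : E → ℝ) :=
  Real.smoothTransition.contDiff.comp (contDiff_const.sub (contDiff_norm_sq ℝ))

theorem contDiff_radialDensity : ContDiff ℝ ∞ (radialDensity : E → ℝ) :=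
  contDiff_const.mul
    (contDiff_deriv_smoothTransition.comp (contDiff_const.sub (contDiff_norm_sq ℝ)))

theorem dirDeriv_radialCutoff (e : E) :
    dirDeriv e radialCutoff = fun x => -⟪x, e⟫ * radialDensity x := by
  ext x
  have hnorm := ((hasStrictFDerivAt_norm_sq x).hasFDerivAt).const_sub 2
  have hcutoff : HasFDerivAt (radialCutoff : E → ℝ) _ x :=
    (differentiable_smoothTransition (2 - ‖x‖ ^ 2)).hasDerivAt.comp_hasFDerivAt x hnorm
  rw [dirDeriv, hcutoff.fderiv]
  simp [radialDensity]
  ring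

theorem radialDeriv_radialCutoff (x : E) :
    radialDeriv radialCutoff x = -(‖x‖ ^ 2 * radialDensity x) := by
  have h := congrFun (dirDeriv_radialCutoff x) x
  rwa [real_inner_self_eq_norm_sq, neg_mul] at h

theorem radialDeriv_eq_sum {ι : Type*} [Fintype ι] (b : OrthonormalBasis ι ℝ E) (ψ : E → ℝ)
    (x : E) : radialDeriv ψ x = ∑ i, ⟪x, b i⟫ * dirDeriv (b i) ψ x := by
  conv_lhs => rw [radialDeriv, ← b.sum_repr' x, map_sum, b.sum_repr' x]
  simp only [map_smul, smul_eq_mul, dirDeriv, real_inner_comm]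

variable [FiniteDimensional ℝ E]

theorem isTestFunction_radialCutoff : IsTestFunction (radialCutoff : E → ℝ) :=
  ⟨contDiff_radialCutoff, .intro (isCompact_closedBall 0 2) fun _ hx =>
    radialCutoff_of_two_lt (by simpa using hx)⟩

theorem isTestFunction_radialDensity : IsTestFunction (radialDensity : E → ℝ) :=
  ⟨contDiff_radialDensity, .intro (isCompact_closedBall 0 2) fun _ hx =>
    radialDensity_of_two_lt (by simpa using hx)⟩

theorem laplacian_radialCutoff (x : E) :
    Δ (radialCutoff : E → ℝ) x =
      -((Module.finrank ℝ E : ℝ) * radialDensity x + radialDeriv radialDensity x) := by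
  let b := stdOrthonormalBasis ℝ E
  have hsecond (i : Fin (Module.finrank ℝ E)) :
      dirDeriv (b i) (dirDeriv (b i) radialCutoff) x =
        -(⟪x, b i⟫ * dirDeriv (b i) radialDensity x) - radialDensity x := by
    have hinner : HasFDerivAt (fun x : E => -⟪x, b i⟫) _ x :=
      ((hasFDerivAt_id x).inner ℝ (hasFDerivAt_const (b i) x)).neg
    rw [dirDeriv_radialCutoff, dirDeriv_mul_apply (b i) hinner.differentiableAt
      (isTestFunction_radialDensity.differentiable x), dirDeriv, dirDeriv, hinner.fderiv]
    simp
    ring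
  rw [laplacian_eq_sum_dirDeriv b (contDiff_infty.1 contDiff_radialCutoff 2),
    radialDeriv_eq_sum b]
  simp only [hsecond, Finset.sum_sub_distrib, Finset.sum_neg_distrib, Finset.sum_const,
    Finset.card_univ, Fintype.card_fin, nsmul_eq_mul]
  ring

variable [MeasurableSpace E] [BorelSpace E]

theorem ae_eq_zero_of_homogeneous_of_integral_mul_radialCutoff {ν : Measure E} [ν.IsAddHaarMeasure]
    {u : E → ℝ} {a : ℝ} (hu : LocallyIntegrable u ν)
    (hhom : ∀ r : ℝ, 0 < r → ∀ x, u (r • x) = r ^ a * u x) (hu₀ : ∀ x, 0 ≤ u x)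
    (h : ∫ x, u x * radialCutoff x ∂ν = 0) : ∀ᵐ x ∂ν, u x = 0 := by
  have hscaled (k : ℕ) : ∀ᵐ x ∂ν, u x * radialCutoff ((k + 1 : ℝ)⁻¹ • x) = 0 := by
    have hk : (0 : ℝ) < (k + 1 : ℝ)⁻¹ := by positivity
    refine (integral_eq_zero_iff_of_nonneg (fun x => mul_nonneg (hu₀ x) (radialCutoff_nonneg _))
      ((isTestFunction_radialCutoff.comp_smul hk.ne').integrable_mul hu)).1 ?_
    rw [integral_mul_comp_smul_of_homogeneous hhom radialCutoff hk, h, mul_zero]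
  filter_upwards [ae_all_iff.2 hscaled] with x hx
  obtain ⟨k, hk⟩ := exists_nat_gt ‖x‖
  have hnorm : ‖(k + 1 : ℝ)⁻¹ • x‖ ≤ 1 := by
    rw [norm_smul, norm_inv, Real.norm_of_nonneg (by positivity), inv_mul_le_one₀ (by positivity)]
    linarith
  simpa [radialCutoff_of_norm_le_one hnorm] using hx k

theorem ae_eq_zero_of_homogeneous_of_integral_mul_radialDensity {ν : Measure E}
    [ν.IsAddHaarMeasure] {u : E → ℝ} {a : ℝ} (hu : LocallyIntegrable u ν)
    (hhom : ∀ r : ℝ, 0 < r → ∀ x, u (r • x) = r ^ a * u x) (hu₀ : ∀ x, 0 ≤ u x)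
    (ha : 0 < (Module.finrank ℝ E : ℝ) + a) (h : ∫ x, u x * radialDensity x ∂ν = 0) :
    ∀ᵐ x ∂ν, u x = 0 := by
  have hae : ∀ᵐ x ∂ν, u x * radialDensity x = 0 :=
    (integral_eq_zero_iff_of_nonneg (fun x => mul_nonneg (hu₀ x) (radialDensity_nonneg x))
      (isTestFunction_radialDensity.integrable_mul hu)).1 h
  have hradial : ∫ x, u x * radialDeriv radialCutoff x ∂ν = 0 := by
    refine integral_eq_zero_of_ae (hae.mono fun x hx => ?_)
    simp only [radialDeriv_radialCutoff, Pi.zero_apply]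
    linear_combination (-‖x‖ ^ 2) * hx
  rw [integral_mul_radialDeriv_of_homogeneous hu hhom isTestFunction_radialCutoff] at hradial
  exact ae_eq_zero_of_homogeneous_of_integral_mul_radialCutoff hu hhom hu₀
    ((mul_eq_zero.1 hradial).resolve_left (neg_ne_zero.2 ha.ne'))

theorem integral_radialDensity_pos [Nontrivial E] : 0 < ∫ x : E, radialDensity x := by
  refine (integral_nonneg radialDensity_nonneg).lt_of_ne fun h => ?_
  have hone : ∀ᵐ _ : E, (1 : ℝ) = 0 :=
    ae_eq_zero_of_homogeneous_of_integral_mul_radialDensity (a := 0)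
      continuous_const.locallyIntegrable (by simp) (fun _ => zero_le_one)
      (by simp [Module.finrank_pos]) (by simpa using h.symm)
  simp [ae_iff] at hone

end RadialCutoff

section Weyl

variable {E : Type*} [NormedAddCommGroup E] [InnerProductSpace ℝ E] [FiniteDimensional ℝ E]

theorem laplacian_comp_sub {φ : E → ℝ} (h : ContDiff ℝ 2 φ) (a : E) :
    Δ (fun x => φ (x - a)) = fun x => Δ φ (x - a) := by
  have hsub : ContDiff ℝ 2 fun x => φ (x - a) := h.comp (contDiff_id.sub contDiff_const)
  simp only [laplacian_eq_sum_dirDeriv (stdOrthonormalBasis ℝ E) h,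
    laplacian_eq_sum_dirDeriv (stdOrthonormalBasis ℝ E) hsub, dirDeriv_comp_sub]

theorem laplacian_comp_smul {ψ : E → ℝ} (h : ContDiff ℝ 2 ψ) (r : ℝ) :
    Δ (fun x => ψ (r • x)) = fun x => r ^ 2 * Δ ψ (r • x) := by
  have hsmul : ContDiff ℝ 2 fun x => ψ (r • x) := h.comp (contDiff_const_smul r)
  simp only [laplacian_eq_sum_dirDeriv (stdOrthonormalBasis ℝ E) h,
    laplacian_eq_sum_dirDeriv (stdOrthonormalBasis ℝ E) hsmul, dirDeriv_comp_smul,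
    dirDeriv_const_mul, ← mul_assoc, ← sq, ← Finset.mul_sum]

variable [MeasurableSpace E] [BorelSpace E]

/-- `Δ q = 0` in the sense of distributions. -/
def IsWeaklyHarmonic (q : E → ℝ) : Prop :=
  ∀ φ : E → ℝ, IsTestFunction φ → ∫ x, q x * Δ φ x = 0

theorem tendsto_integral_comp_smul_mul {g φ : E → ℝ} (hg : Continuous g)
    (hφ : IsTestFunction φ) :
    Tendsto (fun s : ℝ => ∫ z, g (s • z) * φ z) (𝓝 0) (𝓝 (g 0 * ∫ z, φ z)) := by
  have hcont : Continuous fun s : ℝ => ∫ z in tsupport φ, g (s • z) * φ z :=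
    continuous_parametric_integral_of_continuous
      (f := fun (s : ℝ) z => g (s • z) * φ z)
      ((hg.comp continuous_smul).mul (hφ.continuous.comp continuous_snd)) hφ.hasCompactSupport
  have hset (s : ℝ) : ∫ z in tsupport φ, g (s • z) * φ z = ∫ z, g (s • z) * φ z :=
    setIntegral_eq_integral_of_forall_compl_eq_zero fun z hz => by
      rw [image_eq_zero_of_notMem_tsupport hz, mul_zero]
  have hlim := hcont.tendsto 0
  simp only [hset] at hlim
  simpa only [zero_smul, integral_const_mul] using hlim

theorem integral_mul_dirDeriv_eq_neg {f φ : E → ℝ} (hf : ContDiff ℝ ∞ f) (hφ : IsTestFunction φ)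
    (e : E) : ∫ x, f x * dirDeriv e φ x = -∫ x, dirDeriv e f x * φ x :=
  integral_mul_fderiv_eq_neg_fderiv_mul_of_integrable
    (hφ.integrable_mul (contDiff_dirDeriv hf e).continuous.locallyIntegrable)
    ((hφ.dirDeriv e).integrable_mul hf.continuous.locallyIntegrable)
    (hφ.integrable_mul hf.continuous.locallyIntegrable)
    (fun x _ => hf.differentiable (by simp) x) fun x _ => hφ.differentiable x

namespace IsWeaklyHarmonic

variable {q : E → ℝ}

theorem comp_add (h : IsWeaklyHarmonic q) (a : E) : IsWeaklyHarmonic fun x => q (x + a) := by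
  intro φ hφ
  rw [← h _ (hφ.comp_sub a), laplacian_comp_sub (contDiff_infty.1 hφ.contDiff 2),
    integral_mul_comp_sub]

theorem finrank_mul_integral_add_eq_zero (h : IsWeaklyHarmonic q) (hq : LocallyIntegrable q)
    {t : ℝ} (ht : 0 < t) :
    (Module.finrank ℝ E : ℝ) * (∫ y, q y * radialDensity (t • y)) +
      ∫ y, q y * radialDeriv radialDensity (t • y) = 0 := by
  have htest := h _ (isTestFunction_radialCutoff.comp_smul ht.ne')
  simp only [laplacian_comp_smul (contDiff_infty.1 contDiff_radialCutoff 2),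
    laplacian_radialCutoff, mul_left_comm (q _) (t ^ 2), integral_const_mul] at htest
  have hsum := (mul_eq_zero.1 htest).resolve_left (by positivity)
  simp only [mul_neg, mul_add, integral_neg, neg_eq_zero, mul_left_comm (q _)] at hsum
  rwa [integral_add, integral_const_mul] at hsum
  · exact ((isTestFunction_radialDensity.comp_smul ht.ne').integrable_mul hq).const_mul _
  · exact (isTestFunction_radialDensity.radialDeriv.comp_smul ht.ne').integrable_mul hq

theorem hasDerivAt_pow_mul_integral (h : IsWeaklyHarmonic q) (hq : LocallyIntegrable q)
    [Nontrivial E] {t : ℝ} (ht : 0 < t) :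
    HasDerivAt (fun t : ℝ => t ^ Module.finrank ℝ E * ∫ y, q y * radialDensity (t • y)) 0 t := by
  refine ((hasDerivAt_pow (Module.finrank ℝ E) t).mul
    (hasDerivAt_integral_mul_comp_smul hq isTestFunction_radialDensity ht)).congr_deriv ?_
  have hpow := pow_sub_one_mul (Module.finrank_pos (R := ℝ) (M := E)).ne' t
  have hzero := h.finrank_mul_integral_add_eq_zero hq ht
  rw [← hpow]
  field_simp
  linear_combination t ^ (Module.finrank ℝ E - 1) * hzero

theorem integral_mul_radialDensity [Nontrivial E] (h : IsWeaklyHarmonic q) (hq : Continuous q) :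
    ∫ y, q y * radialDensity y = q 0 * ∫ y : E, radialDensity y := by
  -- By harmonicity the dilated means do not depend on the scale `s`; now let `s → 0`.
  have hderiv {t : ℝ} (ht : t ∈ Ioi (0 : ℝ)) :=
    h.hasDerivAt_pow_mul_integral hq.locallyIntegrable ht
  have hmean {s : ℝ} (hs : 0 < s) :
      ∫ z, q (s • z) * radialDensity z = ∫ y, q y * radialDensity y := by
    have hsubst := Measure.integral_comp_smul (volume : Measure E)
      (fun z => q (s • z) * radialDensity z) s⁻¹
    simp only [smul_smul, mul_inv_cancel₀ hs.ne', one_smul, smul_eq_mul] at hsubst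
    have hconst := isOpen_Ioi.is_const_of_deriv_eq_zero isPreconnected_Ioi
      (fun t ht => (hderiv ht).differentiableAt.differentiableWithinAt)
      (fun t ht => (hderiv ht).deriv) (inv_pos.2 hs) (zero_lt_one' ℝ)
    simp only [hsubst, one_pow, one_smul, one_mul] at hconst
    rwa [abs_of_pos (by positivity), ← mul_assoc, mul_inv_cancel₀ (by positivity),
      one_mul] at hconst
  refine tendsto_nhds_unique (tendsto_const_nhds.congr' ?_)
    ((tendsto_integral_comp_smul_mul hq isTestFunction_radialDensity).mono_left
      (nhdsWithin_le_nhds (s := Ioi 0)))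
  filter_upwards [self_mem_nhdsWithin] with s hs using (hmean hs).symm

theorem contDiff [Nontrivial E] (h : IsWeaklyHarmonic q) (hq : Continuous q) : ContDiff ℝ ∞ q := by
  have hconv : convolution q radialDensity (.mul ℝ ℝ) volume =
      fun a => q a * ∫ x : E, radialDensity x := by
    ext a
    have hmean := (h.comp_add a).integral_mul_radialDensity (by fun_prop)
    rw [zero_add] at hmean
    rw [convolution_def, ← hmean, ← integral_mul_comp_sub]
    simp only [ContinuousLinearMap.mul_apply', radialDensity, norm_sub_rev]
  have hsmooth := isTestFunction_radialDensity.hasCompactSupport.contDiff_convolution_right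
    (.mul ℝ ℝ) (μ := volume) hq.locallyIntegrable contDiff_radialDensity
  rw [hconv] at hsmooth
  simpa [integral_radialDensity_pos.ne'] using
    hsmooth.div_const (∫ x : E, radialDensity x)

theorem laplacian_eq_zero (h : IsWeaklyHarmonic q) (hq : ContDiff ℝ ∞ q) : Δ q = 0 := by
  let b := stdOrthonormalBasis ℝ E
  have hsecond (i : Fin (Module.finrank ℝ E)) :
      ContDiff ℝ ∞ (dirDeriv (b i) (dirDeriv (b i) q)) :=
    contDiff_dirDeriv (contDiff_dirDeriv hq _) _
  have hΔ : Δ q = fun x => ∑ i, dirDeriv (b i) (dirDeriv (b i) q) x :=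
    laplacian_eq_sum_dirDeriv b (contDiff_infty.1 hq 2)
  have hcont : Continuous (Δ q) := hΔ ▸ continuous_finsetSum _ fun i _ => (hsecond i).continuous
  have hparts {φ : E → ℝ} (hφ : IsTestFunction φ) : ∫ x, Δ q x * φ x = 0 := by
    rw [← h φ hφ]
    simp only [hΔ, laplacian_eq_sum_dirDeriv b (contDiff_infty.1 hφ.contDiff 2), Finset.mul_sum,
      Finset.sum_mul]
    rw [integral_finsetSum _ fun i _ => hφ.integrable_mul (hsecond i).continuous.locallyIntegrable,
      integral_finsetSum _ fun i _ =>
        ((hφ.dirDeriv _).dirDeriv _).integrable_mul hq.continuous.locallyIntegrable]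
    refine Finset.sum_congr rfl fun i _ => ?_
    rw [integral_mul_dirDeriv_eq_neg hq (hφ.dirDeriv _),
      integral_mul_dirDeriv_eq_neg (contDiff_dirDeriv hq _) hφ, neg_neg]
  refine (hcont.ae_eq_iff_eq volume continuous_const).1 ?_
  exact ae_eq_zero_of_integral_contDiff_smul_eq_zero hcont.locallyIntegrable fun φ hφ hφ' => by
    simpa only [smul_eq_mul, mul_comm] using hparts ⟨hφ, hφ'⟩

end IsWeaklyHarmonic

end Weyl

section Liouville

variable {m : ℕ}

namespace IsHomogeneousOfDegree

variable {f : Space m → ℝ} {lam : ℝ}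

theorem eq_zero_of_neg (hf : IsHomogeneousOfDegree f lam) (hc : Continuous f) (hlam : lam < 0) :
    f = 0 := by
  ext x
  have hlim : Tendsto (fun r : ℝ => r ^ (-lam) * f (r • x)) (𝓝[>] 0)
      (𝓝 (0 ^ (-lam) * f ((0 : ℝ) • x))) := by
    refine Tendsto.mono_left (ContinuousAt.mul ?_ ?_).tendsto nhdsWithin_le_nhds
    · exact Real.continuousAt_rpow_const _ _ (Or.inr (by linarith))
    · exact Continuous.continuousAt (by fun_prop)
  rw [Real.zero_rpow (by linarith), zero_mul] at hlim
  refine tendsto_nhds_unique (tendsto_const_nhds.congr' ?_) hlim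
  filter_upwards [self_mem_nhdsWithin] with r (hr : 0 < r)
  rw [hf r hr, ← mul_assoc, ← Real.rpow_add hr, neg_add_cancel, Real.rpow_zero, one_mul]

theorem eq_const (hf : IsHomogeneousOfDegree f 0) (hc : Continuous f) (x : Space m) :
    f x = f 0 := by
  have hray : Continuous fun r : ℝ => f (r • x) := by fun_prop
  have hlim := (hray.tendsto 0).mono_left (nhdsWithin_le_nhds (s := Ioi 0))
  rw [zero_smul] at hlim
  refine tendsto_nhds_unique (tendsto_const_nhds.congr' ?_) hlim
  filter_upwards [self_mem_nhdsWithin] with r hr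
  rw [hf r hr, Real.rpow_zero, one_mul]

theorem dirDeriv (hf : IsHomogeneousOfDegree f lam) (e : Space m) :
    IsHomogeneousOfDegree (dirDeriv e f) (lam - 1) := by
  intro r hr x
  have hscale := congrFun (dirDeriv_comp_smul f r e) x
  rw [funext (hf r hr), dirDeriv_const_mul] at hscale
  rw [Real.rpow_sub_one hr.ne', div_mul_eq_mul_div, eq_div_iff hr.ne', mul_comm _ r]
  exact hscale.symm

theorem radialDeriv_eq (hf : IsHomogeneousOfDegree f lam) (hd : Differentiable ℝ f)
    (x : Space m) : radialDeriv f x = lam * f x := by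
  have hray := hasDerivAt_comp_smul hd x 1
  have hpow := (Real.hasDerivAt_rpow_const (x := 1) (p := lam) (Or.inl one_ne_zero)).mul_const (f x)
  simp only [one_smul, Real.one_rpow, mul_one] at hray hpow
  refine hray.unique (hpow.congr_of_eventuallyEq ?_)
  filter_upwards [lt_mem_nhds (zero_lt_one' ℝ)] with t ht using hf t ht x

theorem sum_mul_dirDeriv (hf : IsHomogeneousOfDegree f lam) (hd : Differentiable ℝ f)
    (x : Space m) : ∑ i, x i * _root_.dirDeriv (basisVec i) f x = lam * f x := by
  rw [← hf.radialDeriv_eq hd, radialDeriv_eq_sum (EuclideanSpace.basisFun _ ℝ)]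
  simp [basisVec, EuclideanSpace.inner_single_right]

/-- Each derivative lowers the degree of homogeneity by one, and a continuous function cannot be
homogeneous of negative degree; Euler's identity recovers the function from its derivatives. -/
theorem exists_mvPolynomial_and_natCast (hf : IsHomogeneousOfDegree f lam)
    (hs : ContDiff ℝ ∞ f) :
    (∃ P : MvPolynomial (Fin (m + 1)) ℝ, ∀ x, f x = MvPolynomial.eval (fun i => x i) P) ∧
      (f ≠ 0 → ∃ k : ℕ, lam = k) := by
  obtain ⟨N, hN⟩ := exists_nat_gt lam
  induction N generalizing lam f with
  | zero =>
    have hzero := hf.eq_zero_of_neg hs.continuous (by simpa using hN)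
    exact ⟨⟨0, fun x => by simp [hzero]⟩, fun hne => absurd hzero hne⟩
  | succ N ih =>
    obtain rfl | hlam := eq_or_ne lam 0
    · exact ⟨⟨MvPolynomial.C (f 0), fun x => by simp [hf.eq_const hs.continuous x]⟩,
        fun _ => ⟨0, by simp⟩⟩
    have hderiv (i : Fin (m + 1)) := ih (hf.dirDeriv (basisVec i)) (contDiff_dirDeriv hs _)
      (by push_cast at hN; linarith)
    choose P hP using fun i => (hderiv i).1
    have euler := hf.sum_mul_dirDeriv (hs.differentiable (by simp))
    refine ⟨⟨MvPolynomial.C lam⁻¹ * ∑ i, MvPolynomial.X i * P i, fun x => ?_⟩, fun hne => ?_⟩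
    · simp only [map_mul, map_sum, MvPolynomial.eval_C, MvPolynomial.eval_X, ← hP, euler]
      field_simp
    · obtain ⟨i, hi⟩ : ∃ i, _root_.dirDeriv (basisVec i) f ≠ 0 := by
        by_contra! hall
        refine hne (funext fun x => (mul_eq_zero.1 ?_).resolve_left hlam)
        simp [← euler, hall]
      obtain ⟨k, hk⟩ := (hderiv i).2 hi
      exact ⟨k + 1, by push_cast; linarith⟩

theorem exists_eq_sum_mul (hf : IsHomogeneousOfDegree f 1) (hs : ContDiff ℝ ∞ f) :
    ∃ c : Fin (m + 1) → ℝ, ∀ x, f x = ∑ i, x i * c i := by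
  refine ⟨fun i => _root_.dirDeriv (basisVec i) f 0, fun x => ?_⟩
  rw [← one_mul (f x), ← hf.sum_mul_dirDeriv (hs.differentiable (by simp))]
  refine Finset.sum_congr rfl fun i _ => ?_
  have hdegree := hf.dirDeriv (basisVec i)
  rw [sub_self] at hdegree
  rw [hdegree.eq_const (contDiff_dirDeriv hs _).continuous]

end IsHomogeneousOfDegree

theorem IsWeaklyHarmonic.isHarmonicPolynomial {q : Space m → ℝ} {lam : ℝ}
    (h : IsWeaklyHarmonic q) (hq : Continuous q) (hf : IsHomogeneousOfDegree q lam) :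
    IsHarmonicPolynomial q := by
  have hs := h.contDiff hq
  exact ⟨(hf.exists_mvPolynomial_and_natCast hs).1, fun x _ =>
    ⟨(contDiff_infty.1 hs 2).contDiffAt, .of_eq (h.laplacian_eq_zero hs)⟩⟩

theorem IsWeaklyHarmonic.exists_natCast_eq_degree {q : Space m → ℝ} {lam : ℝ}
    (h : IsWeaklyHarmonic q) (hq : Continuous q) (hf : IsHomogeneousOfDegree q lam) (hne : q ≠ 0) :
    ∃ k : ℕ, lam = k :=
  (hf.exists_mvPolynomial_and_natCast (h.contDiff hq)).2 hne

end Liouville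

/-! ### The half-harmonic function of degree `1/2` -/

/-- The modulus of the complex number `X + iY`. -/
noncomputable def modulus (X Y : ℝ) : ℝ := √(X ^ 2 + Y ^ 2)

/-- The real part of the principal square root of `X + iY`. -/
noncomputable def halfPower (X Y : ℝ) : ℝ := √((modulus X Y + X) / 2)

/-- The partial derivative of `halfPower` in the first variable, for `Y > 0`. -/
noncomputable def halfPowerX (X Y : ℝ) : ℝ := halfPower X Y / (2 * modulus X Y)

/-- The partial derivative of `halfPower` in the second variable, for `Y > 0`. -/
noncomputable def halfPowerY (X Y : ℝ) : ℝ := Y / (4 * modulus X Y * halfPower X Y)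

section HalfPower

variable {X Y d : ℝ}

theorem modulus_nonneg (X Y : ℝ) : 0 ≤ modulus X Y := Real.sqrt_nonneg _

theorem modulus_pos (X : ℝ) (hY : 0 < Y) : 0 < modulus X Y := Real.sqrt_pos.2 (by positivity)

theorem modulus_sq (X Y : ℝ) : modulus X Y ^ 2 = X ^ 2 + Y ^ 2 := Real.sq_sqrt (by positivity)

theorem le_modulus (X Y : ℝ) : Y ≤ modulus X Y :=
  Real.le_sqrt_of_sq_le (by nlinarith [sq_nonneg X])

theorem abs_le_modulus (X Y : ℝ) : |X| ≤ modulus X Y :=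
  Real.abs_le_sqrt (by nlinarith [sq_nonneg Y])

theorem modulus_le_abs_add_abs (X Y : ℝ) : modulus X Y ≤ |X| + |Y| := by
  refine Real.sqrt_le_iff.2 ⟨by positivity, ?_⟩
  nlinarith [sq_abs X, sq_abs Y, mul_nonneg (abs_nonneg X) (abs_nonneg Y)]

theorem modulus_add_pos (X : ℝ) (hY : 0 < Y) : 0 < modulus X Y + X := by
  have habs : |X| < modulus X Y := Real.lt_sqrt_of_sq_lt (by rw [sq_abs]; nlinarith)
  linarith [neg_abs_le X]

theorem modulus_mul {r : ℝ} (hr : 0 ≤ r) (X Y : ℝ) :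
    modulus (r * X) (r * Y) = r * modulus X Y := by
  rw [modulus, show (r * X) ^ 2 + (r * Y) ^ 2 = r ^ 2 * (X ^ 2 + Y ^ 2) by ring,
    Real.sqrt_mul (by positivity), Real.sqrt_sq hr, modulus]

theorem halfPower_nonneg (X Y : ℝ) : 0 ≤ halfPower X Y := Real.sqrt_nonneg _

theorem halfPower_pos (X : ℝ) (hY : 0 < Y) : 0 < halfPower X Y :=
  Real.sqrt_pos.2 (half_pos (modulus_add_pos X hY))

theorem halfPower_sq (X Y : ℝ) : halfPower X Y ^ 2 = (modulus X Y + X) / 2 :=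
  Real.sq_sqrt (by linarith [abs_le_modulus X Y, neg_abs_le X])

theorem halfPower_sq_le_modulus (X Y : ℝ) : halfPower X Y ^ 2 ≤ modulus X Y := by
  rw [halfPower_sq]
  linarith [le_abs_self X, abs_le_modulus X Y]

theorem two_mul_halfPower_sq_sub_modulus (X Y : ℝ) :
    2 * halfPower X Y ^ 2 - modulus X Y = X := by
  rw [halfPower_sq]
  ring

theorem sq_eq_four_mul_halfPower_sq (X Y : ℝ) :
    Y ^ 2 = 4 * halfPower X Y ^ 2 * (modulus X Y - halfPower X Y ^ 2) := by
  have hsq := modulus_sq X Y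
  rw [halfPower_sq]
  nlinarith

theorem halfPower_mul {r : ℝ} (hr : 0 ≤ r) (X Y : ℝ) :
    halfPower (r * X) (r * Y) = r ^ (1 / 2 : ℝ) * halfPower X Y := by
  rw [halfPower, modulus_mul hr, ← mul_add, mul_div_assoc, Real.sqrt_mul hr, ← Real.sqrt_eq_rpow,
    halfPower]

theorem continuous_modulus : Continuous fun p : ℝ × ℝ => modulus p.1 p.2 := by
  unfold modulus
  fun_prop

theorem continuous_halfPower : Continuous fun p : ℝ × ℝ => halfPower p.1 p.2 :=
  ((continuous_modulus.add continuous_fst).div_const 2).sqrt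

theorem halfPowerX_nonneg (X Y : ℝ) : 0 ≤ halfPowerX X Y :=
  div_nonneg (halfPower_nonneg _ _) (mul_nonneg two_pos.le (modulus_nonneg _ _))

theorem halfPowerY_nonneg (X : ℝ) (hY : 0 ≤ Y) : 0 ≤ halfPowerY X Y :=
  div_nonneg hY (mul_nonneg (mul_nonneg four_pos.le (modulus_nonneg _ _)) (halfPower_nonneg _ _))

theorem hasDerivAt_modulus_left (X : ℝ) (hY : 0 < Y) :
    HasDerivAt (fun X => modulus X Y) (X / modulus X Y) X := by
  have hsq : X ^ 2 + Y ^ 2 ≠ 0 := by positivity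
  refine (((hasDerivAt_pow 2 X).add_const (Y ^ 2)).sqrt hsq).congr_deriv ?_
  rw [← modulus]
  field_simp
  ring

theorem hasDerivAt_modulus_right (X : ℝ) (hY : 0 < Y) :
    HasDerivAt (fun Y => modulus X Y) (Y / modulus X Y) Y := by
  have hsq : X ^ 2 + Y ^ 2 ≠ 0 := by positivity
  refine (((hasDerivAt_pow 2 Y).const_add (X ^ 2)).sqrt hsq).congr_deriv ?_
  rw [← modulus]
  field_simp
  ring

theorem hasDerivAt_halfPower_left (X : ℝ) (hY : 0 < Y) :
    HasDerivAt (fun X => halfPower X Y) (halfPowerX X Y) X := by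
  have hr := modulus_pos X hY
  have hw := halfPower_pos X hY
  have hX := two_mul_halfPower_sq_sub_modulus X Y
  refine ((((hasDerivAt_modulus_left X hY).fun_add (hasDerivAt_id' X)).div_const 2).sqrt
    (half_pos (modulus_add_pos X hY)).ne').congr_deriv ?_
  rw [← halfPower, halfPowerX]
  field_simp
  linarith

theorem hasDerivAt_halfPower_right (X : ℝ) (hY : 0 < Y) :
    HasDerivAt (fun Y => halfPower X Y) (halfPowerY X Y) Y := by
  refine ((((hasDerivAt_modulus_right X hY).add_const X).div_const 2).sqrt
    (half_pos (modulus_add_pos X hY)).ne').congr_deriv ?_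
  rw [← halfPower, halfPowerY]
  field_simp
  ring

theorem exists_hasDerivAt_halfPowerX_and_halfPowerY_neg (X : ℝ) (hY : 0 < Y) :
    ∃ c : ℝ, HasDerivAt (fun X => halfPowerX X Y) c X ∧
      HasDerivAt (fun Y => halfPowerY X Y) (-c) Y := by
  have hr := modulus_pos X hY
  have hw := halfPower_pos X hY
  have hderivX := (hasDerivAt_halfPower_left X hY).fun_div
    ((hasDerivAt_modulus_left X hY).const_mul 2) (by positivity)
  have hderivY := (hasDerivAt_id' Y).fun_div (((hasDerivAt_modulus_right X hY).const_mul 4).fun_mul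
    (hasDerivAt_halfPower_right X hY)) (by positivity)
  refine ⟨_, hderivX, hderivY.congr_deriv ?_⟩
  have hY2 := sq_eq_four_mul_halfPower_sq X Y
  have hX := (two_mul_halfPower_sq_sub_modulus X Y).symm
  simp only [halfPowerX, halfPowerY]
  generalize halfPower X Y = w at *
  generalize modulus X Y = r at *
  subst hX
  field_simp
  rw [hY2]
  ring

theorem mul_halfPowerX_add_mul_halfPowerY (X : ℝ) (hY : 0 < Y) :
    X * halfPowerX X Y + Y * halfPowerY X Y = 1 / 2 * halfPower X Y := by
  have hr := modulus_pos X hY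
  have hw := halfPower_pos X hY
  have hY2 := sq_eq_four_mul_halfPower_sq X Y
  have hX := (two_mul_halfPower_sq_sub_modulus X Y).symm
  simp only [halfPowerX, halfPowerY]
  generalize halfPower X Y = w at *
  generalize modulus X Y = r at *
  subst hX
  field_simp
  rw [hY2]
  ring

theorem abs_mul_halfPowerX_le_one (X : ℝ) (hY : 0 < Y) (hd : d ^ 2 ≤ Y) :
    |d * halfPowerX X Y| ≤ 1 := by
  have hr := modulus_pos X hY
  refine abs_le_of_sq_le_sq ?_ zero_le_one
  rw [halfPowerX, ← mul_div_assoc, div_pow, div_le_iff₀ (by positivity)]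
  calc (d * halfPower X Y) ^ 2 = d ^ 2 * halfPower X Y ^ 2 := by ring
    _ ≤ modulus X Y * modulus X Y := mul_le_mul (hd.trans (le_modulus X Y))
        (halfPower_sq_le_modulus X Y) (sq_nonneg _) hr.le
    _ ≤ 1 ^ 2 * (2 * modulus X Y) ^ 2 := by nlinarith

theorem abs_mul_halfPowerY_le_one (X : ℝ) {h : ℝ} (hh : 0 ≤ h) (hY : 0 < Y) (hhY : h ≤ Y)
    (hh1 : h ≤ 1) : |h * halfPowerY X Y| ≤ 1 := by
  have hr := modulus_pos X hY
  have hw := halfPower_pos X hY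
  have hY2 : Y ^ 2 ≤ 4 * halfPower X Y ^ 2 * modulus X Y := by
    rw [sq_eq_four_mul_halfPower_sq X Y]
    gcongr
    exact sub_le_self _ (sq_nonneg _)
  have hh2 : h ^ 2 ≤ modulus X Y := by nlinarith [le_modulus X Y]
  refine abs_le_of_sq_le_sq ?_ zero_le_one
  rw [halfPowerY, ← mul_div_assoc, div_pow, div_le_iff₀ (by positivity)]
  calc (h * Y) ^ 2 = h ^ 2 * Y ^ 2 := by ring
    _ ≤ modulus X Y * (4 * halfPower X Y ^ 2 * modulus X Y) := by gcongr
    _ ≤ 1 ^ 2 * (4 * modulus X Y * halfPower X Y) ^ 2 := by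
      nlinarith [show 0 ≤ modulus X Y ^ 2 * halfPower X Y ^ 2 by positivity]

theorem halfPower_sq_le_pow_of_le_neg (hd : 0 < d) (hX : X ≤ -d) :
    halfPower X (d ^ 2) ^ 2 ≤ d ^ 3 := by
  have hgap : d ≤ modulus X (d ^ 2) - halfPower X (d ^ 2) ^ 2 := by
    rw [halfPower_sq]
    linarith [abs_le_modulus X (d ^ 2), neg_le_abs X]
  have hmul : 4 * halfPower X (d ^ 2) ^ 2 * d ≤ d ^ 3 * d :=
    calc 4 * halfPower X (d ^ 2) ^ 2 * d
        ≤ 4 * halfPower X (d ^ 2) ^ 2 * (modulus X (d ^ 2) - halfPower X (d ^ 2) ^ 2) := by gcongr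
      _ = (d ^ 2) ^ 2 := (sq_eq_four_mul_halfPower_sq X (d ^ 2)).symm
      _ = d ^ 3 * d := by ring
  nlinarith [le_of_mul_le_mul_right hmul hd, sq_nonneg (halfPower X (d ^ 2))]

theorem halfPowerX_le_sqrt_of_le_neg (hd : 0 < d) (hX : X ≤ -d) : halfPowerX X (d ^ 2) ≤ √d := by
  have hr : d ≤ modulus X (d ^ 2) := by linarith [abs_le_modulus X (d ^ 2), neg_le_abs X]
  have hr₀ := hd.trans_le hr
  refine Real.le_sqrt_of_sq_le ?_
  rw [halfPowerX, div_pow, div_le_iff₀ (by positivity)]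
  calc halfPower X (d ^ 2) ^ 2 ≤ d ^ 3 := halfPower_sq_le_pow_of_le_neg hd hX
    _ = d * d ^ 2 := by ring
    _ ≤ d * (2 * modulus X (d ^ 2)) ^ 2 := by
      gcongr
      linarith

theorem halfPowerY_le_sqrt_of_le (hd : 0 < d) (hX : d ≤ X) : halfPowerY X (d ^ 2) ≤ √d := by
  have hr : d ≤ modulus X (d ^ 2) := by linarith [abs_le_modulus X (d ^ 2), le_abs_self X]
  have hw : d ≤ halfPower X (d ^ 2) ^ 2 := by
    rw [halfPower_sq]
    linarith
  have hr₀ := hd.trans_le hr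
  have hw₀ := halfPower_pos X (pow_pos hd 2)
  refine Real.le_sqrt_of_sq_le ?_
  rw [halfPowerY, div_pow, div_le_iff₀ (by positivity)]
  calc (d ^ 2) ^ 2 = d * (d ^ 2 * d) := by ring
    _ ≤ d * (modulus X (d ^ 2) ^ 2 * halfPower X (d ^ 2) ^ 2) := by gcongr
    _ ≤ d * (4 * modulus X (d ^ 2) * halfPower X (d ^ 2)) ^ 2 := by
      gcongr
      nlinarith [show 0 ≤ modulus X (d ^ 2) ^ 2 * halfPower X (d ^ 2) ^ 2 by positivity]

end HalfPower

/-! ### Barriers -/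

section Product

variable {E : Type*} [NormedAddCommGroup E]

theorem dirDeriv_eq_of_hasDerivAt [NormedSpace ℝ E] {f : E → ℝ} (hf : ContDiff ℝ ∞ f) {x v : E}
    {c : ℝ} (h : HasDerivAt (fun t : ℝ => f (x + t • v)) c 0) : dirDeriv v f x = c := by
  have hline := hasDerivAt_comp_add_smul (hf.differentiable (by simp)) x v 0
  rw [zero_smul, add_zero] at hline
  exact hline.unique h

theorem laplacian_mul [InnerProductSpace ℝ E] [FiniteDimensional ℝ E] {ι : Type*} [Fintype ι]
    (b : OrthonormalBasis ι ℝ E) {f g : E → ℝ} (hf : ContDiff ℝ ∞ f) (hg : ContDiff ℝ ∞ g)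
    (x : E) :
    Δ (fun x => f x * g x) x =
      f x * Δ g x + 2 * (∑ i, dirDeriv (b i) f x * dirDeriv (b i) g x) + Δ f x * g x := by
  have hdf := hf.differentiable (by simp)
  have hdg := hg.differentiable (by simp)
  rw [laplacian_eq_sum_dirDeriv b (contDiff_infty.1 (hf.mul hg) 2),
    laplacian_eq_sum_dirDeriv b (contDiff_infty.1 hf 2),
    laplacian_eq_sum_dirDeriv b (contDiff_infty.1 hg 2)]
  simp only [Finset.mul_sum, Finset.sum_mul, ← Finset.sum_add_distrib]
  refine Finset.sum_congr rfl fun i _ => ?_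
  have hd2f := differentiable_dirDeriv hf (b i)
  have hd2g := differentiable_dirDeriv hg (b i)
  have hfirst : dirDeriv (b i) (fun x => f x * g x) =
      fun x => f x * dirDeriv (b i) g x + dirDeriv (b i) f x * g x :=
    funext fun x => dirDeriv_mul_apply _ (hdf x) (hdg x)
  rw [hfirst, dirDeriv_add_apply _ ((hdf x).fun_mul (hd2g x)) ((hd2f x).fun_mul (hdg x)),
    dirDeriv_mul_apply _ (hdf x) (hd2g x), dirDeriv_mul_apply _ (hd2f x) (hdg x)]
  ring

end Product

/-- A smooth positive function of `t`, equal to `t + h` for `-h / 4 ≤ t`. -/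
noncomputable def raise (h t : ℝ) : ℝ :=
  h + t * Real.smoothTransition (2 + 4 * t / h)

section Raise

variable {h t : ℝ}

theorem raise_pos (hh : 0 < h) (t : ℝ) : 0 < raise h t := by
  have hnonneg := Real.smoothTransition.nonneg (2 + 4 * t / h)
  have hle := Real.smoothTransition.le_one (2 + 4 * t / h)
  rw [raise]
  rcases le_or_gt t (-(h / 2)) with ht | ht
  · have harg : 4 * t / h ≤ -2 := by
      rw [div_le_iff₀ hh]
      linarith
    rwa [Real.smoothTransition.zero_of_nonpos (by linarith), mul_zero, add_zero]
  · nlinarith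

theorem raise_of_le (hh : 0 < h) (ht : -(h / 4) ≤ t) : raise h t = t + h := by
  have harg : -1 ≤ 4 * t / h := by
    rw [le_div_iff₀ hh]
    linarith
  rw [raise, Real.smoothTransition.one_of_one_le (by linarith), mul_one, add_comm]

theorem raise_of_nonneg (hh : 0 < h) (ht : 0 ≤ t) : raise h t = t + h :=
  raise_of_le hh (by linarith)

theorem contDiff_raise (h : ℝ) : ContDiff ℝ ∞ (raise h) :=
  contDiff_const.add (contDiff_id.mul (Real.smoothTransition.contDiff.comp
    (contDiff_const.add ((contDiff_const.mul contDiff_id).div_const h))))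

end Raise

/-- The half-harmonic function of degree `1/2`, translated by `s` along `e` and by `h` upwards, and
modified below the thin space so as to be smooth. -/
noncomputable def barrier {m : ℕ} (e : Space m) (s h : ℝ) (x : Space m) : ℝ :=
  halfPower (⟪e, x⟫ + s) (raise h (x (Fin.last m)))

section Barrier

variable {m : ℕ} {e v x : Space m} {s h c : ℝ}

theorem contDiff_barrier (e : Space m) (s : ℝ) (hh : 0 < h) : ContDiff ℝ ∞ (barrier e s h) := by
  have hX : ContDiff ℝ ∞ fun x : Space m => ⟪e, x⟫ + s :=
    (innerSL ℝ e).contDiff.add contDiff_const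
  have hY : ContDiff ℝ ∞ fun x : Space m => raise h (x (Fin.last m)) :=
    (contDiff_raise h).comp (contDiff_coord _)
  have hmodulus : ContDiff ℝ ∞ fun x : Space m =>
      modulus (⟪e, x⟫ + s) (raise h (x (Fin.last m))) :=
    ((hX.pow 2).add (hY.pow 2)).sqrt fun x => by
      have := raise_pos hh (x (Fin.last m))
      positivity
  exact ((hmodulus.add hX).div_const 2).sqrt fun x =>
    (half_pos (modulus_add_pos _ (raise_pos hh _))).ne'

theorem hasDerivAt_comp_inner_add {F : ℝ → ℝ} (hF : HasDerivAt F c (⟪e, x⟫ + s)) (v : Space m) :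
    HasDerivAt (fun t : ℝ => F (⟪e, x + t • v⟫ + s)) (c * ⟪e, v⟫) 0 := by
  have hinner : HasDerivAt (fun t : ℝ => ⟪e, x + t • v⟫ + s) ⟪e, v⟫ 0 := by
    simpa only [inner_add_right, inner_smul_right, one_mul] using
      (((hasDerivAt_id' (0 : ℝ)).mul_const ⟪e, v⟫).const_add ⟪e, x⟫).add_const s
  exact HasDerivAt.comp (0 : ℝ) (by simpa using hF) hinner

theorem hasDerivAt_comp_last_add {F : ℝ → ℝ} (hF : HasDerivAt F c (x (Fin.last m) + h)) :
    HasDerivAt (fun t : ℝ => F ((x + t • normalVec : Space m) (Fin.last m) + h)) c 0 := by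
  have hlast : HasDerivAt (fun t : ℝ => (x + t • normalVec : Space m) (Fin.last m) + h) 1 0 := by
    simpa using ((hasDerivAt_id' (0 : ℝ)).const_add (x (Fin.last m))).add_const h
  exact (HasDerivAt.comp (0 : ℝ) (h₂ := F) (by simpa using hF) hlast).congr_deriv (mul_one c)

theorem inner_normalVec_of_thin (he : e (Fin.last m) = 0) : ⟪e, normalVec⟫ = 0 := by
  rw [real_inner_comm, inner_normalVec, he]

theorem dirDeriv_tangential_barrier (e : Space m) (s : ℝ) (hh : 0 < h)
    (hv : v (Fin.last m) = 0) (x : Space m) :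
    dirDeriv v (barrier e s h) x =
      halfPowerX (⟪e, x⟫ + s) (raise h (x (Fin.last m))) * ⟪e, v⟫ := by
  refine dirDeriv_eq_of_hasDerivAt (contDiff_barrier e s hh)
    ((hasDerivAt_comp_inner_add (hasDerivAt_halfPower_left _
      (raise_pos hh (x (Fin.last m)))) v).congr_of_eventuallyEq (.of_forall fun t => ?_))
  simp [barrier, hv]

theorem eventually_lt_last_add_smul (hx : c < x (Fin.last m)) :
    ∀ᶠ t in 𝓝 (0 : ℝ), c < (x + t • normalVec : Space m) (Fin.last m) := by
  have hline : Continuous fun t : ℝ => (x + t • normalVec : Space m) (Fin.last m) := by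
    simp only [PiLp.add_apply, PiLp.smul_apply]
    fun_prop
  exact hline.continuousAt.eventually (lt_mem_nhds (by simpa using hx))

theorem dirDeriv_normalVec_barrier (he : e (Fin.last m) = 0) (s : ℝ) (hh : 0 < h)
    (hx : -(h / 4) < x (Fin.last m)) :
    dirDeriv normalVec (barrier e s h) x = halfPowerY (⟪e, x⟫ + s) (x (Fin.last m) + h) := by
  refine dirDeriv_eq_of_hasDerivAt (contDiff_barrier e s hh)
    ((hasDerivAt_comp_last_add (hasDerivAt_halfPower_right (⟪e, x⟫ + s)
      (by linarith))).congr_of_eventuallyEq ?_)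
  filter_upwards [eventually_lt_last_add_smul hx] with t ht
  rw [barrier, raise_of_le hh ht.le, inner_add_right, inner_smul_right,
    inner_normalVec_of_thin he, mul_zero, add_zero]

theorem sum_inner_basisVec_castSucc_sq (he : e (Fin.last m) = 0) :
    ∑ i : Fin m, ⟪e, basisVec i.castSucc⟫ ^ 2 = ‖e‖ ^ 2 := by
  rw [EuclideanSpace.norm_sq_eq, Fin.sum_univ_castSucc, he]
  simp [basisVec, EuclideanSpace.inner_single_right]

theorem tangentialLaplacian_barrier (he : e (Fin.last m) = 0) (hn : ‖e‖ = 1) (hh : 0 < h)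
    (hc : HasDerivAt (fun X => halfPowerX X (raise h (x (Fin.last m)))) c (⟪e, x⟫ + s)) :
    tangentialLaplacian (barrier e s h) x = c := by
  have hsecond (i : Fin m) :
      dirDeriv (basisVec i.castSucc) (dirDeriv (basisVec i.castSucc) (barrier e s h)) x =
        c * ⟪e, basisVec i.castSucc⟫ ^ 2 := by
    refine dirDeriv_eq_of_hasDerivAt (contDiff_dirDeriv (contDiff_barrier e s hh) _) ?_
    refine (((hasDerivAt_comp_inner_add hc (basisVec i.castSucc)).mul_const
      ⟪e, basisVec i.castSucc⟫).congr_deriv (by ring)).congr_of_eventuallyEq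
        (.of_forall fun t => ?_)
    simp [dirDeriv_tangential_barrier e s hh (basisVec_castSucc_last i), basisVec_castSucc_last]
  simp only [tangentialLaplacian, hsecond]
  rw [← Finset.mul_sum, sum_inner_basisVec_castSucc_sq he, hn, one_pow, mul_one]

theorem dirDeriv_normalVec_dirDeriv_normalVec_barrier (he : e (Fin.last m) = 0) (hh : 0 < h)
    (hx : -(h / 4) < x (Fin.last m))
    (hc : HasDerivAt (fun Y => halfPowerY (⟪e, x⟫ + s) Y) c (x (Fin.last m) + h)) :
    dirDeriv normalVec (dirDeriv normalVec (barrier e s h)) x = c := by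
  refine dirDeriv_eq_of_hasDerivAt (contDiff_dirDeriv (contDiff_barrier e s hh) _)
    ((hasDerivAt_comp_last_add hc).congr_of_eventuallyEq ?_)
  filter_upwards [eventually_lt_last_add_smul hx] with t ht
  rw [dirDeriv_normalVec_barrier he s hh ht, inner_add_right, inner_smul_right,
    inner_normalVec_of_thin he, mul_zero, add_zero]

theorem laplacian_barrier (he : e (Fin.last m) = 0) (hn : ‖e‖ = 1) (s : ℝ) (hh : 0 < h)
    (hx : 0 ≤ x (Fin.last m)) : Δ (barrier e s h) x = 0 := by
  obtain ⟨c, hcX, hcY⟩ := exists_hasDerivAt_halfPowerX_and_halfPowerY_neg (⟪e, x⟫ + s)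
    (show 0 < x (Fin.last m) + h by linarith)
  rw [laplacian_eq_tangentialLaplacian_add (contDiff_barrier e s hh),
    tangentialLaplacian_barrier he hn hh (by rwa [raise_of_nonneg hh hx]),
    dirDeriv_normalVec_dirDeriv_normalVec_barrier he hh (by linarith) hcY, add_neg_cancel]

theorem radialDeriv_barrier (he : e (Fin.last m) = 0) (s : ℝ) (hh : 0 < h)
    (hx : 0 ≤ x (Fin.last m)) :
    radialDeriv (barrier e s h) x = 1 / 2 * halfPower (⟪e, x⟫ + s) (x (Fin.last m) + h) -
      (s * halfPowerX (⟪e, x⟫ + s) (x (Fin.last m) + h) +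
        h * halfPowerY (⟪e, x⟫ + s) (x (Fin.last m) + h)) := by
  set v : Space m := x - x (Fin.last m) • normalVec with hv
  have hv₀ : v (Fin.last m) = 0 := by simp [hv]
  have hev : ⟪e, v⟫ = ⟪e, x⟫ := by
    rw [hv, inner_sub_right, inner_smul_right, inner_normalVec_of_thin he, mul_zero, sub_zero]
  have hsplit : radialDeriv (barrier e s h) x = dirDeriv v (barrier e s h) x +
      x (Fin.last m) * dirDeriv normalVec (barrier e s h) x := by
    simp only [radialDeriv, dirDeriv, ← smul_eq_mul, ← map_smul, ← map_add, hv, sub_add_cancel]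
  rw [hsplit, dirDeriv_tangential_barrier e s hh hv₀, dirDeriv_normalVec_barrier he s hh
    (by linarith), raise_of_nonneg hh hx, hev, ← mul_halfPowerX_add_mul_halfPowerY (⟪e, x⟫ + s)
    (show 0 < x (Fin.last m) + h by linarith)]
  ring

/-- The barrier, cut off outside the ball of radius `√2`. -/
noncomputable def cutBarrier (e : Space m) (s h : ℝ) (x : Space m) : ℝ :=
  barrier e s h x * radialCutoff x

theorem isTestFunction_cutBarrier (e : Space m) (s : ℝ) (hh : 0 < h) :
    IsTestFunction (cutBarrier e s h) :=
  isTestFunction_radialCutoff.mul_left (contDiff_barrier e s hh)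

theorem cutBarrier_nonneg (e : Space m) (s h : ℝ) (x : Space m) : 0 ≤ cutBarrier e s h x :=
  mul_nonneg (halfPower_nonneg _ _) (radialCutoff_nonneg x)

theorem dirDeriv_cutBarrier (e : Space m) (s : ℝ) (hh : 0 < h) (v x : Space m) :
    dirDeriv v (cutBarrier e s h) x = dirDeriv v (barrier e s h) x * radialCutoff x -
      barrier e s h x * (⟪x, v⟫ * radialDensity x) := by
  have hmul := dirDeriv_mul_apply v ((contDiff_barrier e s hh).differentiable (by simp) x)
    (isTestFunction_radialCutoff.differentiable x)
  rw [dirDeriv_radialCutoff] at hmul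
  refine hmul.trans ?_
  ring

theorem laplacian_cutBarrier (he : e (Fin.last m) = 0) (hn : ‖e‖ = 1) (s : ℝ) (hh : 0 < h)
    (hx : 0 ≤ x (Fin.last m)) :
    Δ (cutBarrier e s h) x =
      halfPower (⟪e, x⟫ + s) (x (Fin.last m) + h) *
          -(((Module.finrank ℝ (Space m) : ℝ) + 1) * radialDensity x +
            radialDeriv radialDensity x) +
        2 * radialDensity x * (s * halfPowerX (⟪e, x⟫ + s) (x (Fin.last m) + h) +
          h * halfPowerY (⟪e, x⟫ + s) (x (Fin.last m) + h)) := by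
  let b := EuclideanSpace.basisFun (Fin (m + 1)) ℝ
  have hcross : ∑ i, dirDeriv (b i) (barrier e s h) x * dirDeriv (b i) radialCutoff x =
      -radialDensity x * radialDeriv (barrier e s h) x := by
    rw [radialDeriv_eq_sum b, Finset.mul_sum]
    refine Finset.sum_congr rfl fun i _ => ?_
    simp only [dirDeriv_radialCutoff]
    ring
  refine (laplacian_mul b (contDiff_barrier e s hh) contDiff_radialCutoff x).trans ?_
  rw [laplacian_barrier he hn s hh hx, laplacian_radialCutoff, hcross,
    radialDeriv_barrier he s hh hx, barrier, raise_of_nonneg hh hx]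
  ring

end Barrier

/-- The half-harmonic function of degree `1/2`: on `{x_n > 0}` the real part of
`(⟪e, x⟫ + i x_n) ^ (1/2)`, extended by zero. -/
noncomputable def halfHarmonic {m : ℕ} (e : Space m) : Space m → ℝ :=
  (upperHalfSpace m).indicator fun x => halfPower ⟪e, x⟫ (x (Fin.last m))

section BarrierLimit

variable {m : ℕ} {e v x : Space m} {u : Space m → ℝ} {a d τ : ℝ} {μ : Measure (Space m)}

theorem halfHarmonic_of_pos (e : Space m) (hx : 0 < x (Fin.last m)) :
    halfHarmonic e x = halfPower ⟪e, x⟫ (x (Fin.last m)) :=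
  indicator_of_mem hx _

theorem halfHarmonic_of_nonpos (e : Space m) (hx : x (Fin.last m) ≤ 0) : halfHarmonic e x = 0 :=
  indicator_of_notMem (s := upperHalfSpace m) (not_lt.2 hx) _

theorem isHomogeneousOfDegree_halfHarmonic (e : Space m) :
    IsHomogeneousOfDegree (halfHarmonic e) (1 / 2) := by
  intro r hr x
  rcases lt_or_ge 0 (x (Fin.last m)) with hx | hx
  · rw [halfHarmonic_of_pos e hx, halfHarmonic_of_pos e (by simpa [hr] using hx),
      ← halfPower_mul hr.le, inner_smul_right, PiLp.smul_apply, smul_eq_mul]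
  · rw [halfHarmonic_of_nonpos e hx, mul_zero, halfHarmonic_of_nonpos]
    exact mul_nonpos_of_nonneg_of_nonpos hr.le hx

theorem IsHomogeneousOfDegree.mul {f g : Space m → ℝ} {a b : ℝ} (hf : IsHomogeneousOfDegree f a)
    (hg : IsHomogeneousOfDegree g b) : IsHomogeneousOfDegree (fun x => f x * g x) (a + b) := by
  intro r hr x
  simp only [hf r hr, hg r hr, Real.rpow_add hr]
  ring

theorem locallyIntegrable_mul_halfHarmonic (hu : LocallyIntegrable u) (e : Space m) :
    LocallyIntegrable fun x => u x * halfHarmonic e x := by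
  have hcont : Continuous fun x : Space m => halfPower ⟪e, x⟫ (x (Fin.last m)) :=
    continuous_halfPower.comp ((innerSL ℝ e).continuous.prodMk (contDiff_coord _).continuous)
  have hmul := (hu.mul_continuous hcont).indicator measurableSet_upperHalfSpace
  simpa only [halfHarmonic, ← indicator_mul_right] using hmul

/-- By Euler's identity the two radial terms of `laplacian_cutBarrier` combine to a multiple of
`radialDensity` when tested against a homogeneous function. -/
theorem integral_mul_halfHarmonic_mul_radial (hu : LocallyIntegrable u)
    (hhom : IsHomogeneousOfDegree u a) (e : Space m) :
    ∫ x, u x * (halfHarmonic e x * -(((Module.finrank ℝ (Space m) : ℝ) + 1) * radialDensity x +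
        radialDeriv radialDensity x)) =
      (a - 1 / 2) * ∫ x, u x * halfHarmonic e x * radialDensity x := by
  have hint := locallyIntegrable_mul_halfHarmonic hu e
  have heuler := integral_mul_radialDeriv_of_homogeneous hint
    (hhom.mul (isHomogeneousOfDegree_halfHarmonic e)) isTestFunction_radialDensity
  have hsplit (x : Space m) : u x * (halfHarmonic e x *
      -(((Module.finrank ℝ (Space m) : ℝ) + 1) * radialDensity x + radialDeriv radialDensity x)) =
      -((Module.finrank ℝ (Space m) : ℝ) + 1) * (u x * halfHarmonic e x * radialDensity x) -
        u x * halfHarmonic e x * radialDeriv radialDensity x := by ring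
  simp only [hsplit]
  rw [integral_sub ((isTestFunction_radialDensity.integrable_mul hint).const_mul _)
    (isTestFunction_radialDensity.radialDeriv.integrable_mul hint), integral_const_mul, heuler]
  ring

theorem abs_halfPower_barrier_le (hn : ‖e‖ = 1) (hτ : |τ| = 1) (hd : d ∈ Ioc (0 : ℝ) 1)
    (hx : ‖x‖ ≤ 2) : |halfPower (⟪e, x⟫ + τ * d) (x (Fin.last m) + d ^ 2)| ≤ 6 := by
  have hlast : |x (Fin.last m)| ≤ 2 := (PiLp.norm_apply_le x (Fin.last m)).trans hx
  have hinner : |⟪e, x⟫| ≤ 2 := by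
    simpa [hn] using (abs_real_inner_le_norm e x).trans
      (mul_le_mul_of_nonneg_left hx (norm_nonneg e))
  have hX : |⟪e, x⟫ + τ * d| ≤ 2 + 1 := by
    refine (abs_add_le _ _).trans (add_le_add hinner ?_)
    rw [abs_mul, hτ, one_mul, abs_of_pos hd.1]
    exact hd.2
  have hY : |x (Fin.last m) + d ^ 2| ≤ 2 + 1 := by
    refine (abs_add_le _ _).trans (add_le_add hlast ?_)
    rw [abs_of_nonneg (sq_nonneg d)]
    exact pow_le_one₀ hd.1.le hd.2
  refine abs_le_of_sq_le_sq ?_ (by norm_num)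
  linarith [halfPower_sq_le_modulus (⟪e, x⟫ + τ * d) (x (Fin.last m) + d ^ 2),
    modulus_le_abs_add_abs (⟪e, x⟫ + τ * d) (x (Fin.last m) + d ^ 2)]

theorem exists_abs_laplacian_cutBarrier_le (he : e (Fin.last m) = 0) (hn : ‖e‖ = 1)
    (hτ : |τ| = 1) : ∃ C, ∀ d ∈ Ioc (0 : ℝ) 1, ∀ x : Space m, 0 < x (Fin.last m) → ‖x‖ ≤ 2 →
      |Δ (cutBarrier e (τ * d) (d ^ 2)) x| ≤ C := by
  have hweight : IsTestFunction fun x : Space m =>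
      -(((Module.finrank ℝ (Space m) : ℝ) + 1) * radialDensity x +
        radialDeriv radialDensity x) := by
    simpa using ((isTestFunction_radialDensity.mul_left
      (g := fun _ => (Module.finrank ℝ (Space m) : ℝ) + 1) contDiff_const).add
        isTestFunction_radialDensity.radialDeriv).mul_left (g := fun _ => -1) contDiff_const
  obtain ⟨B, hB⟩ := hweight.hasCompactSupport.exists_bound_of_continuous hweight.continuous
  obtain ⟨B', hB'⟩ := (isTestFunction_radialDensity (E := Space m)).hasCompactSupport
    |>.exists_bound_of_continuous isTestFunction_radialDensity.continuous
  refine ⟨6 * B + 2 * B' * (1 + 1), fun d hd x hx₀ hx => ?_⟩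
  have hd2 : 0 < d ^ 2 := pow_pos hd.1 2
  have hY : 0 < x (Fin.last m) + d ^ 2 := by positivity
  have hX₁ : |τ * d * halfPowerX (⟪e, x⟫ + τ * d) (x (Fin.last m) + d ^ 2)| ≤ 1 :=
    abs_mul_halfPowerX_le_one _ hY (by rw [mul_pow, ← sq_abs τ, hτ]; linarith)
  have hY₁ : |d ^ 2 * halfPowerY (⟪e, x⟫ + τ * d) (x (Fin.last m) + d ^ 2)| ≤ 1 :=
    abs_mul_halfPowerY_le_one _ hd2.le hY (by linarith) (pow_le_one₀ hd.1.le hd.2)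
  rw [laplacian_cutBarrier he hn _ hd2 hx₀.le]
  refine (abs_add_le _ _).trans (add_le_add ?_ ?_)
  · rw [abs_mul]
    exact mul_le_mul (abs_halfPower_barrier_le hn hτ hd hx) (hB x) (abs_nonneg _) (by norm_num)
  · rw [abs_mul, abs_mul, abs_two]
    exact mul_le_mul (mul_le_mul_of_nonneg_left (hB' x) two_pos.le)
      ((abs_add_le _ _).trans (add_le_add hX₁ hY₁)) (abs_nonneg _)
      (mul_nonneg two_pos.le ((norm_nonneg _).trans (hB' x)))

theorem tendsto_laplacian_cutBarrier (he : e (Fin.last m) = 0) (hn : ‖e‖ = 1) (τ : ℝ)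
    (hx : 0 < x (Fin.last m)) :
    Tendsto (fun d : ℝ => Δ (cutBarrier e (τ * d) (d ^ 2)) x) (𝓝[>] 0)
      (𝓝 (halfHarmonic e x * -(((Module.finrank ℝ (Space m) : ℝ) + 1) * radialDensity x +
        radialDeriv radialDensity x))) := by
  have hX : Continuous fun d : ℝ => ⟪e, x⟫ + τ * d := by fun_prop
  have hY : Continuous fun d : ℝ => x (Fin.last m) + d ^ 2 := by fun_prop
  have hpos (d : ℝ) : 0 < x (Fin.last m) + d ^ 2 := by positivity
  have hmodulus : Continuous fun d : ℝ => modulus (⟪e, x⟫ + τ * d) (x (Fin.last m) + d ^ 2) :=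
    continuous_modulus.comp (hX.prodMk hY)
  have hpower : Continuous fun d : ℝ => halfPower (⟪e, x⟫ + τ * d) (x (Fin.last m) + d ^ 2) :=
    continuous_halfPower.comp (hX.prodMk hY)
  have hpowerX : Continuous fun d : ℝ => halfPowerX (⟪e, x⟫ + τ * d) (x (Fin.last m) + d ^ 2) :=
    hpower.div (hmodulus.const_mul 2) fun d => (mul_pos two_pos (modulus_pos _ (hpos d))).ne'
  have hpowerY : Continuous fun d : ℝ => halfPowerY (⟪e, x⟫ + τ * d) (x (Fin.last m) + d ^ 2) :=
    hY.div ((hmodulus.const_mul 4).mul hpower) fun d =>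
      (mul_pos (mul_pos four_pos (modulus_pos _ (hpos d))) (halfPower_pos _ (hpos d))).ne'
  have hcont : Continuous fun d : ℝ => halfPower (⟪e, x⟫ + τ * d) (x (Fin.last m) + d ^ 2) *
      -(((Module.finrank ℝ (Space m) : ℝ) + 1) * radialDensity x + radialDeriv radialDensity x) +
      2 * radialDensity x * (τ * d * halfPowerX (⟪e, x⟫ + τ * d) (x (Fin.last m) + d ^ 2) +
        d ^ 2 * halfPowerY (⟪e, x⟫ + τ * d) (x (Fin.last m) + d ^ 2)) := by
    fun_prop
  have hlim := hcont.tendsto 0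
  simp only [mul_zero, add_zero, zero_mul, ne_eq, OfNat.ofNat_ne_zero, not_false_eq_true,
    zero_pow, ← halfHarmonic_of_pos e hx] at hlim
  refine (hlim.mono_left nhdsWithin_le_nhds).congr' ?_
  filter_upwards [self_mem_nhdsWithin] with d hd
  exact (laplacian_cutBarrier he hn _ (pow_pos hd 2) hx.le).symm

theorem laplacian_cutBarrier_of_two_lt (he : e (Fin.last m) = 0) (hn : ‖e‖ = 1) (s : ℝ) {h : ℝ}
    (hh : 0 < h) (hx₀ : 0 ≤ x (Fin.last m)) (hx : 2 < ‖x‖) : Δ (cutBarrier e s h) x = 0 := by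
  have hdensity : (radialDensity : Space m → ℝ) =ᶠ[𝓝 x] fun _ => 0 := by
    filter_upwards [continuous_norm.continuousAt.eventually (lt_mem_nhds hx)] with y hy
    exact radialDensity_of_two_lt hy
  simp [laplacian_cutBarrier he hn s hh hx₀, radialDensity_of_two_lt hx, radialDeriv,
    hdensity.fderiv_eq]

theorem tendsto_setIntegral_mul_laplacian_cutBarrier (hu : LocallyIntegrable u)
    (hhom : IsHomogeneousOfDegree u a) (he : e (Fin.last m) = 0) (hn : ‖e‖ = 1) (hτ : |τ| = 1) :
    Tendsto (fun d : ℝ => ∫ x in upperHalfSpace m, u x * Δ (cutBarrier e (τ * d) (d ^ 2)) x)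
      (𝓝[>] 0) (𝓝 ((a - 1 / 2) * ∫ x, u x * halfHarmonic e x * radialDensity x)) := by
  obtain ⟨C, hC⟩ := exists_abs_laplacian_cutBarrier_le he hn hτ
  rw [← integral_mul_halfHarmonic_mul_radial hu hhom e]
  simp only [← integral_indicator measurableSet_upperHalfSpace, indicator_mul_right]
  refine tendsto_integral_mul_of_bounded hu (isCompact_closedBall (0 : Space m) 2)
    (C := max C 0) ?_ ?_ ?_ (.of_forall fun x => ?_)
  · filter_upwards [self_mem_nhdsWithin] with d hd
    exact (isTestFunction_cutBarrier e _ (pow_pos hd 2)).laplacian.continuous.aestronglyMeasurable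
      |>.indicator measurableSet_upperHalfSpace
  · filter_upwards [Ioc_mem_nhdsGT (zero_lt_one' ℝ)] with d hd x hx
    by_cases hmem : x ∈ upperHalfSpace m
    · rw [indicator_of_mem hmem]
      exact le_max_of_le_left (hC d hd x hmem (by simpa using hx))
    · rw [indicator_of_notMem hmem, abs_zero]
      exact le_max_right C 0
  · filter_upwards [self_mem_nhdsWithin] with d hd x hx
    exact indicator_apply_eq_zero.2 fun hmem =>
      laplacian_cutBarrier_of_two_lt he hn _ (pow_pos hd 2) (le_of_lt hmem) (by simpa using hx)
  · by_cases hmem : x ∈ upperHalfSpace m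
    · simpa only [indicator_of_mem hmem] using tendsto_laplacian_cutBarrier he hn τ hmem
    · simpa [hmem] using .inl (halfHarmonic_of_nonpos e (not_lt.1 hmem))

theorem dirDeriv_cutBarrier_of_two_lt (e : Space m) (s : ℝ) {h : ℝ} (hh : 0 < h) (v : Space m)
    (hx : 2 < ‖x‖) : dirDeriv v (cutBarrier e s h) x = 0 := by
  rw [dirDeriv_cutBarrier e s hh, radialCutoff_of_two_lt hx, radialDensity_of_two_lt hx, mul_zero,
    mul_zero, mul_zero, sub_zero]

theorem tendsto_integral_zero_of_abs_le_mul_sqrt [IsLocallyFiniteMeasure μ] {F : ℝ → Space m → ℝ}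
    {C : ℝ} (hF₀ : ∀ᶠ d in 𝓝[>] 0, ∀ x, 2 < ‖x‖ → F d x = 0)
    (hF : ∀ᶠ d in 𝓝[>] 0, ∀ᵐ x ∂μ, |F d x| ≤ C * √d) :
    Tendsto (fun d => ∫ x, F d x ∂μ) (𝓝[>] 0) (𝓝 0) := by
  have hlim : Tendsto (fun d : ℝ => C * √d * μ.real (closedBall 0 2)) (𝓝[>] 0) (𝓝 0) := by
    have hcont : Continuous fun d : ℝ => C * √d * μ.real (closedBall (0 : Space m) 2) := by
      fun_prop
    simpa using (hcont.tendsto 0).mono_left nhdsWithin_le_nhds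
  refine squeeze_zero_norm' ?_ hlim
  filter_upwards [hF₀, hF] with d hd₀ hd
  rw [← setIntegral_eq_integral_of_forall_compl_eq_zero (s := closedBall (0 : Space m) 2)
    fun x hx => hd₀ x (by simpa using hx)]
  exact norm_setIntegral_le_of_norm_le_const_ae (isCompact_closedBall _ _).measure_lt_top
    (ae_restrict_of_ae hd)

theorem tendsto_integral_dirDeriv_normalVec_cutBarrier [IsLocallyFiniteMeasure μ]
    (hthin : ∀ᵐ x ∂μ, x (Fin.last m) = 0) (he : e (Fin.last m) = 0)
    (hμ : ∀ᵐ x ∂μ, 0 ≤ ⟪e, x⟫) :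
    Tendsto (fun d : ℝ => ∫ x, dirDeriv normalVec (cutBarrier e (1 * d) (d ^ 2)) x ∂μ)
      (𝓝[>] 0) (𝓝 0) := by
  refine tendsto_integral_zero_of_abs_le_mul_sqrt (C := 1) ?_ ?_ <;>
    filter_upwards [self_mem_nhdsWithin] with d (hd : 0 < d)
  · exact fun x hx => dirDeriv_cutBarrier_of_two_lt e _ (pow_pos hd 2) _ hx
  · have hd2 : 0 < d ^ 2 := pow_pos hd 2
    filter_upwards [hthin, hμ] with x hx hex
    have hY := halfPowerY_nonneg (⟪e, x⟫ + 1 * d) hd2.le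
    rw [dirDeriv_cutBarrier e _ hd2, dirDeriv_normalVec_barrier he _ hd2 (by rw [hx]; linarith),
      real_inner_comm normalVec x, inner_normalVec, hx, zero_add, zero_mul, mul_zero, sub_zero,
      abs_of_nonneg (mul_nonneg hY (radialCutoff_nonneg x))]
    rw [one_mul (√d)]
    exact (mul_le_of_le_one_right hY (radialCutoff_le_one x)).trans
      (halfPowerY_le_sqrt_of_le hd (by linarith))

theorem abs_dirDeriv_tangential_cutBarrier_le (hn : ‖e‖ = 1) (hv : v (Fin.last m) = 0) {B : ℝ}
    (hB : |radialDensity x| ≤ B) (hd : d ∈ Ioc (0 : ℝ) 1) (hx : x (Fin.last m) = 0)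
    (hex : ⟪e, x⟫ ≤ 0) (hx₂ : ‖x‖ ≤ 2) :
    |dirDeriv v (cutBarrier e (-1 * d) (d ^ 2)) x| ≤ (‖v‖ + 2 * ‖v‖ * B) * √d := by
  have hd2 : 0 < d ^ 2 := pow_pos hd.1 2
  have hX : ⟪e, x⟫ + -1 * d ≤ -d := by linarith
  have hpower : halfPower (⟪e, x⟫ + -1 * d) (d ^ 2) ≤ √d :=
    Real.le_sqrt_of_sq_le <| (halfPower_sq_le_pow_of_le_neg hd.1 hX).trans <|
      pow_le_of_le_one hd.1.le hd.2 three_ne_zero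
  have hev : |⟪e, v⟫| ≤ ‖v‖ := by simpa [hn] using abs_real_inner_le_norm e v
  have hxv : |⟪x, v⟫| ≤ 2 * ‖v‖ :=
    (abs_real_inner_le_norm x v).trans (mul_le_mul_of_nonneg_right hx₂ (norm_nonneg v))
  rw [dirDeriv_cutBarrier e _ hd2, dirDeriv_tangential_barrier e _ hd2 hv, barrier,
    raise_of_le hd2 (by rw [hx]; linarith), hx, zero_add]
  refine (abs_sub _ _).trans ?_
  rw [abs_mul, abs_mul, abs_mul, abs_mul, abs_of_nonneg (halfPowerX_nonneg _ _),
    abs_of_nonneg (halfPower_nonneg _ _), abs_of_nonneg (radialCutoff_nonneg x)]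
  have hfirst := mul_le_mul (halfPowerX_le_sqrt_of_le_neg hd.1 hX) hev (abs_nonneg _)
    (Real.sqrt_nonneg d)
  have hcut := mul_le_of_le_one_right
    (mul_nonneg (halfPowerX_nonneg (⟪e, x⟫ + -1 * d) (d ^ 2)) (abs_nonneg ⟪e, v⟫))
    (radialCutoff_le_one x)
  have hsecond := mul_le_mul hpower (mul_le_mul hxv hB (abs_nonneg _) (by positivity))
    (mul_nonneg (abs_nonneg _) (abs_nonneg _)) (Real.sqrt_nonneg d)
  linarith

theorem tendsto_integral_dirDeriv_tangential_cutBarrier [IsLocallyFiniteMeasure μ]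
    (hthin : ∀ᵐ x ∂μ, x (Fin.last m) = 0) (hn : ‖e‖ = 1) (hμ : ∀ᵐ x ∂μ, ⟪e, x⟫ ≤ 0)
    (hv : v (Fin.last m) = 0) :
    Tendsto (fun d : ℝ => ∫ x, dirDeriv v (cutBarrier e (-1 * d) (d ^ 2)) x ∂μ)
      (𝓝[>] 0) (𝓝 0) := by
  obtain ⟨B, hB⟩ := (isTestFunction_radialDensity (E := Space m)).hasCompactSupport
    |>.exists_bound_of_continuous isTestFunction_radialDensity.continuous
  have hB₀ : 0 ≤ B := (norm_nonneg _).trans (hB 0)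
  refine tendsto_integral_zero_of_abs_le_mul_sqrt (C := ‖v‖ + 2 * ‖v‖ * B) ?_ ?_ <;>
    filter_upwards [Ioc_mem_nhdsGT (zero_lt_one' ℝ)] with d hd
  · exact fun x hx => dirDeriv_cutBarrier_of_two_lt e _ (pow_pos hd.1 2) _ hx
  · filter_upwards [hthin, hμ] with x hx hex
    rcases lt_or_ge 2 ‖x‖ with hx₂ | hx₂
    · rw [dirDeriv_cutBarrier_of_two_lt e _ (pow_pos hd.1 2) v hx₂, abs_zero]
      positivity
    · exact abs_dirDeriv_tangential_cutBarrier_le hn hv (hB x) hd hx hex hx₂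

end BarrierLimit

/-! ### Solutions that are even in the normal variable -/

theorem apply_le_apply_of_concaveOn_of_even {g : ℝ → ℝ} (hg : ConcaveOn ℝ univ g)
    (heven : ∀ t, g (-t) = g t) {a b : ℝ} (hab : |a| ≤ b) : g b ≤ g a := by
  simpa [heven] using hg.min_le_of_mem_Icc (mem_univ (-b)) (mem_univ b) (abs_le.1 hab)

theorem monotone_of_convexOn_of_forall_le {g : ℝ → ℝ} (hg : ConvexOn ℝ univ g) {T C : ℝ}
    (hbound : ∀ t ≤ T, g t ≤ C) : Monotone g := by
  refine monotone_iff_forall_lt.2 fun a b hab => ?_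
  by_contra! hlt
  set c := (g a - g b) / (b - a) with hc
  have hc₀ : 0 < c := div_pos (sub_pos.2 hlt) (sub_pos.2 hab)
  have hlim : Tendsto (fun t => g a + c * (a + -t)) atBot atTop :=
    tendsto_atTop_add_const_left _ _
      ((tendsto_atTop_add_const_left _ a tendsto_neg_atBot_atTop).const_mul_atTop hc₀)
  obtain ⟨t, htT, hta, htC⟩ := ((eventually_le_atBot T).and
    ((eventually_lt_atBot a).and (hlim.eventually_gt_atTop C))).exists
  have hslope := hg.slope_mono_adjacent (mem_univ t) (mem_univ b) hta hab
  rw [← neg_sub (g a) (g b), neg_div, ← hc, div_le_iff₀ (sub_pos.2 hta)] at hslope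
  linarith [hbound t htT]

theorem exists_mem_forall_add_smul_mem {E : Type*} [AddCommGroup E] [Module ℝ E]
    [FiniteDimensional ℝ E] (C : PointedCone ℝ E) :
    ∃ z ∈ C, ∀ x ∈ Submodule.span ℝ (C : Set E), ∃ T : ℝ, ∀ t ≥ T, x + t • z ∈ C := by
  classical
  obtain ⟨s, hsC, hs⟩ := (Submodule.fg_span_iff_fg_span_finset_subset (C : Set E)).1
    (IsNoetherian.noetherian (Submodule.span ℝ (C : Set E)))
  refine ⟨∑ b ∈ s, b, C.sum_mem fun b hb => hsC hb, fun x hx => ?_⟩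
  rw [hs] at hx
  obtain ⟨c, -, rfl⟩ := Submodule.mem_span_finset.1 hx
  refine ⟨∑ b ∈ s, |c b|, fun t ht => ?_⟩
  rw [Finset.smul_sum, ← Finset.sum_add_distrib]
  simp only [← add_smul]
  refine C.sum_mem fun b hb => C.smul_mem ?_ (hsC hb)
  linarith [Finset.single_le_sum (f := fun b => |c b|) (fun i _ => abs_nonneg _) hb,
    neg_abs_le (c b)]

theorem measure_eq_zero_of_forall_integral_eq_zero {E : Type*} [NormedAddCommGroup E]
    [InnerProductSpace ℝ E] [FiniteDimensional ℝ E] [MeasurableSpace E] [BorelSpace E]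
    {μ : Measure E} [IsLocallyFiniteMeasure μ]
    (h : ∀ φ : E → ℝ, IsTestFunction φ → (∀ x, 0 ≤ φ x) → ∫ x, φ x ∂μ = 0) : μ = 0 := by
  refine Measure.measure_univ_eq_zero.1 (measure_null_of_locally_null _ fun x _ => ?_)
  let b : ContDiffBump x := ⟨1, 2, one_pos, one_lt_two⟩
  have hb : IsTestFunction b := ⟨b.contDiff, b.hasCompactSupport⟩
  have hae := (integral_eq_zero_iff_of_nonneg (fun y => b.nonneg' y) (hb.integrable μ)).1
    (h b hb b.nonneg')
  refine ⟨closedBall x 1, mem_nhdsWithin_of_mem_nhds (closedBall_mem_nhds x one_pos),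
    measure_mono_null (fun y hy => ?_) (ae_iff.1 hae)⟩
  simp [b.one_of_mem_closedBall hy]

section UpperHalfSpace

variable {m : ℕ} {x₀ : Space m} {f g u : Space m → ℝ} {a : ℝ}

theorem sub_smul_normalVec_last (x : Space m) :
    (x - x (Fin.last m) • normalVec : Space m) (Fin.last m) = 0 := by
  simp

theorem exists_tangential_forall_inner_nonpos (C : ProperCone ℝ (Space m))
    (hthin : ∀ x ∈ C, x (Fin.last m) = 0) (hx₀ : x₀ (Fin.last m) = 0) (hx₀C : x₀ ∉ C) :
    ∃ e : Space m, e (Fin.last m) = 0 ∧ ‖e‖ = 1 ∧ ∀ x ∈ C, ⟪e, x⟫ ≤ 0 := by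
  obtain ⟨y, hy, hy₀⟩ := C.hyperplane_separation' hx₀C
  set w : Space m := y - y (Fin.last m) • normalVec with hw
  have hinner (x : Space m) (hx : x (Fin.last m) = 0) : ⟪w, x⟫ = ⟪x, y⟫ := by
    rw [hw, inner_sub_left, real_inner_smul_left, inner_normalVec, hx, mul_zero, sub_zero,
      real_inner_comm]
  have hw₀ : w ≠ 0 := fun h0 => by simp [← hinner x₀ hx₀, h0] at hy₀
  refine ⟨-(‖w‖⁻¹ • w), ?_, (norm_neg _).trans (norm_smul_inv_norm hw₀), fun x hx => ?_⟩
  · rw [PiLp.neg_apply, PiLp.smul_apply, sub_smul_normalVec_last, smul_zero, neg_zero]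
  · rw [inner_neg_left, real_inner_smul_left, hinner x (hthin x hx)]
    exact neg_nonpos.2 (mul_nonneg (inv_nonneg.2 (norm_nonneg w)) (hy x hx))

theorem mem_closure_upperHalfSpace {x : Space m} (hx : 0 ≤ x (Fin.last m)) :
    x ∈ closure (upperHalfSpace m) := by
  have hcont : Continuous fun s : ℝ => x + s • (normalVec : Space m) := by fun_prop
  have hlim : Tendsto (fun s : ℝ => x + s • (normalVec : Space m)) (𝓝[>] 0) (𝓝 x) := by
    simpa using (hcont.tendsto 0).mono_left nhdsWithin_le_nhds
  refine mem_closure_of_tendsto hlim ?_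
  filter_upwards [self_mem_nhdsWithin] with s hs
  simpa [upperHalfSpace] using add_pos_of_nonneg_of_pos hx hs

theorem eq_of_ae_eq_upperHalfSpace (hf : Continuous f) (hg : Continuous g)
    (h : f =ᵐ[volume.restrict (upperHalfSpace m)] g) {x : Space m} (hx : 0 ≤ x (Fin.last m)) :
    f x = g x :=
  (Measure.eqOn_open_of_ae_eq h isOpen_upperHalfSpace hf.continuousOn hg.continuousOn).closure
    hf hg (mem_closure_upperHalfSpace hx)

theorem integral_mul_halfHarmonic_mul_radialDensity_pos (hu : LocallyIntegrable u)
    (hhom : IsHomogeneousOfDegree u a) (ha : -(3 / 2) < a)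
    (hu₀ : ∀ x ∈ upperHalfSpace m, 0 ≤ u x)
    (hne : ¬ ∀ᵐ x ∂(volume.restrict (upperHalfSpace m)), u x = 0) (e : Space m) :
    0 < ∫ x, u x * halfHarmonic e x * radialDensity x := by
  have hnonneg (x : Space m) : 0 ≤ u x * halfHarmonic e x := by
    rcases lt_or_ge 0 (x (Fin.last m)) with hx | hx
    · rw [halfHarmonic_of_pos e hx]
      exact mul_nonneg (hu₀ x hx) (halfPower_nonneg _ _)
    · rw [halfHarmonic_of_nonpos e hx, mul_zero]
  refine (integral_nonneg fun x => mul_nonneg (hnonneg x) (radialDensity_nonneg x)).lt_of_ne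
    fun hzero => hne ?_
  have hdegree : 0 < (Module.finrank ℝ (Space m) : ℝ) + (a + 1 / 2) := by
    rw [finrank_euclideanSpace_fin, Nat.cast_succ]
    linarith [Nat.cast_nonneg (α := ℝ) m]
  have hae := ae_eq_zero_of_homogeneous_of_integral_mul_radialDensity
    (locallyIntegrable_mul_halfHarmonic hu e) (hhom.mul (isHomogeneousOfDegree_halfHarmonic e))
    hnonneg hdegree hzero.symm
  rw [ae_restrict_iff' measurableSet_upperHalfSpace]
  filter_upwards [hae] with x hx hmem
  rw [halfHarmonic_of_pos e hmem] at hx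
  exact (mul_eq_zero.1 hx).resolve_right (halfPower_pos _ hmem).ne'

end UpperHalfSpace

/-- Solutions of positive degree that are even in the normal variable, convex along the thin space
and not harmonic. The Laplacian `-μ` is a parameter, since all estimates are stated in terms of
it. -/
structure IsEvenSolution {m : ℕ} (q : Space m → ℝ) (μ : Measure (Space m)) (lam : ℝ) : Prop where
  continuous : Continuous q
  even : ∀ x, q (mirror x) = q x
  hasNegLaplacian : HasNegLaplacian q μ
  ae_thin : ∀ᵐ x ∂μ, x (Fin.last m) = 0
  ae_eq_zero : ∀ᵐ x ∂μ, q x = 0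
  nonneg_on_thin : ∀ x : Space m, x (Fin.last m) = 0 → 0 ≤ q x
  convex : IsConvexAlongThin q
  homogeneous : IsHomogeneousOfDegree q lam
  degree_pos : 0 < lam
  measure_ne_zero : μ ≠ 0

namespace IsEvenSolution

variable {m : ℕ} {q D : Space m → ℝ} {μ : Measure (Space m)} {lam : ℝ} {e x y z : Space m}

theorem apply_zero (h : IsEvenSolution q μ lam) : q 0 = 0 := by
  have hscale := h.homogeneous 2 two_pos 0
  rw [smul_zero] at hscale
  have hpow : (1 : ℝ) < 2 ^ lam := Real.one_lt_rpow one_lt_two h.degree_pos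
  exact (mul_eq_zero.1 (by linarith : (2 ^ lam - 1) * q 0 = 0)).resolve_left (sub_pos.2 hpow).ne'

theorem apply_add_smul_normalVec_le (h : IsEvenSolution q μ lam) (hy : y (Fin.last m) = 0)
    {a b : ℝ} (hab : |a| ≤ b) : q (y + b • normalVec) ≤ q (y + a • normalVec) := by
  refine apply_le_apply_of_concaveOn_of_even (g := fun t => q (y + t • normalVec))
    (concaveOn_normal_of_isConvexAlongThin h.continuous h.convex h.hasNegLaplacian y)
    (fun t => ?_) hab
  rw [← h.even, map_add, map_smul, mirror_normalVec, mirror_of_thin hy, smul_neg, neg_smul,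
    neg_neg]

theorem apply_eq_apply_sub_add_abs_smul (h : IsEvenSolution q μ lam) (x : Space m) :
    q x = q (x - x (Fin.last m) • normalVec + |x (Fin.last m)| • normalVec) := by
  rcases abs_choice (x (Fin.last m)) with habs | habs
  · rw [habs, sub_add_cancel]
  · rw [habs, ← h.even x, mirror_eq]
    congr 1
    module

theorem apply_le_apply_sub_smul_normalVec (h : IsEvenSolution q μ lam) (x : Space m) :
    q x ≤ q (x - x (Fin.last m) • normalVec) := by
  have hle := h.apply_add_smul_normalVec_le (sub_smul_normalVec_last x) (a := 0)
    (b := |x (Fin.last m)|) (by simp)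
  rwa [zero_smul, add_zero, ← h.apply_eq_apply_sub_add_abs_smul] at hle

theorem normalDeriv_nonpos (h : IsEvenSolution q μ lam) (hD : IsSymmDeriv normalVec q D)
    (hx : x ∈ upperHalfSpace m) : D x ≤ 0 := by
  refine le_of_tendsto (hD.tendsto x) ?_
  filter_upwards [Ioc_mem_nhdsGT (show 0 < x (Fin.last m) from hx)] with s hs
  refine div_nonpos_of_nonpos_of_nonneg (sub_nonpos.2 ?_) (by linarith [hs.1])
  have hle := h.apply_add_smul_normalVec_le (sub_smul_normalVec_last x)
    (a := x (Fin.last m) - s) (b := x (Fin.last m) + s)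
    (by rw [abs_of_nonneg (sub_nonneg.2 hs.2)]; linarith [hs.1])
  rwa [add_smul, sub_smul, ← add_assoc, sub_add_cancel, ← add_sub_assoc, sub_add_cancel] at hle

theorem exists_normalDeriv (h : IsEvenSolution q μ lam) : ∃ D, IsSymmDeriv normalVec q D :=
  exists_isSymmDeriv_of_concaveOn h.continuous normalVec
    (concaveOn_normal_of_isConvexAlongThin h.continuous h.convex h.hasNegLaplacian)

theorem apply_add_eq_zero (h : IsEvenSolution q μ lam) (hx : x (Fin.last m) = 0) (hqx : q x = 0)
    (hy : y (Fin.last m) = 0) (hqy : q y = 0) : q (x + y) = 0 := by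
  have hmid := (h.convex x (y - x) (by simp [hx, hy])).2 (mem_univ (0 : ℝ))
    (mem_univ (1 : ℝ)) one_half_pos.le one_half_pos.le (add_halves (1 : ℝ))
  have hpoint : x + (1 / 2 : ℝ) • (y - x) = (1 / 2 : ℝ) • (x + y) := by module
  simp only [smul_eq_mul, mul_zero, zero_add, mul_one, zero_smul, add_zero, one_smul,
    add_sub_cancel, hqx, hqy, hpoint, h.homogeneous _ one_half_pos] at hmid
  exact le_antisymm (nonpos_of_mul_nonpos_right hmid (Real.rpow_pos_of_pos one_half_pos _))
    (h.nonneg_on_thin _ (by simp [hx, hy]))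

/-- The contact set `{x_n = 0, q = 0}`, which is a closed convex cone because `q` is nonnegative,
convex and homogeneous on the thin space. -/
def contactCone (h : IsEvenSolution q μ lam) : ProperCone ℝ (Space m) where
  carrier := {x | x (Fin.last m) = 0 ∧ q x = 0}
  add_mem' hx hy := ⟨by simp [hx.1, hy.1], h.apply_add_eq_zero hx.1 hx.2 hy.1 hy.2⟩
  zero_mem' := ⟨rfl, h.apply_zero⟩
  smul_mem' := by
    rintro ⟨r, hr⟩ x ⟨hx, hqx⟩
    refine ⟨by simp [Nonneg.mk_smul, hx], ?_⟩
    rcases hr.eq_or_lt with rfl | hr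
    · simpa [Nonneg.mk_smul] using h.apply_zero
    · rw [Nonneg.mk_smul, h.homogeneous r hr, hqx, mul_zero]
  isClosed' := (isClosed_eq (contDiff_coord (Fin.last m)).continuous continuous_const).inter
    (isClosed_eq h.continuous continuous_const)

theorem ae_mem_contactCone (h : IsEvenSolution q μ lam) : ∀ᵐ x ∂μ, x ∈ h.contactCone := by
  filter_upwards [h.ae_thin, h.ae_eq_zero] with x hx hqx using ⟨hx, hqx⟩

section LocallyFinite

variable [IsLocallyFiniteMeasure μ]

theorem not_ae_normalDeriv_eq_zero (h : IsEvenSolution q μ lam)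
    (hD : IsSymmDeriv normalVec q D) :
    ¬ ∀ᵐ x ∂(volume.restrict (upperHalfSpace m)), D x = 0 := by
  intro hzero
  refine h.measure_ne_zero (measure_eq_zero_of_forall_integral_eq_zero fun φ hφ hφ₀ => ?_)
  have hweak := setIntegral_upperHalfSpace_mul_tangentialLaplacian_sub_mul_normal h.continuous
    h.even h.hasNegLaplacian h.ae_thin hD hφ
  have hnormal : ∫ x in upperHalfSpace m, D x * dirDeriv normalVec φ x = 0 :=
    integral_eq_zero_of_ae (hzero.mono fun x hx => by simp [hx])
  have htan := setIntegral_upperHalfSpace_mul_tangentialLaplacian_nonneg h.continuous h.convex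
    hφ hφ₀
  have hmass : 0 ≤ ∫ x, φ x ∂μ := integral_nonneg hφ₀
  linarith

theorem three_halves_le (h : IsEvenSolution q μ lam) (he : e (Fin.last m) = 0) (hn : ‖e‖ = 1)
    (hcone : ∀ x ∈ h.contactCone, ⟪e, x⟫ ≤ 0) : 3 / 2 ≤ lam := by
  obtain ⟨D, hD⟩ := h.exists_normalDeriv
  have hloc : LocallyIntegrable (fun x => -D x) := (hD.locallyIntegrable h.continuous volume).neg
  have hhom : IsHomogeneousOfDegree (fun x => -D x) (lam - 1) := fun r hr x => by
    simp only [hD.homogeneous h.homogeneous r hr x, mul_neg]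
  have he' : (-e) (Fin.last m) = 0 := by simp [he]
  have hlower := (tendsto_integral_dirDeriv_normalVec_cutBarrier (e := -e) h.ae_thin he'
    (h.ae_mem_contactCone.mono fun x hx => by simpa using hcone x hx)).const_mul (-(1 / 2 : ℝ))
  have hle := le_of_tendsto_of_tendsto hlower
    (tendsto_setIntegral_mul_laplacian_cutBarrier hloc hhom he' ((norm_neg e).trans hn) abs_one)
    (by
      filter_upwards [self_mem_nhdsWithin] with d hd
      have hbarrier := setIntegral_normalDeriv_mul_laplacian_le h.continuous h.even h.convex
        h.hasNegLaplacian h.ae_thin hD (isTestFunction_cutBarrier (-e) (1 * d) (pow_pos hd 2))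
        fun x _ => cutBarrier_nonneg _ _ _ x
      simp only [neg_mul, integral_neg]
      linarith)
  have hpos := integral_mul_halfHarmonic_mul_radialDensity_pos hloc hhom
    (by linarith [h.degree_pos]) (fun x hx => neg_nonneg.2 (h.normalDeriv_nonpos hD hx))
    (by simpa only [neg_eq_zero] using h.not_ae_normalDeriv_eq_zero hD) (-e)
  rw [mul_zero] at hle
  linarith [nonneg_of_mul_nonneg_left hle hpos]

theorem mem_span_contactCone (h : IsEvenSolution q μ lam) (hx : x (Fin.last m) = 0) :
    x ∈ Submodule.span ℝ (h.contactCone : Set (Space m)) := by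
  by_contra hxS
  set S := Submodule.span ℝ (h.contactCone : Set (Space m))
  obtain ⟨D, hD⟩ := h.exists_normalDeriv
  have hthin (y : Space m) (hy : y ∈ S) : y (Fin.last m) = 0 :=
    (Submodule.span_le (p := (EuclideanSpace.proj (𝕜 := ℝ) (Fin.last m)).ker)).2
      (fun y hy => hy.1) hy
  refine h.measure_ne_zero (measure_eq_zero_of_forall_integral_eq_zero fun φ hφ hφ₀ =>
    integral_eq_zero_of_ae_inner_eq_zero (e := x - S.starProjection x) h.continuous h.even h.convex
      h.hasNegLaplacian h.ae_thin hD ?_ (fun hzero => hxS ?_) ?_ hφ hφ₀)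
  · rw [PiLp.sub_apply, hx, hthin _ (S.starProjection_apply_mem x), sub_zero]
  · rw [sub_eq_zero.1 hzero]
    exact S.starProjection_apply_mem x
  · filter_upwards [h.ae_mem_contactCone] with y hy
    exact (S.mem_orthogonal' _).1 (S.sub_starProjection_mem_orthogonal x) y
      (Submodule.subset_span hy)

theorem exists_mem_contactCone_forall_add_smul_mem (h : IsEvenSolution q μ lam) :
    ∃ z ∈ h.contactCone, ∀ x : Space m, x (Fin.last m) = 0 →
      ∃ T : ℝ, ∀ t ≥ T, x + t • z ∈ h.contactCone := by
  obtain ⟨z, hz, hzT⟩ := exists_mem_forall_add_smul_mem h.contactCone.toPointedCone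
  exact ⟨z, hz, fun x hx => hzT x (h.mem_span_contactCone hx)⟩

end LocallyFinite

theorem apply_add_le_apply (h : IsEvenSolution q μ lam) (hz : z (Fin.last m) = 0)
    (hzT : ∀ x : Space m, x (Fin.last m) = 0 → ∃ T : ℝ, ∀ t ≥ T, x + t • z ∈ h.contactCone)
    (x : Space m) : q (x + z) ≤ q x := by
  obtain ⟨T, hT⟩ := hzT _ (sub_smul_normalVec_last x)
  have hmono : Monotone fun t : ℝ => q (x + z + t • -z) := by
    refine monotone_of_convexOn_of_forall_le (h.convex (x + z) (-z) (by simp [hz])) (T := 1 - T)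
      (C := 0) fun t ht => (h.apply_le_apply_sub_smul_normalVec _).trans_eq ?_
    have hproj : x + z + t • -z - (x + z + t • -z : Space m) (Fin.last m) • normalVec =
        x - x (Fin.last m) • normalVec + (1 - t) • z := by
      simp only [PiLp.add_apply, PiLp.smul_apply, PiLp.neg_apply, hz, neg_zero, smul_zero, add_zero]
      module
    rw [hproj]
    exact (hT (1 - t) (by linarith)).2
  simpa using hmono zero_le_one

theorem apply_eq_zero_of_forall_apply_add_eq (h : IsEvenSolution q μ lam)
    (hz : z (Fin.last m) = 0) (hinv : ∀ x : Space m, x (Fin.last m) = 0 → q (x + z) = q x)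
    (hzT : ∃ T : ℝ, ∀ t ≥ T, x + t • z ∈ h.contactCone) (hx : x (Fin.last m) = 0) : q x = 0 := by
  obtain ⟨T, hT⟩ := hzT
  obtain ⟨k, hk⟩ := exists_nat_ge T
  have hiter (k : ℕ) : q (x + (k : ℝ) • z) = q x := by
    induction k with
    | zero => simp
    | succ k ih =>
      rw [← ih, Nat.cast_succ, add_smul, one_smul, ← add_assoc, hinv _ (by simp [hx, hz])]
  exact (hiter k).symm.trans (hT k hk).2

variable [IsLocallyFiniteMeasure μ]

theorem exists_tangentialDeriv (h : IsEvenSolution q μ lam) (hx : x (Fin.last m) = 0)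
    (hqx : q x ≠ 0) :
    ∃ (w : Space m) (v : Space m → ℝ), w (Fin.last m) = 0 ∧ IsSymmDeriv w q v ∧
      (∀ x, 0 ≤ v x) ∧ ¬ ∀ᵐ x ∂(volume.restrict (upperHalfSpace m)), v x = 0 := by
  obtain ⟨z, ⟨hz, -⟩, hzT⟩ := h.exists_mem_contactCone_forall_add_smul_mem
  have hw : (-z) (Fin.last m) = 0 := by simp [hz]
  obtain ⟨v, hv, hdiff⟩ :=
    exists_isSymmDeriv_of_convexOn h.continuous (-z) fun x => h.convex x (-z) hw
  simp only [sub_neg_eq_add] at hdiff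
  have hle := h.apply_add_le_apply hz hzT
  refine ⟨-z, v, hw, hv, fun y => (sub_nonneg.2 (hle y)).trans (hdiff y), fun hzero => hqx ?_⟩
  have hae : (fun y => q (y + z)) =ᵐ[volume.restrict (upperHalfSpace m)] q :=
    hzero.mono fun y hy => (hle y).antisymm (sub_nonpos.1 ((hdiff y).trans_eq hy))
  exact h.apply_eq_zero_of_forall_apply_add_eq hz (fun y hy => eq_of_ae_eq_upperHalfSpace
    (h.continuous.comp (continuous_add_const z)) h.continuous hae hy.ge) (hzT x hx) hx

theorem le_three_halves (h : IsEvenSolution q μ lam) (he : e (Fin.last m) = 0) (hn : ‖e‖ = 1)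
    (hcone : ∀ x ∈ h.contactCone, ⟪e, x⟫ ≤ 0) (hx : x (Fin.last m) = 0) (hqx : q x ≠ 0) :
    lam ≤ 3 / 2 := by
  obtain ⟨D, hD⟩ := h.exists_normalDeriv
  obtain ⟨w, v, hw, hv, hv₀, hne⟩ := h.exists_tangentialDeriv hx hqx
  have hloc := hv.locallyIntegrable h.continuous volume
  have hhom := hv.homogeneous h.homogeneous
  have hupper := (tendsto_integral_dirDeriv_tangential_cutBarrier h.ae_thin hn
    (h.ae_mem_contactCone.mono hcone) hw).const_mul (1 / 2 : ℝ)
  have hle := le_of_tendsto_of_tendsto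
    (tendsto_setIntegral_mul_laplacian_cutBarrier hloc hhom he hn (τ := -1) (by simp)) hupper (by
      filter_upwards [self_mem_nhdsWithin] with d hd
      have hd₂ : (0 : ℝ) < d ^ 2 := pow_pos hd 2
      refine setIntegral_tangentialDeriv_mul_laplacian_le h.continuous h.even h.hasNegLaplacian
        h.ae_thin hD hw hv hv₀ (isTestFunction_cutBarrier e (-1 * d) hd₂)
        (isTestFunction_radialDensity.mul_left (contDiff_barrier e (-1 * d) hd₂)) fun x hx => ?_
      rw [dirDeriv_cutBarrier e _ hd₂, dirDeriv_normalVec_barrier he _ hd₂ (by linarith),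
        real_inner_comm normalVec x, inner_normalVec]
      linarith [mul_nonneg (halfPowerY_nonneg (⟪e, x⟫ + -1 * d) (add_nonneg hx hd₂.le))
        (radialCutoff_nonneg x)])
  have hpos := integral_mul_halfHarmonic_mul_radialDensity_pos hloc hhom
    (by linarith [h.degree_pos]) (fun x _ => hv₀ x) hne e
  rw [mul_zero] at hle
  linarith [nonpos_of_mul_nonpos_left hle hpos]

end IsEvenSolution

section LinearIsometry

variable {E : Type*} [NormedAddCommGroup E] [InnerProductSpace ℝ E]

theorem dirDeriv_comp_linearIsometryEquiv (L : E ≃ₗᵢ[ℝ] E) (ψ : E → ℝ) (e : E) :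
    dirDeriv e (fun x => ψ (L x)) = fun x => dirDeriv (L e) ψ (L x) := by
  ext x
  exact congrArg (· e) (L.toContinuousLinearEquiv.comp_right_fderiv (f := ψ) (x := x))

theorem IsTestFunction.comp_linearIsometryEquiv {φ : E → ℝ} (hφ : IsTestFunction φ)
    (L : E ≃ₗᵢ[ℝ] E) : IsTestFunction fun x => φ (L x) :=
  ⟨hφ.contDiff.comp L.contDiff, hφ.hasCompactSupport.comp_homeomorph L.toHomeomorph⟩

theorem laplacian_comp_linearIsometryEquiv [FiniteDimensional ℝ E] {φ : E → ℝ}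
    (hφ : ContDiff ℝ 2 φ) (L : E ≃ₗᵢ[ℝ] E) : Δ (fun x => φ (L x)) = fun x => Δ φ (L x) := by
  let b := stdOrthonormalBasis ℝ E
  have hcomp : ContDiff ℝ 2 fun x => φ (L x) := hφ.comp L.contDiff
  simp only [laplacian_eq_sum_dirDeriv b hcomp, laplacian_eq_sum_dirDeriv (b.map L) hφ,
    dirDeriv_comp_linearIsometryEquiv, OrthonormalBasis.map_apply]

end LinearIsometry

section Planar

variable {m : ℕ} {q ψ : Space m → ℝ} {lam : ℝ} {μ : Measure (Space m)}

theorem dirDeriv_coord_mul (i : Fin (m + 1)) (hψ : Differentiable ℝ ψ) (x : Space m) :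
    dirDeriv (basisVec i) (fun x => x i * ψ x) x = x i * dirDeriv (basisVec i) ψ x + ψ x := by
  have hcoord : dirDeriv (basisVec i) (fun x : Space m => x i) x = 1 := by
    simp [dirDeriv, (hasFDerivAt_coord i x).fderiv, basisVec]
  rw [dirDeriv_mul_apply _ (hasFDerivAt_coord i x).differentiableAt (hψ x), hcoord, one_mul]

theorem sum_dirDeriv_coord_mul (hψ : Differentiable ℝ ψ) (x : Space m) :
    ∑ i, dirDeriv (basisVec i) (fun x => x i * ψ x) x = radialDeriv ψ x + (m + 1) * ψ x := by
  simp only [dirDeriv_coord_mul _ hψ, Finset.sum_add_distrib]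
  rw [radialDeriv_eq_sum (EuclideanSpace.basisFun _ ℝ)]
  simp [basisVec, EuclideanSpace.inner_single_right]

theorem integral_mul_dirDeriv_coord_last_mul (hq : LocallyIntegrable q)
    (hhom : IsHomogeneousOfDegree q lam)
    (hinv : ∀ e : Space m, e (Fin.last m) = 0 → ∀ x (t : ℝ), q (x + t • e) = q x)
    (hψ : IsTestFunction ψ) :
    ∫ x, q x * dirDeriv normalVec (fun x => x (Fin.last m) * ψ x) x = -lam * ∫ x, q x * ψ x := by
  have hcoord (i : Fin (m + 1)) : IsTestFunction fun x : Space m => x i * ψ x :=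
    hψ.mul_left (contDiff_coord i)
  have hdivergence : ∫ x, q x * ∑ i, dirDeriv (basisVec i) (fun x => x i * ψ x) x =
      -lam * ∫ x, q x * ψ x := by
    simp only [sum_dirDeriv_coord_mul hψ.differentiable, mul_add, mul_left_comm (q _) (_ + _)]
    rw [integral_add (hψ.radialDeriv.integrable_mul hq) ((hψ.integrable_mul hq).const_mul _),
      integral_const_mul, integral_mul_radialDeriv_of_homogeneous hq hhom hψ,
      finrank_euclideanSpace_fin]
    push_cast
    ring
  simp only [Finset.mul_sum] at hdivergence
  rw [integral_finsetSum _ fun i _ => ((hcoord i).dirDeriv _).integrable_mul hq,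
    Fin.sum_univ_castSucc, Finset.sum_eq_zero fun i _ =>
      integral_mul_dirDeriv_eq_zero_of_forall_add_smul hq (hcoord i.castSucc)
        (hinv _ (basisVec_castSucc_last i)), zero_add] at hdivergence
  exact hdivergence

theorem integral_mul_dirDeriv_dirDeriv_sq_mul (hq : LocallyIntegrable q)
    (hhom : IsHomogeneousOfDegree q lam)
    (hinv : ∀ e : Space m, e (Fin.last m) = 0 → ∀ x (t : ℝ), q (x + t • e) = q x)
    (hψ : IsTestFunction ψ) :
    ∫ x, q x * dirDeriv normalVec (dirDeriv normalVec
        fun x => x (Fin.last m) * (x (Fin.last m) * ψ x)) x =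
      lam * (lam - 1) * ∫ x, q x * ψ x := by
  have hχ : IsTestFunction fun x : Space m => x (Fin.last m) * ψ x :=
    hψ.mul_left (contDiff_coord _)
  have hfactor : dirDeriv normalVec (fun x => x (Fin.last m) * (x (Fin.last m) * ψ x)) =
      fun x => x (Fin.last m) *
        (dirDeriv normalVec (fun x => x (Fin.last m) * ψ x) x + ψ x) := by
    ext x
    rw [normalVec, dirDeriv_coord_mul _ hχ.differentiable, mul_add]
  rw [hfactor, integral_mul_dirDeriv_coord_last_mul hq hhom hinv ((hχ.dirDeriv _).add hψ)]
  simp only [mul_add]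
  rw [integral_add ((hχ.dirDeriv _).integrable_mul hq) (hψ.integrable_mul hq),
    integral_mul_dirDeriv_coord_last_mul hq hhom hinv hψ]
  ring

theorem mul_sub_one_eq_zero_of_forall_add_smul (hq : LocallyIntegrable q)
    (hhom : IsHomogeneousOfDegree q lam)
    (hinv : ∀ e : Space m, e (Fin.last m) = 0 → ∀ x (t : ℝ), q (x + t • e) = q x)
    (hμ : HasNegLaplacian q μ) (hthin : ∀ᵐ x ∂μ, x (Fin.last m) = 0) (hψ : IsTestFunction ψ)
    (hne : ∫ x, q x * ψ x ≠ 0) : lam * (lam - 1) = 0 := by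
  have hφ : IsTestFunction fun x : Space m => x (Fin.last m) * (x (Fin.last m) * ψ x) :=
    (hψ.mul_left (contDiff_coord _)).mul_left (contDiff_coord _)
  have hlap := hμ _ hφ.contDiff hφ.hasCompactSupport
  have htan : ∫ x, q x * tangentialLaplacian
      (fun x : Space m => x (Fin.last m) * (x (Fin.last m) * ψ x)) x = 0 := by
    simp only [tangentialLaplacian, Finset.mul_sum]
    rw [integral_finsetSum _ fun i _ => ((hφ.dirDeriv _).dirDeriv _).integrable_mul hq]
    exact Finset.sum_eq_zero fun i _ => integral_mul_dirDeriv_eq_zero_of_forall_add_smul hq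
      (hφ.dirDeriv _) (hinv _ (basisVec_castSucc_last i))
  have hmass : ∫ x : Space m, x (Fin.last m) * (x (Fin.last m) * ψ x) ∂μ = 0 :=
    integral_eq_zero_of_ae (hthin.mono fun x hx => by simp [hx])
  rw [integral_mul_laplacian_eq_tangential_add_normal hq hφ, htan, hmass, zero_add, neg_zero,
    integral_mul_dirDeriv_dirDeriv_sq_mul hq hhom hinv hψ] at hlap
  exact (mul_eq_zero.1 hlap).resolve_right hne

end Planar

namespace IsEvenSolution

variable {m : ℕ} {q : Space m → ℝ} {μ : Measure (Space m)} {lam : ℝ}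

theorem apply_add_eq_of_nonpos (h : IsEvenSolution q μ lam) (hq : ∀ x, q x ≤ 0) {e : Space m}
    (he : e (Fin.last m) = 0) (x : Space m) : q (x + e) = q x := by
  have hle (e : Space m) (he : e (Fin.last m) = 0) (x : Space m) : q x ≤ q (x + e) := by
    simpa using monotone_of_convexOn_of_forall_le (h.convex x e he) (T := 0) (C := 0)
      (fun t _ => hq _) zero_le_one
  refine (hle e he x).antisymm' ?_
  simpa using hle (-e) (by simp [he]) (x + e)

theorem eq_abs_rpow_mul_of_nonpos (h : IsEvenSolution q μ lam) (hq : ∀ x, q x ≤ 0)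
    (x : Space m) : q x = |x (Fin.last m)| ^ lam * q normalVec := by
  rw [h.apply_eq_apply_sub_add_abs_smul, add_comm,
    h.apply_add_eq_of_nonpos hq (sub_smul_normalVec_last x)]
  rcases (abs_nonneg (x (Fin.last m))).eq_or_lt with hzero | hpos
  · rw [← hzero, zero_smul, h.apply_zero, Real.zero_rpow h.degree_pos.ne', zero_mul]
  · exact h.homogeneous _ hpos _

variable [IsLocallyFiniteMeasure μ]

theorem ne_zero (h : IsEvenSolution q μ lam) : q ≠ 0 := by
  rintro rfl
  refine h.measure_ne_zero (measure_eq_zero_of_forall_integral_eq_zero fun φ hφ _ => ?_)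
  simpa using (h.hasNegLaplacian φ hφ.contDiff hφ.hasCompactSupport).symm

theorem integral_mul_radialCutoff_ne_zero_of_nonpos (h : IsEvenSolution q μ lam)
    (hq : ∀ x, q x ≤ 0) : ∫ x, q x * radialCutoff x ≠ 0 := by
  intro hzero
  have hae := ae_eq_zero_of_homogeneous_of_integral_mul_radialCutoff (u := fun x => -q x)
    (ν := volume) h.continuous.neg.locallyIntegrable
    (fun r hr x => by rw [h.homogeneous r hr, mul_neg]) (fun x => neg_nonneg.2 (hq x))
    (by simp only [neg_mul, integral_neg, hzero, neg_zero])
  exact h.ne_zero ((h.continuous.ae_eq_iff_eq volume continuous_zero).1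
    (hae.mono fun x hx => neg_eq_zero.1 hx))

theorem eq_neg_mul_abs_of_nonpos (h : IsEvenSolution q μ lam) (hq : ∀ x, q x ≤ 0) :
    lam = 1 ∧ ∃ b : ℝ, 0 < b ∧ ∀ x, q x = -(b * |x (Fin.last m)|) := by
  have hinv (e : Space m) (he : e (Fin.last m) = 0) (x : Space m) (t : ℝ) :
      q (x + t • e) = q x :=
    h.apply_add_eq_of_nonpos hq (by simp [he]) x
  have hlam : lam = 1 := sub_eq_zero.1 ((mul_eq_zero.1 (mul_sub_one_eq_zero_of_forall_add_smul
    h.continuous.locallyIntegrable h.homogeneous hinv h.hasNegLaplacian h.ae_thin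
    isTestFunction_radialCutoff (h.integral_mul_radialCutoff_ne_zero_of_nonpos hq))).resolve_left
    h.degree_pos.ne')
  have hform := h.eq_abs_rpow_mul_of_nonpos hq
  have hnormal : q normalVec ≠ 0 := fun hzero =>
    h.ne_zero (funext fun x => by simp [hform x, hzero])
  refine ⟨hlam, -q normalVec, neg_pos.2 ((hq _).lt_of_ne hnormal), fun x => ?_⟩
  rw [hform, hlam, Real.rpow_one]
  ring

theorem degree_eq_or_eq_neg_mul_abs (h : IsEvenSolution q μ lam) :
    lam = 3 / 2 ∨ (lam = 1 ∧ ∃ b : ℝ, 0 < b ∧ ∀ x, q x = -(b * |x (Fin.last m)|)) := by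
  by_cases hcontact : ∀ x : Space m, x (Fin.last m) = 0 → q x = 0
  · exact Or.inr (h.eq_neg_mul_abs_of_nonpos fun x =>
      (h.apply_le_apply_sub_smul_normalVec x).trans_eq (hcontact _ (sub_smul_normalVec_last x)))
  · push Not at hcontact
    obtain ⟨x, hx, hqx⟩ := hcontact
    obtain ⟨e, he, hn, hcone⟩ := exists_tangential_forall_inner_nonpos h.contactCone
      (fun y hy => hy.1) hx fun hmem => hqx hmem.2
    exact Or.inl ((h.le_three_halves he hn hcone hx hqx).antisymm (h.three_halves_le he hn hcone))

end IsEvenSolution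

/-! ### Reduction to even solutions -/

section EvenPart

variable {m : ℕ} {q : Space m → ℝ} {μ : Measure (Space m)} {lam : ℝ}

/-- The part of `q` that is even in the normal variable. It has the same Laplacian as `q` when
that is carried by the thin space, so that only a linear function is lost in passing to it. -/
noncomputable def evenPart (q : Space m → ℝ) (x : Space m) : ℝ :=
  (q x + q (mirror x)) / 2

theorem evenPart_mirror (q : Space m → ℝ) (x : Space m) : evenPart q (mirror x) = evenPart q x := by
  rw [evenPart, evenPart, mirror_mirror, add_comm]

theorem evenPart_of_thin {x : Space m} (hx : x (Fin.last m) = 0) : evenPart q x = q x := by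
  rw [evenPart, mirror_of_thin hx, add_self_div_two]

theorem continuous_evenPart (hq : Continuous q) : Continuous (evenPart q) :=
  (hq.add (hq.comp mirror.continuous)).div_const 2

theorem isHomogeneousOfDegree_evenPart (h : IsHomogeneousOfDegree q lam) :
    IsHomogeneousOfDegree (evenPart q) lam := fun r hr x => by
  rw [evenPart, evenPart, map_smul, h r hr, h r hr]
  ring

theorem isConvexAlongThin_evenPart (h : IsConvexAlongThin q) :
    IsConvexAlongThin (evenPart q) := fun x e he => by
  have hsum := ((h x e he).add (h (mirror x) e he)).smul (one_half_pos (α := ℝ)).le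
  refine hsum.congr fun t _ => ?_
  simp only [evenPart, map_add, map_smul, mirror_of_thin he, Pi.add_apply, smul_eq_mul]
  ring

theorem hasNegLaplacian_evenPart (hμ : HasNegLaplacian q μ) (hq : Continuous q)
    (hthin : ∀ᵐ x ∂μ, x (Fin.last m) = 0) : HasNegLaplacian (evenPart q) μ := by
  intro φ hφ₁ hφ₂
  have hφ : IsTestFunction φ := ⟨hφ₁, hφ₂⟩
  have hφ' := hφ.comp_linearIsometryEquiv mirror
  have hcomp : Continuous fun x => q (mirror x) := hq.comp mirror.continuous
  have hmass : ∫ x, φ (mirror x) ∂μ = ∫ x, φ x ∂μ :=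
    integral_congr_ae (hthin.mono fun x hx => by simp only [mirror_of_thin hx])
  have hreflected : ∫ x, q (mirror x) * Δ φ x = -∫ x, φ x ∂μ := by
    rw [← hmass, ← hμ _ hφ'.contDiff hφ'.hasCompactSupport,
      laplacian_comp_linearIsometryEquiv (contDiff_infty.1 hφ₁ 2), ← integral_comp_mirror]
    simp only [mirror_mirror]
  simp only [evenPart, div_mul_eq_mul_div, add_mul]
  rw [integral_div, integral_add (hφ.laplacian.integrable_mul hq.locallyIntegrable)
    (hφ.laplacian.integrable_mul hcomp.locallyIntegrable), hreflected,
    hμ φ hφ₁ hφ₂, add_self_div_two]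

theorem isWeaklyHarmonic_sub_evenPart (hμ : HasNegLaplacian q μ) (hq : Continuous q)
    (hthin : ∀ᵐ x ∂μ, x (Fin.last m) = 0) : IsWeaklyHarmonic fun x => q x - evenPart q x := by
  intro φ hφ
  simp only [sub_mul]
  rw [integral_sub (hφ.laplacian.integrable_mul hq.locallyIntegrable)
      (hφ.laplacian.integrable_mul (continuous_evenPart hq).locallyIntegrable),
    hμ φ hφ.contDiff hφ.hasCompactSupport,
    hasNegLaplacian_evenPart hμ hq hthin φ hφ.contDiff hφ.hasCompactSupport, sub_self]

theorem exists_eq_mul_last_add_evenPart (hμ : HasNegLaplacian q μ) (hq : Continuous q)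
    (hthin : ∀ᵐ x ∂μ, x (Fin.last m) = 0) (hhom : IsHomogeneousOfDegree q 1) :
    ∃ a : ℝ, ∀ x : Space m, q x = a * x (Fin.last m) + evenPart q x := by
  have hodd : IsHomogeneousOfDegree (fun x => q x - evenPart q x) 1 := fun r hr x => by
    simp only [hhom r hr, isHomogeneousOfDegree_evenPart hhom r hr, mul_sub]
  obtain ⟨c, hc⟩ := hodd.exists_eq_sum_mul
    ((isWeaklyHarmonic_sub_evenPart hμ hq hthin).contDiff (hq.sub (continuous_evenPart hq)))
  have htan (i : Fin m) : c i.castSucc = 0 := by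
    have hi := hc (basisVec i.castSucc)
    simp only [evenPart_of_thin (basisVec_castSucc_last i), sub_self] at hi
    simpa [basisVec, eq_comm] using hi
  refine ⟨c (Fin.last m), fun x => ?_⟩
  have hx := hc x
  simp only [Fin.sum_univ_castSucc, htan, mul_zero, Finset.sum_const_zero, zero_add] at hx
  linarith

theorem isEvenSolution_evenPart (hμ : HasNegLaplacian q μ) (hq : Continuous q)
    (hthin : ∀ᵐ x ∂μ, x (Fin.last m) = 0) (hzero : ∀ᵐ x ∂μ, q x = 0)
    (hnonneg : ∀ x : Space m, x (Fin.last m) = 0 → 0 ≤ q x) (hconv : IsConvexAlongThin q)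
    (hhom : IsHomogeneousOfDegree q lam) (hlam : 0 < lam) (hne : μ ≠ 0) :
    IsEvenSolution (evenPart q) μ lam where
  continuous := continuous_evenPart hq
  even := evenPart_mirror q
  hasNegLaplacian := hasNegLaplacian_evenPart hμ hq hthin
  ae_thin := hthin
  ae_eq_zero := by
    filter_upwards [hthin, hzero] with x hx hqx
    rw [evenPart_of_thin hx, hqx]
  nonneg_on_thin x hx := (hnonneg x hx).trans_eq (evenPart_of_thin hx).symm
  convex := isConvexAlongThin_evenPart hconv
  homogeneous := isHomogeneousOfDegree_evenPart hhom
  degree_pos := hlam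
  measure_ne_zero := hne

end EvenPart

theorem isHarmonicPolynomial_const {m : ℕ} (c : ℝ) :
    IsHarmonicPolynomial fun _ : Space m => c :=
  ⟨⟨MvPolynomial.C c, fun _ => (MvPolynomial.eval_C c).symm⟩,
    InnerProductSpace.harmonicOnNhd_const c⟩

theorem mainTheorem8 (m : ℕ) (lam : ℝ) (q : Space m → ℝ)
    (hq : IsSignoriniSolution q)
    (hne : ∃ x, q x ≠ 0)
    (hhom : IsHomogeneousOfDegree q lam)
    (hconv : IsConvexAlongThin q) :
    lam = 3 / 2 ∨
      (IsHarmonicPolynomial q ∧ ∃ k : ℤ, lam = k) ∨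
      (lam = 1 ∧ ∃ a b : ℝ, 0 < b ∧
        ∀ x : Space m, q x = a * x (Fin.last m) - b * |x (Fin.last m)|) := by
  have hcont := hq.continuous
  have hne₀ : q ≠ 0 := Function.ne_iff.2 hne
  obtain ⟨μ, _, hμ, hzero, hthin⟩ := hq.laplacian
  have hthin : ∀ᵐ x ∂μ, x (Fin.last m) = 0 := ae_iff.2 hthin
  by_cases hμ₀ : μ = 0
  · have hharm : IsWeaklyHarmonic q := fun φ hφ => by
      simpa [hμ₀] using hμ φ hφ.contDiff hφ.hasCompactSupport
    obtain ⟨k, hk⟩ := hharm.exists_natCast_eq_degree hcont hhom hne₀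
    exact Or.inr (Or.inl ⟨hharm.isHarmonicPolynomial hcont hhom, k, by simpa using hk⟩)
  rcases lt_trichotomy lam 0 with hlam | rfl | hlam
  · exact absurd (hhom.eq_zero_of_neg hcont hlam) hne₀
  · refine Or.inr (Or.inl ⟨?_, 0, by simp⟩)
    rw [funext (hhom.eq_const hcont)]
    exact isHarmonicPolynomial_const (q 0)
  · rcases (isEvenSolution_evenPart hμ hcont hthin hzero hq.nonneg_on_thin hconv hhom hlam
      hμ₀).degree_eq_or_eq_neg_mul_abs with hdeg | ⟨rfl, b, hb, heven⟩
    · exact Or.inl hdeg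
    · obtain ⟨a, ha⟩ := exists_eq_mul_last_add_evenPart hμ hcont hthin hhom
      exact Or.inr (Or.inr ⟨rfl, a, b, hb, fun x => by rw [ha, heven, sub_eq_add_neg]⟩)
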